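/- **Proposition (inf-sup for $a(\cdot,\cdot)$).** *Meshes.* Let $\Omega\subset\mathbb R^2$ be a polygonal domain and $\mathcal T_h$ a finite partition of $\Omega$ into non-overlapping polygons $K$ (with diameters $h_K$, $h=\max_K h_K$), such that each side of an element lies on $\partial\Omega$ or is also a side of a neighbouring element (vertices with a straight angle are allowed). For constants $\gamma_0,\gamma_1>0$ assume that each $K\in\mathcal T_h$ is star-shaped with respect to a ball of radius $\ge\gamma_0h_K$ and that any two vertices of $K$ have distance $\ge\gamma_1h_K$. Let $\Sigma=\bigcup_K\partial K$, let $n$ be a choice of a unit normal on each edge of $\Sigma$ pointing outwards on $\partial\Omega$, and $n_K$ the outer unit normal of $K$. The jump $[\![u]\!]$ on an edge $e$ is the sum of $u^Kn_K$ over the one or two elements $K$ having $e$ as a side. *Norms.* For $g\in H^1(K)$ let $\bar g^K=|K|^{-1}\int_Kg$, $|g|_{1,K}=\|\nabla g\|_{0,K}$, $\|g\|_{1,K}^2=|\bar g^K|^2+|g|_{1,K}^2$; for $F\in(H^1(K))'$ let $$\|F\|_{-1,K}=\sup_{g\in H^1(K)}\frac{\langle F,g\rangle}{\|g\|_{1,K}},\qquad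 |F|_{-1,K}=\sup_{g\in H^1(K),\ \bar g^K=0}\frac{\langle F,g\rangle}{|g|_{1,K}} .$$ Let $\langle Du,v\rangle=\int_K\nabla u\cdot\nabla v$ for $u,v\in H^1(K)$, and $\langle\gamma_K^*\lambda,v\rangle=\int_{\partial K}\lambda\,(n_K\cdot n)\,v$ for $\lambda\in L^2(\Sigma)$, $v\in H^1(K)$. *Discrete spaces.* Let $k,k'\ge0$ be integers with $k'\in\{k-1,k\}$, let $V_h=\prod_K\mathbb P_k(K)$, let $\Lambda_h=\{\lambda\in L^2(\Sigma):\lambda|_e\in\mathbb P_{k'}(e)\text{ for all edges }e\}$, and let $\mathbb V_h=V_h\times\Lambda_h$ be endowed with the norm $$\|(u,\lambda)\|_{\mathbb V_h}^2=\|u\|_{1,\mathcal T_h}^2+|||\lambda|||_{-1/2,\Sigma}^2,\quad \|u\|_{1,\mathcal T_h}^2=\sum_K|u^K|_{1,K}^2+\sum_{e\subset\Sigma}|[\![\bar u]\!]|^2,\quad |||\lambda|||_{-1/2,\Sigma}^2=\sum_K\|\gamma_K^*\lambda\|_{-1,K}^2,$$ where $\bar u$ is the piecewise constant function with value $\bar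 u^K$ on $K$. *Stabilization.* For each $K$ let $s_K$ be a bilinear form on $(H^1(K))'$, and let $M(k),\rho(k)>0$ be such that, for all $K\in\mathcal T_h$, $$s_K(F,G)\le M(k)\,|F|_{-1,K}|G|_{-1,K}\ \ \forall F,G\in(H^1(K))',\qquad s_K(\gamma_K^*\lambda,\gamma_K^*\lambda)\ge\rho(k)\,|\gamma_K^*\lambda|_{-1,K}^2\ \ \forall\lambda\in\Lambda_h .$$ For $t\in\{1,-1\}$ and $\alpha>0$ let $$a(u,\lambda;v,\mu)=\sum_K\int_K\nabla u^K\cdot\nabla v^K-\int_\Sigma\lambda[\![v]\!]\cdot n+\int_\Sigma\mu[\![u]\!]\cdot n+\alpha\sum_Ks_K(Du^K-\gamma_K^*\lambda,\ tDv^K-\gamma_K^*\mu).$$ *Claim.* There is a constant $C_0>0$ depending only on $\gamma_0,\gamma_1$ such that for each $C\in(0,C_0]$ there is a constant $c>0$, depending only on $\gamma_0,\gamma_1,C$ (in particular not on $\Omega$, the mesh, $h$, $k$, $k'$, $M(k)$, $\rho(k)$ or the forms $s_K$), such that with the choice $\alpha=C\,\rho(k)/M(k)^2$ $$\inf_{0\ne(u,\lambda)\in\mathbb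 V_h}\ \sup_{0\ne(v,\mu)\in\mathbb V_h}\frac{a(u,\lambda;v,\mu)}{\|(u,\lambda)\|_{\mathbb V_h}\|(v,\mu)\|_{\mathbb V_h}}\ \ge\ c\left(\frac{\rho(k)}{M(k)}\right)^2 .$$ -/

import Mathlib

open MeasureTheory Set Filter Topology
open scoped ContDiff RealInnerProductSpace

noncomputable section

/-- The Euclidean plane. -/
abbrev Plane : Type := EuclideanSpace ℝ (Fin 2)

/-! ### The Sobolev space `H¹(U)` -/

/-- `g` is the weak gradient of `u` on the open set `U` (tested against `C_c^∞(U)`). -/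
def IsWeakGradient (U : Set Plane) (u : Plane → ℝ) (g : Plane → Plane) : Prop :=
  ∀ φ : Plane → ℝ, ContDiff ℝ ∞ φ → HasCompactSupport φ → tsupport φ ⊆ U → ∀ d : Plane,
    ∫ x in U, u x * fderiv ℝ φ x d = -∫ x in U, ⟪g x, d⟫ * φ x

theorem integrable_mul_test {U : Set Plane} {f ψ : Plane → ℝ}
    (hf : MemLp f 2 (volume.restrict U)) (hψ : Continuous ψ) (hs : HasCompactSupport ψ) :
    Integrable (fun x => f x * ψ x) (volume.restrict U) :=
  MemLp.integrable_mul (p := 2) (q := 2) hf (hψ.memLp_of_hasCompactSupport hs)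

theorem continuous_fderiv_test {φ : Plane → ℝ} (h : ContDiff ℝ ∞ φ) (d : Plane) :
    Continuous (fun x => fderiv ℝ φ x d) :=
  (h.continuous_fderiv (by simp)).clm_apply continuous_const

theorem memLp_inner_const {U : Set Plane} {g : Plane → Plane}
    (hg : MemLp g 2 (volume.restrict U)) (d : Plane) :
    MemLp (fun x => ⟪g x, d⟫) 2 (volume.restrict U) :=
  hg.inner_const d

/-- `H¹(U)`: the pairs `(u, ∇u)` in `L²(U) × L²(U)²` in which `∇u` is the weak gradient of `u`,
with the topology of `L²(U) × L²(U)²`, that is, of the usual `H¹` norm. -/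
def H1 (U : Set Plane) :
    Submodule ℝ (Lp ℝ 2 (volume.restrict U) × Lp Plane 2 (volume.restrict U)) where
  carrier := {w | IsWeakGradient U w.1 w.2}
  zero_mem' := by
    intro φ _ _ _ d
    have h1 : ∫ x in U, (0 : Lp ℝ 2 (volume.restrict U)) x * fderiv ℝ φ x d = 0 := by
      refine integral_eq_zero_of_ae ?_
      filter_upwards [Lp.coeFn_zero ℝ 2 (volume.restrict U)] with x hx
      rw [hx, Pi.zero_apply, zero_mul]
    have h2 : ∫ x in U, ⟪(0 : Lp Plane 2 (volume.restrict U)) x, d⟫ * φ x = 0 := by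
      refine integral_eq_zero_of_ae ?_
      filter_upwards [Lp.coeFn_zero Plane 2 (volume.restrict U)] with x hx
      rw [hx, Pi.zero_apply, inner_zero_left, zero_mul]; rfl
    exact h1.trans (by rw [Prod.snd_zero, h2, neg_zero])
  add_mem' := by
    intro w z hw hz φ hφ hc hs d
    have hD : HasCompactSupport (fun x => fderiv ℝ φ x d) :=
      (hc.fderiv (𝕜 := ℝ)).comp_left (g := fun L : Plane →L[ℝ] ℝ => L d) (by simp)
    have e1 : ∫ x in U, (w + z).1 x * fderiv ℝ φ x d
        = (∫ x in U, w.1 x * fderiv ℝ φ x d) + ∫ x in U, z.1 x * fderiv ℝ φ x d := by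
      rw [← integral_add
        (integrable_mul_test (Lp.memLp w.1) (continuous_fderiv_test hφ d) hD)
        (integrable_mul_test (Lp.memLp z.1) (continuous_fderiv_test hφ d) hD)]
      refine integral_congr_ae ?_
      filter_upwards [Lp.coeFn_add w.1 z.1] with x hx
      rw [Prod.fst_add, hx, Pi.add_apply, add_mul]
    have e2 : ∫ x in U, ⟪(w + z).2 x, d⟫ * φ x
        = (∫ x in U, ⟪w.2 x, d⟫ * φ x) + ∫ x in U, ⟪z.2 x, d⟫ * φ x := by
      rw [← integral_add
        (integrable_mul_test (memLp_inner_const (Lp.memLp w.2) d) hφ.continuous hc)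
        (integrable_mul_test (memLp_inner_const (Lp.memLp z.2) d) hφ.continuous hc)]
      refine integral_congr_ae ?_
      filter_upwards [Lp.coeFn_add w.2 z.2] with x hx
      rw [Prod.snd_add, hx, Pi.add_apply, inner_add_left, add_mul]
    rw [e1, e2, hw φ hφ hc hs d, hz φ hφ hc hs d, neg_add]
  smul_mem' := by
    intro c w hw φ hφ hc hs d
    have e1 : ∫ x in U, (c • w).1 x * fderiv ℝ φ x d
        = c * ∫ x in U, w.1 x * fderiv ℝ φ x d := by
      rw [← integral_const_mul]
      refine integral_congr_ae ?_
      filter_upwards [Lp.coeFn_smul c w.1] with x hx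
      rw [Prod.smul_fst, hx, Pi.smul_apply, smul_eq_mul, mul_assoc]
    have e2 : ∫ x in U, ⟪(c • w).2 x, d⟫ * φ x = c * ∫ x in U, ⟪w.2 x, d⟫ * φ x := by
      rw [← integral_const_mul]
      refine integral_congr_ae ?_
      filter_upwards [Lp.coeFn_smul c w.2] with x hx
      rw [Prod.smul_snd, hx, Pi.smul_apply, real_inner_smul_left, mul_assoc]
    rw [e1, e2, hw φ hφ hc hs d, mul_neg]

namespace H1

variable {U : Set Plane}

/-- The function underlying an element of `H¹(U)`. -/
def fn (u : H1 U) : Plane → ℝ := u.1.1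

/-- The weak gradient, as a continuous linear map into `L²(U)²`. -/
def grad : H1 U →L[ℝ] Lp Plane 2 (volume.restrict U) :=
  (ContinuousLinearMap.snd ℝ _ _).comp (H1 U).subtypeL

/-- The mean value of `u` on `U`. -/
def mean (u : H1 U) : ℝ := ⨍ x in U, fn u x

/-- `|u|_{1,U} = (∫_U |∇u|²)^{1/2}`. -/
def seminorm (u : H1 U) : ℝ := ‖grad u‖

/-- `‖u‖_{1,U} = (|mean u|² + |u|_{1,U}²)^{1/2}`. -/
def meanNorm (u : H1 U) : ℝ := Real.sqrt (mean u ^ 2 + seminorm u ^ 2)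

/-- The dual space `(H¹(U))'`. -/
abbrev Dual (U : Set Plane) : Type := H1 U →L[ℝ] ℝ

/-- `‖F‖_{-1,U}`, the norm dual to `‖·‖_{1,U}`. -/
def dualNorm (F : Dual U) : ℝ := ⨆ g : H1 U, F g / meanNorm g

/-- `|F|_{-1,U}`, the supremum of `⟨F, g⟩ / |g|_{1,U}` over the `g` with mean value zero. -/
def dualSeminorm (F : Dual U) : ℝ := ⨆ g : {g : H1 U // mean g = 0}, F g.1 / seminorm g.1

/-- The operator `D : H¹(U) → (H¹(U))'`, `⟨D u, v⟩ = ∫_U ∇u · ∇v`. -/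
def D (u : H1 U) : Dual U := (innerSL ℝ (grad u)).comp grad

end H1

/-! ### Polygons -/

/-- A polygon: a bounded, connected open set whose boundary is a simple closed polygonal line.
The `m + 3` vertices are listed counterclockwise; `i + 1` is cyclic. A vertex may have a straight
angle, so that a side of a neighbouring polygon may end there. -/
structure MeshPolygon where
  m : ℕ
  vertex : Fin (m + 3) → Plane
  carrier : Set Plane
  vertex_injective : Function.Injective vertex
  /-- two distinct sides can meet only in a common end point -/
  simple : ∀ i j, i ≠ j → Disjoint (openSegment ℝ (vertex i) (vertex (i + 1)))
    (segment ℝ (vertex j) (vertex (j + 1)))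
  isOpen : IsOpen carrier
  isConnected : IsConnected carrier
  isBounded : Bornology.IsBounded carrier
  frontier_eq : frontier carrier = ⋃ i, segment ℝ (vertex i) (vertex (i + 1))
  /-- the polygon lies to the left of each side -/
  left : ∀ i, ∀ x ∈ openSegment ℝ (vertex i) (vertex (i + 1)), ∀ᶠ ε in 𝓝[>] (0 : ℝ),
    x + ε • !₂[-((vertex (i + 1) - vertex i) 1), (vertex (i + 1) - vertex i) 0] ∈ carrier ∧
    x - ε • !₂[-((vertex (i + 1) - vertex i) 1), (vertex (i + 1) - vertex i) 0] ∉ carrier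

namespace MeshPolygon

/-- The index set of the vertices, and of the sides, of a polygon. -/
abbrev Idx (K : MeshPolygon) : Type := Fin (K.m + 3)

/-- The closed side from vertex `j` to vertex `j + 1`. -/
def side (K : MeshPolygon) (j : K.Idx) : Set Plane := segment ℝ (K.vertex j) (K.vertex (j + 1))

/-- The outer unit normal of `K` on its side `j`. -/
def normal (K : MeshPolygon) (j : K.Idx) : Plane :=
  ‖K.vertex (j + 1) - K.vertex j‖⁻¹ •
    !₂[(K.vertex (j + 1) - K.vertex j) 1, -((K.vertex (j + 1) - K.vertex j) 0)]

/-- The space `H¹(K)`. -/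
abbrev H1 (K : MeshPolygon) : Type := ↥(_root_.H1 K.carrier)

/-- The space `L²(e)` on a segment `e`, with respect to arc length. -/
abbrev _root_.L2Seg (e : Set Plane) : Type := Lp ℝ 2 (Measure.restrict μH[1] e)

/-- `T` is the trace operator from `H¹(K)` to `L²` of the side `j`: it is continuous and maps each
function that is smooth up to the boundary to its restriction. -/
def IsTrace (K : MeshPolygon) (j : K.Idx) (T : K.H1 →L[ℝ] L2Seg (K.side j)) : Prop :=
  ∀ (u : K.H1) (φ : Plane → ℝ), ContDiff ℝ ∞ φ → _root_.H1.fn u =ᵐ[volume.restrict K.carrier] φ →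
    T u =ᵐ[Measure.restrict μH[1] (K.side j)] φ

open Classical in
/-- The trace operator `H¹(K) → L²(e)` on the side `e` with index `j`. (A polygon is a Lipschitz
domain, hence there is exactly one operator with the property `IsTrace`.) -/
def trace (K : MeshPolygon) (j : K.Idx) : K.H1 →L[ℝ] L2Seg (K.side j) :=
  if h : ∃ T, K.IsTrace j T then h.choose else 0

/-- `K` is star-shaped with respect to a ball of radius `≥ γ₀ h_K`, and its vertices have mutual
distances `≥ γ₁ h_K`, where `h_K` is the diameter. -/
structure ShapeRegular (γ₀ γ₁ : ℝ) (K : MeshPolygon) : Prop where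
  star : ∃ (x₀ : Plane) (r : ℝ), γ₀ * Metric.diam K.carrier ≤ r ∧
    ∀ y ∈ Metric.ball x₀ r, StarConvex ℝ y K.carrier
  dist_vertex : ∀ i j, i ≠ j → γ₁ * Metric.diam K.carrier ≤ dist (K.vertex i) (K.vertex j)

end MeshPolygon

/-! ### Meshes -/

/-- A polygonal domain (possibly with holes, but without slits). -/
structure IsPolygonalDomain (Ω : Set Plane) : Prop where
  isOpen : IsOpen Ω
  isConnected : IsConnected Ω
  isBounded : Bornology.IsBounded Ω
  interior_closure : interior (closure Ω) = Ω
  frontier_eq : ∃ S : Finset (Plane × Plane), frontier Ω = ⋃ p ∈ S, segment ℝ p.1 p.2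

section Mesh

variable {ι : Type*} [Fintype ι]

/-- The finite family `K` of polygons is a mesh of `Ω`: the elements do not overlap, they fill `Ω`,
and each side of an element lies on `∂Ω` or is also a side of another element. -/
structure IsMesh (Ω : Set Plane) (K : ι → MeshPolygon) : Prop where
  disjoint : ∀ i i', i ≠ i' → Disjoint (K i).carrier (K i').carrier
  cover : ⋃ i, closure (K i).carrier = closure Ω
  conforming : ∀ i j, (K i).side j ⊆ frontier Ω ∨
    ∃ i', i' ≠ i ∧ ∃ j', (K i').side j' = (K i).side j

open Classical in
/-- The edges of the mesh (closed segments); their union is the skeleton `Σ`. -/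
def edges (K : ι → MeshPolygon) : Finset (Set Plane) :=
  Finset.univ.image fun p : Σ i, (K i).Idx => (K p.1).side p.2

theorem side_mem_edges (K : ι → MeshPolygon) (i : ι) (j : (K i).Idx) : (K i).side j ∈ edges K := by
  classical
  exact Finset.mem_image.2 ⟨⟨i, j⟩, Finset.mem_univ _, rfl⟩

/-- `n` is a choice of a unit normal on each edge that points outwards on `∂Ω`. -/
structure IsSkeletonNormal (Ω : Set Plane) (K : ι → MeshPolygon) (n : Set Plane → Plane) : Prop where
  normal : ∀ i j, n ((K i).side j) = (K i).normal j ∨ n ((K i).side j) = -(K i).normal j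
  outward : ∀ i j, (K i).side j ⊆ frontier Ω → n ((K i).side j) = (K i).normal j

/-- The broken space `V = ∏_K H¹(K)`. -/
abbrev BrokenH1 (K : ι → MeshPolygon) : Type _ := ∀ i, (K i).H1

/-- The space `Λ = L²(Σ) = ∏_e L²(e)`. -/
abbrev SkeletonL2 (K : ι → MeshPolygon) : Type := ∀ e : {e // e ∈ edges K}, L2Seg e.1

/-- The polynomial function on the plane given by a polynomial in two variables. -/
def polyFn (p : MvPolynomial (Fin 2) ℝ) (x : Plane) : ℝ := MvPolynomial.eval (fun a => x a) p

/-- `V_h = ∏_K ℙ_k(K)`. -/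
def discreteV (K : ι → MeshPolygon) (k : ℕ) : Submodule ℝ (BrokenH1 K) where
  carrier := {u | ∀ i, ∃ p ∈ MvPolynomial.restrictTotalDegree (Fin 2) ℝ k,
    H1.fn (u i) =ᵐ[volume.restrict (K i).carrier] polyFn p}
  zero_mem' i := by
    refine ⟨0, Submodule.zero_mem _, ?_⟩
    filter_upwards [Lp.coeFn_zero ℝ 2 (volume.restrict (K i).carrier)] with x hx
    simpa [polyFn, H1.fn] using hx
  add_mem' := by
    intro u v hu hv i
    obtain ⟨p, hp, hup⟩ := hu i
    obtain ⟨q, hq, hvq⟩ := hv i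
    refine ⟨p + q, Submodule.add_mem _ hp hq, ?_⟩
    filter_upwards [hup, hvq, Lp.coeFn_add (u i).1.1 (v i).1.1] with x h1 h2 h3
    have h4 : H1.fn (u i + v i) x = H1.fn (u i) x + H1.fn (v i) x := h3
    simp only [Pi.add_apply]
    rw [h4, h1, h2]
    simp [polyFn]
  smul_mem' := by
    intro c u hu i
    obtain ⟨p, hp, hup⟩ := hu i
    refine ⟨c • p, Submodule.smul_mem _ c hp, ?_⟩
    filter_upwards [hup, Lp.coeFn_smul c (u i).1.1] with x h1 h3
    have h4 : H1.fn (c • u i) x = c * H1.fn (u i) x := h3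
    simp only [Pi.smul_apply]
    rw [h4, h1]
    simp [polyFn, MvPolynomial.smul_eval]

/-- `Λ_h`: the functions on the skeleton whose restriction to each edge is in `ℙ_{k'}(e)`. -/
def discreteL (K : ι → MeshPolygon) (k' : ℕ) : Submodule ℝ (SkeletonL2 K) where
  carrier := {l | ∀ e, ∃ p ∈ MvPolynomial.restrictTotalDegree (Fin 2) ℝ k',
    l e =ᵐ[Measure.restrict μH[1] e.1] polyFn p}
  zero_mem' e := by
    refine ⟨0, Submodule.zero_mem _, ?_⟩
    filter_upwards [Lp.coeFn_zero ℝ 2 (Measure.restrict μH[1] e.1)] with x hx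
    simpa [polyFn] using hx
  add_mem' := by
    intro u v hu hv e
    obtain ⟨p, hp, hup⟩ := hu e
    obtain ⟨q, hq, hvq⟩ := hv e
    refine ⟨p + q, Submodule.add_mem _ hp hq, ?_⟩
    filter_upwards [hup, hvq, Lp.coeFn_add (u e) (v e)] with x h1 h2 h3
    simp only [Pi.add_apply] at h3 ⊢
    rw [h3, h1, h2]
    simp [polyFn]
  smul_mem' := by
    intro c u hu e
    obtain ⟨p, hp, hup⟩ := hu e
    refine ⟨c • p, Submodule.smul_mem _ c hp, ?_⟩
    filter_upwards [hup, Lp.coeFn_smul c (u e)] with x h1 h3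
    simp only [Pi.smul_apply] at h3 ⊢
    rw [h3, h1]
    simp [polyFn, MvPolynomial.smul_eval]

/-- `γ_K^* λ ∈ (H¹(K))'` for the element `K i`: `⟨γ_K^* λ, v⟩ = ∫_{∂K} λ (n_K · n) v`, where the
value of `v` on the side `j` is its trace and `innerSL` is the inner product of `L²(e)`. -/
def adjTrace (K : ι → MeshPolygon) (n : Set Plane → Plane) (l : SkeletonL2 K) (i : ι) :
    H1.Dual (K i).carrier :=
  ∑ j : (K i).Idx, ⟪(K i).normal j, n ((K i).side j)⟫ •
    (innerSL ℝ (l ⟨(K i).side j, side_mem_edges K i j⟩)).comp ((K i).trace j)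

open Classical in
/-- The jump on the edge `e` of the values `w i j` taken by the elements `K i` on their sides `j`:
the sum of `w n_K` over the (one or two) elements `K` that have the side `e`. -/
def jump (K : ι → MeshPolygon) (w : ∀ i, (K i).Idx → ℝ) (e : Set Plane) : Plane :=
  ∑ i, ∑ j, if (K i).side j = e then w i j • (K i).normal j else 0

/-- `∫_Σ λ ⟦v⟧ · n`. -/
def jumpPairing (K : ι → MeshPolygon) (n : Set Plane → Plane) (l : SkeletonL2 K) (v : BrokenH1 K) :
    ℝ :=
  ∑ e : {e // e ∈ edges K}, ∫ x in e.1,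
    l e x * ⟪jump K (fun i j => (K i).trace j (v i) x) e.1, n e.1⟫ ∂μH[1]

/-- `‖u‖_{1,T_h}² = ∑_K |u|_{1,K}² + ∑_e |⟦ū⟧|²`, where `ū` is the piecewise mean value. -/
def normV (K : ι → MeshPolygon) (u : BrokenH1 K) : ℝ :=
  Real.sqrt (∑ i, H1.seminorm (u i) ^ 2 +
    ∑ e ∈ edges K, ‖jump K (fun i _ => H1.mean (u i)) e‖ ^ 2)

/-- `|||λ|||_{-1/2,Σ}² = ∑_K ‖γ_K^* λ‖_{-1,K}²`. -/
def normL (K : ι → MeshPolygon) (n : Set Plane → Plane) (l : SkeletonL2 K) : ℝ :=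
  Real.sqrt (∑ i, H1.dualNorm (adjTrace K n l i) ^ 2)

/-- The product norm on `V_h × Λ_h`. -/
def normVL (K : ι → MeshPolygon) (n : Set Plane → Plane) (x : BrokenH1 K × SkeletonL2 K) : ℝ :=
  Real.sqrt (normV K x.1 ^ 2 + normL K n x.2 ^ 2)

/-- Bilinear forms on the spaces `(H¹(K))'`, one for each element. -/
abbrev StabForms (K : ι → MeshPolygon) : Type _ :=
  ∀ i, H1.Dual (K i).carrier →ₗ[ℝ] H1.Dual (K i).carrier →ₗ[ℝ] ℝ

/-- Continuity of the stabilization forms, with constant `M`. -/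
def StabContinuous (K : ι → MeshPolygon) (s : StabForms K) (M : ℝ) : Prop :=
  ∀ i F G, s i F G ≤ M * H1.dualSeminorm F * H1.dualSeminorm G

/-- Coercivity of the stabilization forms on `γ_K^* Λ_h`, with constant `ρ`. -/
def StabCoercive (K : ι → MeshPolygon) (n : Set Plane → Plane) (k' : ℕ) (s : StabForms K) (ρ : ℝ) :
    Prop :=
  ∀ i, ∀ l ∈ discreteL K k',
    ρ * H1.dualSeminorm (adjTrace K n l i) ^ 2 ≤ s i (adjTrace K n l i) (adjTrace K n l i)

/-- The bilinear form
`a(u, λ; v, μ) = ∑_K ∫_K ∇u · ∇v - ∫_Σ λ ⟦v⟧ · n + ∫_Σ μ ⟦u⟧ · n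
  + α ∑_K s_K(D u - γ_K^* λ, t D v - γ_K^* μ)`. -/
def bilinA (K : ι → MeshPolygon) (n : Set Plane → Plane) (s : StabForms K) (t α : ℝ)
    (x y : BrokenH1 K × SkeletonL2 K) : ℝ :=
  ∑ i, ⟪H1.grad (x.1 i), H1.grad (y.1 i)⟫ - jumpPairing K n x.2 y.1 + jumpPairing K n y.2 x.1 +
    α * ∑ i, s i (H1.D (x.1 i) - adjTrace K n x.2 i) (t • H1.D (y.1 i) - adjTrace K n y.2 i)

/-- The discrete space `𝕍_h = V_h × Λ_h`. -/
abbrev discreteVL (K : ι → MeshPolygon) (k k' : ℕ) : Submodule ℝ (BrokenH1 K × SkeletonL2 K) :=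
  (discreteV K k).prod (discreteL K k')

end Mesh

end

/-! Testing the form with `(u, λ)` itself makes the coupling terms cancel and leaves `∑ |u|²` plus
the stabilization. With `α = C ρ / M²` one has `α ρ = C (ρ/M)²` and `α M = C ρ/M`. Coercivity of
`s_K` therefore yields `C (ρ/M)² ∑ |γ_K^* λ|²`, and since `ρ ≤ M` and `C` is small, the terms
containing `D u` are absorbed by `∑ |u|²` (`element_estimate`). Two quantities in the norm are still
not controlled: the action `⟨γ_K^* λ, 1⟩` on constants and the jumps of the mean values `ū`.

Both are recovered with lowest-order test functions, which lie in the discrete spaces for all `k`,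
`k'`; this is why the constants do not depend on the degree. Subtracting from `u` the piecewise
constant with values `⟨γ_K^* λ, 1⟩` (`fluxFn`) changes neither gradients nor the stabilization and
adds `∑ ⟨γ_K^* λ, 1⟩²`. Adding to `λ` the term `δ μ`, with `μ` equal on each edge to the normal jump
of `ū` divided by the edge length (`jumpMultiplier`), adds `δ ∑ |⟦ū⟧|²` up to errors of size `δ |u|
|γ_K^* μ|`. Since `|γ_K^* μ|` is bounded by the jumps, these errors are absorbed for `δ` small in
terms of `γ₀, γ₁`. The outcome is `bilinA_test_ge`; the test pair is bounded by the trial pair in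
`normV_sub_fluxFn_sq_le` and `normL_add_smul_sq_le`.

The mesh constants come from a Poincaré inequality (`H1.poincare`) and a trace inequality
(`norm_trace_le`) on sets that are star-shaped with respect to a ball, from a packing bound on the
number of sides (`card_le`), and from the fact that an edge belongs to at most two elements
(`card_sidesAt_le`). Density of smooth functions (`denseRange_ofSmooth`) makes the trace operator
exist and carries inequalities over to `H¹`.

Two nondegeneracy facts complete the argument. The quotient requires the norm to be definite on the
discrete space (`normVL_pos`), and `ρ ≤ M` has to be derived from the two assumptions on `s_K`
(`StabCoercive.le`). -/

/-! ### Dilations, translations and mollification in `L²` -/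

/-- The affine homeomorphism `x ↦ θ x + a` for `θ ≠ 0`. -/
theorem measurableEmbedding_smul_add {θ : ℝ} (hθ : θ ≠ 0) (a : Plane) :
    MeasurableEmbedding (fun x : Plane => θ • x + a) :=
  ((Homeomorph.smulOfNeZero θ hθ).trans (Homeomorph.addRight a)).measurableEmbedding

theorem map_smul_add_volume {θ : ℝ} (hθ : θ ≠ 0) (a : Plane) :
    Measure.map (fun x : Plane => θ • x + a) volume = ENNReal.ofReal (θ ^ 2)⁻¹ • volume := by
  have h1 : (fun x : Plane => θ • x + a) = (fun x => x + a) ∘ (fun x => θ • x) := rfl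
  rw [h1, ← Measure.map_map (measurable_add_const a) (measurable_const_smul θ),
    Measure.map_addHaar_smul volume hθ, Measure.map_smul, map_add_right_eq_self]
  have : |(θ ^ Module.finrank ℝ Plane)⁻¹| = (θ ^ 2)⁻¹ := by
    rw [finrank_euclideanSpace_fin, abs_of_nonneg (by positivity)]
  rw [this]

theorem lintegral_comp_smul_add {θ : ℝ} (hθ : θ ≠ 0) (a : Plane) (F : Plane → ENNReal) :
    ∫⁻ x, F (θ • x + a) = ENNReal.ofReal (θ ^ 2)⁻¹ * ∫⁻ x, F x := by
  rw [← (measurableEmbedding_smul_add hθ a).lintegral_map F, map_smul_add_volume hθ,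
    lintegral_smul_measure, smul_eq_mul]

section Lp

theorem eLpNorm_comp_smul_add {E : Type*} [NormedAddCommGroup E] {θ : ℝ} (hθ : 0 < θ) (a : Plane) (f : Plane → E) :
    eLpNorm (fun x => f (θ • x + a)) 2 volume = ENNReal.ofReal θ⁻¹ * eLpNorm f 2 volume := by
  have h := (measurableEmbedding_smul_add hθ.ne' a).eLpNorm_map_measure (g := f) (p := 2)
    (μ := volume)
  rw [map_smul_add_volume hθ.ne', eLpNorm_smul_measure_of_ne_top (by simp)] at h
  refine h.symm.trans ?_
  rw [smul_eq_mul, ENNReal.ofReal_rpow_of_nonneg (by positivity) (by simp)]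
  congr 2
  rw [← inv_pow, ← Real.rpow_natCast, ← Real.rpow_mul (by positivity)]
  norm_num

variable {E : Type*} [NormedAddCommGroup E]

theorem eLpNorm_comp_smul_add_sub_le_of_hasCompactSupport {g : Plane → E} (hg : Continuous g)
    (hc : HasCompactSupport g) {ε : ENNReal} (hε : ε ≠ 0) :
    ∃ δ > 0, ∀ (θ : ℝ) (a : Plane), |θ - 1| < δ → ‖a‖ < δ →
      eLpNorm (fun x => g (θ • x + a) - g x) 2 volume ≤ ε := by
  obtain ⟨R, hR0, hR⟩ : ∃ R > 0, ∀ x, R ≤ ‖x‖ → g x = 0 := hc.exists_pos_le_norm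
  -- For `θ > 1/2` and `‖a‖ < 1`, `‖x‖ > S` forces `‖θ x + a‖ ≥ S/2 - 1 = R`, so outside this ball
  -- both terms vanish and uniform continuity on a set of finite measure suffices.
  set S : ℝ := 2 * R + 2
  have hfin : volume (Metric.closedBall (0 : Plane) S) ≠ ⊤ := measure_closedBall_lt_top.ne
  set V := volume (Metric.closedBall (0 : Plane) S) ^ (2 : ENNReal).toReal⁻¹
  have hV : V ≠ ⊤ := ENNReal.rpow_ne_top_of_nonneg (by simp) hfin
  obtain ⟨η, hη0, hη⟩ : ∃ η : ℝ, 0 < η ∧ V * ENNReal.ofReal η ≤ ε := by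
    by_cases hε' : ε = ⊤
    · exact ⟨1, one_pos, by simp [hε']⟩
    have := ENNReal.exists_nnreal_pos_mul_lt hV hε
    obtain ⟨η, h0, h1⟩ := this
    refine ⟨η, by exact_mod_cast h0, ?_⟩
    rw [ENNReal.ofReal_coe_nnreal, mul_comm]; exact h1.le
  obtain ⟨δ, hδ0, hδ⟩ := Metric.uniformContinuous_iff.1
    (hc.uniformContinuous_of_continuous hg) η hη0
  refine ⟨min (1 / 2) (min 1 (δ / (S + 1))), by positivity, fun θ a hθ ha => ?_⟩
  simp only [lt_min_iff] at hθ ha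
  obtain ⟨hθ1, -, hθ3⟩ := hθ
  obtain ⟨ha1, -, ha3⟩ := ha
  have hθ0 : 1 / 2 < θ := by have := (abs_lt.1 hθ1).1; linarith
  have hsupp : ∀ x ∉ Metric.closedBall (0 : Plane) S, g (θ • x + a) - g x = 0 := by
    intro x hx
    have hx' : S < ‖x‖ := by simpa using hx
    have h1 : g x = 0 := hR x (by simp only [S] at hx'; linarith)
    have h2 : R ≤ ‖θ • x + a‖ := by
      have h3 : ‖θ • x‖ ≤ ‖θ • x + a‖ + ‖a‖ := by
        simpa using norm_sub_le (θ • x + a) a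
      rw [norm_smul, Real.norm_of_nonneg (by linarith)] at h3
      have : 1 / 2 * S ≤ θ * ‖x‖ := by gcongr
      simp only [S] at this; linarith
    rw [h1, hR _ h2, sub_zero]
  have hind : (fun x => g (θ • x + a) - g x)
      = (Metric.closedBall (0 : Plane) S).indicator (fun x => g (θ • x + a) - g x) := by
    ext x
    by_cases hx : x ∈ Metric.closedBall (0 : Plane) S
    · rw [indicator_of_mem hx]
    · rw [indicator_of_notMem hx, hsupp x hx]
  rw [hind, eLpNorm_indicator_eq_eLpNorm_restrict Metric.isClosed_closedBall.measurableSet]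
  refine (eLpNorm_le_of_ae_bound (C := η) ?_).trans ?_
  · refine (ae_restrict_iff' Metric.isClosed_closedBall.measurableSet).2
      (Eventually.of_forall fun x hx => ?_)
    rw [← dist_eq_norm]
    refine (hδ ?_).le
    have hxS : ‖x‖ ≤ S := by simpa using hx
    rw [dist_eq_norm]
    calc ‖θ • x + a - x‖ = ‖(θ - 1) • x + a‖ := by congr 1; module
      _ ≤ |θ - 1| * ‖x‖ + ‖a‖ := by
        refine (norm_add_le _ _).trans ?_
        rw [norm_smul, Real.norm_eq_abs]
      _ ≤ |θ - 1| * S + ‖a‖ := by gcongr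
      _ < δ / (S + 1) * S + δ / (S + 1) := by
        have : |θ - 1| * S ≤ δ / (S + 1) * S := by
          have : 0 ≤ S := by positivity
          gcongr
        linarith
      _ = δ := by
        have : S + 1 ≠ 0 := by positivity
        field_simp
  · rwa [Measure.restrict_apply_univ]

/-- Density of compactly supported continuous functions. Of the four quarters of `ε`, the dilated
error `f - g` takes two, because dilation by `θ ≥ 1/2` multiplies the norm by `θ⁻¹ ≤ 2`. -/
theorem exists_eLpNorm_comp_smul_add_sub_le [NormedSpace ℝ E] {f : Plane → E} (hf : MemLp f 2 volume)
    {ε : ENNReal} (hε : ε ≠ 0) :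
    ∃ δ > 0, ∀ (θ : ℝ) (a : Plane), |θ - 1| < δ → ‖a‖ < δ →
      eLpNorm (fun x => f (θ • x + a) - f x) 2 volume ≤ ε := by
  obtain ⟨g, hgc, hgf, hg, hgL⟩ := hf.exists_hasCompactSupport_eLpNorm_sub_le (by simp)
    (ε := ε / 4) (by simpa using hε)
  obtain ⟨δ, hδ0, hδ⟩ := eLpNorm_comp_smul_add_sub_le_of_hasCompactSupport hg hgc
    (ε := ε / 4) (by simpa using hε)
  refine ⟨min δ (1 / 2), by positivity, fun θ a hθ ha => ?_⟩
  simp only [lt_min_iff] at hθ ha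
  have hθ0 : 1 / 2 < θ := by have := (abs_lt.1 hθ.2).1; linarith
  have hcomp : ∀ {u : Plane → E}, AEStronglyMeasurable u volume →
      AEStronglyMeasurable (fun x => u (θ • x + a)) volume := fun {u} hu => by
    refine AEStronglyMeasurable.comp_measurable (f := fun x : Plane => θ • x + a) (g := u) ?_
      (by fun_prop)
    rw [map_smul_add_volume (by linarith : θ ≠ 0)]
    exact hu.smul_measure _
  have hfg := (hf.sub hgL).1
  have e : (fun x => f (θ • x + a) - f x)
      = ((fun x => (f - g) (θ • x + a)) + fun x => g (θ • x + a) - g x) - (f - g) := by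
    ext x; simp only [Pi.sub_apply, Pi.add_apply]; abel
  rw [e]
  refine (eLpNorm_sub_le ((hcomp hfg).add ((hcomp hgL.1).sub hgL.1)) hfg (by simp)).trans ?_
  refine (add_le_add (eLpNorm_add_le (hcomp hfg) ((hcomp hgL.1).sub hgL.1) (by simp)) hgf).trans ?_
  have h1 : eLpNorm (fun x => (f - g) (θ • x + a)) 2 volume ≤ 2 * (ε / 4) := by
    rw [eLpNorm_comp_smul_add (by linarith)]
    refine mul_le_mul' ?_ hgf
    rw [show (2 : ENNReal) = ENNReal.ofReal 2 by simp]
    refine ENNReal.ofReal_le_ofReal ?_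
    rw [inv_le_comm₀ (by linarith) (by norm_num)]; linarith
  refine (add_le_add (add_le_add h1 (hδ θ a hθ.1 ha.1)) le_rfl).trans (le_of_eq ?_)
  have h4 : 4 * (ε / 4) = ε := ENNReal.mul_div_cancel (by simp) (by simp)
  calc 2 * (ε / 4) + ε / 4 + ε / 4 = 4 * (ε / 4) := by ring
    _ = ε := h4

end Lp

theorem eLpNorm_two_sq {α E : Type*} [MeasurableSpace α] [NormedAddCommGroup E] (f : α → E)
    (μ : Measure α) : eLpNorm f 2 μ ^ 2 = ∫⁻ x, ‖f x‖ₑ ^ 2 ∂μ := by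
  have h := eLpNorm_nnreal_pow_eq_lintegral (f := f) (μ := μ) (p := 2) (by simp)
  simpa using h

/-- Jensen's inequality for the square. -/
theorem sq_lintegral_le {α : Type*} [MeasurableSpace α] {μ : Measure α} [IsProbabilityMeasure μ]
    {h : α → ENNReal} (hh : AEMeasurable h μ) : (∫⁻ x, h x ∂μ) ^ 2 ≤ ∫⁻ x, h x ^ 2 ∂μ := by
  have key := ENNReal.lintegral_mul_le_Lp_mul_Lq μ Real.HolderConjugate.two_two hh
    (aemeasurable_const (b := (1 : ENNReal)))
  simp only [Pi.mul_apply, mul_one, ENNReal.one_rpow, lintegral_const, measure_univ] at key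
  calc (∫⁻ x, h x ∂μ) ^ 2 ≤ ((∫⁻ x, h x ^ (2 : ℝ) ∂μ) ^ (1 / 2 : ℝ)) ^ 2 := by gcongr
    _ = ∫⁻ x, h x ^ 2 ∂μ := by
      rw [← ENNReal.rpow_natCast, ← ENNReal.rpow_mul]; norm_num

theorem sq_lintegral_mul_le {α : Type*} [MeasurableSpace α] {μ : Measure α} {w h : α → ENNReal}
    (hw : Measurable w) (hw1 : ∫⁻ x, w x ∂μ = 1) (hh : Measurable h) :
    (∫⁻ x, w x * h x ∂μ) ^ 2 ≤ ∫⁻ x, w x * h x ^ 2 ∂μ := by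
  have : IsProbabilityMeasure (μ.withDensity w) := ⟨by simp [hw1]⟩
  have := sq_lintegral_le (μ := μ.withDensity w) hh.aemeasurable
  rwa [lintegral_withDensity_eq_lintegral_mul μ hw hh,
    lintegral_withDensity_eq_lintegral_mul μ hw (hh.pow_const 2)] at this

open scoped Convolution

section Mollify

variable {E : Type*} [NormedAddCommGroup E] [NormedSpace ℝ E] [CompleteSpace E]
  [SecondCountableTopology E]

/-- The mollification is an average of translates with a probability density. Jensen's inequality
pointwise and Tonelli's theorem bound its error by the worst translation error. -/
theorem eLpNorm_convolution_sub_le (φ : ContDiffBump (0 : Plane)) {f : Plane → E}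
    (hfm : StronglyMeasurable f) (hf : MemLp f 2 volume) {ε : ENNReal}
    (h : ∀ t : Plane, ‖t‖ ≤ φ.rOut → eLpNorm (fun x => f (x - t) - f x) 2 volume ≤ ε) :
    eLpNorm (fun x => (φ.normed volume ⋆[ContinuousLinearMap.lsmul ℝ ℝ, volume] f) x - f x)
      2 volume ≤ ε := by
  borelize E
  set ρ := φ.normed volume
  have hρc : Continuous ρ := φ.continuous_normed
  have hfl : LocallyIntegrable f volume := hf.locallyIntegrable (by simp)
  have hρi : Integrable ρ volume := φ.integrable_normed
  set w : Plane → ENNReal := fun t => ENNReal.ofReal (ρ t)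
  have hw : Measurable w := hρc.measurable.ennreal_ofReal
  have hw1 : ∫⁻ t, w t = 1 := by
    rw [← ofReal_integral_eq_lintegral_ofReal hρi (Eventually.of_forall φ.nonneg_normed),
      φ.integral_normed, ENNReal.ofReal_one]
  have hmeas : Measurable (fun p : Plane × Plane => f (p.1 - p.2) - f p.1) :=
    (hfm.measurable.comp (measurable_fst.sub measurable_snd)).sub
      (hfm.measurable.comp measurable_fst)
  have hpt : ∀ x, ‖(ρ ⋆[ContinuousLinearMap.lsmul ℝ ℝ, volume] f) x - f x‖ₑ ^ 2
      ≤ ∫⁻ t, w t * ‖f (x - t) - f x‖ₑ ^ 2 := by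
    intro x
    have hex := HasCompactSupport.convolutionExists_left (ContinuousLinearMap.lsmul ℝ ℝ)
      φ.hasCompactSupport_normed hρc hfl x
    have e : (ρ ⋆[ContinuousLinearMap.lsmul ℝ ℝ, volume] f) x - f x
        = ∫ t, ρ t • (f (x - t) - f x) := by
      have hex' : Integrable (fun t => ρ t • f (x - t)) volume := hex
      simp only [smul_sub]
      rw [integral_sub hex' (hρi.smul_const _), integral_smul_const, φ.integral_normed, one_smul]
      rfl
    rw [e]
    have hm : Measurable (fun t => ‖f (x - t) - f x‖ₑ) :=
      (hmeas.comp (measurable_const.prodMk measurable_id)).enorm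
    refine le_trans ?_ (sq_lintegral_mul_le hw hw1 hm)
    gcongr
    refine (enorm_integral_le_lintegral_enorm _).trans (le_of_eq ?_)
    refine lintegral_congr fun t => ?_
    rw [enorm_smul, Real.enorm_of_nonneg (φ.nonneg_normed t)]
  have hm2 : Measurable (fun p : Plane × Plane => w p.2 * ‖f (p.1 - p.2) - f p.1‖ₑ ^ 2) :=
    (hw.comp measurable_snd).mul (hmeas.enorm.pow_const 2)
  have hsq : eLpNorm (fun x => (ρ ⋆[ContinuousLinearMap.lsmul ℝ ℝ, volume] f) x - f x)
      2 volume ^ 2 ≤ ε ^ 2 := by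
    rw [eLpNorm_two_sq]
    refine (lintegral_mono hpt).trans ?_
    rw [lintegral_lintegral_swap hm2.aemeasurable]
    calc ∫⁻ t, ∫⁻ x, w t * ‖f (x - t) - f x‖ₑ ^ 2 ≤ ∫⁻ t, w t * ε ^ 2 := by
          refine lintegral_mono fun t => ?_
          have hm3 : Measurable fun x => ‖f (x - t) - f x‖ₑ ^ 2 :=
            (hmeas.comp (measurable_id.prodMk measurable_const)).enorm.pow_const 2
          change ∫⁻ x, w t * ‖f (x - t) - f x‖ₑ ^ 2 ≤ w t * ε ^ 2
          rw [lintegral_const_mul _ hm3, ← eLpNorm_two_sq]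
          by_cases ht : ‖t‖ ≤ φ.rOut
          · gcongr; exact h t ht
          · have : ρ t = 0 := by
              have : t ∉ Function.support ρ := by
                rw [φ.support_normed_eq]; simp only [Metric.mem_ball, dist_zero_right]
                exact fun h => ht h.le
              simpa using this
            simp [w, this]
      _ = ε ^ 2 := by rw [lintegral_mul_const _ hw, hw1, one_mul]
  exact (ENNReal.pow_le_pow_left_iff (by norm_num)).1 hsq

end Mollify

/-! ### Smooth functions as elements of `H¹(U)`, and uniqueness of the weak gradient. -/

theorem Continuous.memLp_restrict_of_isBounded {E : Type*} [NormedAddCommGroup E]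
    [SecondCountableTopology E]
    {f : Plane → E} (hf : Continuous f) {U : Set Plane} (hU : Bornology.IsBounded U) :
    MemLp f 2 (volume.restrict U) := by
  have hc : IsCompact (closure U) := hU.isCompact_closure
  obtain ⟨C, hC⟩ := hc.exists_bound_of_continuousOn hf.continuousOn
  have : IsFiniteMeasure (volume.restrict (closure U)) := ⟨by simpa using hc.measure_lt_top⟩
  have h : MemLp f 2 (volume.restrict (closure U)) :=
    MemLp.of_bound hf.aestronglyMeasurable C
      ((ae_restrict_iff' isClosed_closure.measurableSet).2 (Eventually.of_forall hC))
  exact h.mono_measure (Measure.restrict_mono subset_closure le_rfl)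

/-- The smooth functions on the plane. -/
def smoothFn : Submodule ℝ (Plane → ℝ) where
  carrier := {φ | ContDiff ℝ ∞ φ}
  zero_mem' := (contDiff_const : ContDiff ℝ ∞ fun _ : Plane => (0 : ℝ))
  add_mem' {φ ψ} (h1 : ContDiff ℝ ∞ φ) (h2 : ContDiff ℝ ∞ ψ) := h1.add h2
  smul_mem' c φ (h : ContDiff ℝ ∞ φ) := (contDiff_const (c := c)).smul h

theorem contDiff_smoothFn (φ : smoothFn) : ContDiff ℝ ∞ φ.1 := φ.2

theorem continuous_gradient {φ : Plane → ℝ} (h : ContDiff ℝ ∞ φ) : Continuous (gradient φ) :=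
  (InnerProductSpace.toDual ℝ Plane).symm.continuous.comp (h.continuous_fderiv (by simp))

theorem gradient_add {φ ψ : Plane → ℝ} (h1 : ContDiff ℝ ∞ φ) (h2 : ContDiff ℝ ∞ ψ) :
    gradient (φ + ψ) = gradient φ + gradient ψ := by
  ext1 x
  simp only [gradient, Pi.add_apply]
  rw [fderiv_add ((h1.differentiable (by simp)) x) ((h2.differentiable (by simp)) x), map_add]

theorem gradient_smul {φ : Plane → ℝ} (h1 : ContDiff ℝ ∞ φ) (c : ℝ) :
    gradient (c • φ) = c • gradient φ := by
  ext1 x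
  simp only [gradient, Pi.smul_apply]
  rw [fderiv_const_smul ((h1.differentiable (by simp)) x), map_smul]

theorem isWeakGradient_gradient (U : Set Plane) {φ : Plane → ℝ} (h : ContDiff ℝ ∞ φ) :
    IsWeakGradient U φ (gradient φ) := by
  intro ψ hψ hc hs d
  have hD : HasCompactSupport (fun x => fderiv ℝ ψ x d) :=
    (hc.fderiv (𝕜 := ℝ)).comp_left (g := fun L : Plane →L[ℝ] ℝ => L d) (by simp)
  have z1 : ∀ x, x ∉ U → ψ x = 0 := fun x hx => image_eq_zero_of_notMem_tsupport fun h => hx (hs h)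
  have z2 : ∀ x, x ∉ U → fderiv ℝ ψ x d = 0 := fun x hx => by
    have : x ∉ tsupport (fderiv ℝ ψ) := fun h => hx (hs (tsupport_fderiv_subset ℝ h))
    rw [image_eq_zero_of_notMem_tsupport this]; rfl
  -- The test function and its derivative vanish outside `U`, so both integrals extend to the plane,
  -- where integration by parts has no boundary term.
  rw [setIntegral_eq_integral_of_forall_compl_eq_zero (fun x hx => by rw [z2 x hx, mul_zero]),
    setIntegral_eq_integral_of_forall_compl_eq_zero (fun x hx => by rw [z1 x hx, mul_zero])]
  simp only [inner_gradient_left]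
  have hcφ := h.continuous
  have hcψ := hψ.continuous
  have hc1 := continuous_fderiv_test hψ d
  have hc2 := continuous_fderiv_test h d
  refine integral_mul_fderiv_eq_neg_fderiv_mul_of_integrable ?_ ?_ ?_ ?_ ?_
  · exact (hc2.mul hcψ).integrable_of_hasCompactSupport hc.mul_left
  · exact (hcφ.mul hc1).integrable_of_hasCompactSupport hD.mul_left
  · exact (hcφ.mul hcψ).integrable_of_hasCompactSupport hc.mul_left
  · exact fun x _ => h.differentiable (by simp) x
  · exact fun x _ => hψ.differentiable (by simp) x

theorem IsWeakGradient.congr_ae {U : Set Plane} {u v : Plane → ℝ} {g k : Plane → Plane}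
    (h : IsWeakGradient U u g) (h1 : u =ᵐ[volume.restrict U] v) (h2 : g =ᵐ[volume.restrict U] k) :
    IsWeakGradient U v k := by
  intro φ hφ hc hs d
  have e1 : ∫ x in U, v x * fderiv ℝ φ x d = ∫ x in U, u x * fderiv ℝ φ x d :=
    integral_congr_ae (by filter_upwards [h1] with x hx; rw [hx])
  have e2 : ∫ x in U, ⟪k x, d⟫ * φ x = ∫ x in U, ⟪g x, d⟫ * φ x :=
    integral_congr_ae (by filter_upwards [h2] with x hx; rw [hx])
  rw [e1, e2, h φ hφ hc hs d]

namespace H1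

theorem memLp_smoothFn {U : Set Plane} (hU : Bornology.IsBounded U) (φ : smoothFn) :
    MemLp φ.1 2 (volume.restrict U) :=
  (contDiff_smoothFn φ).continuous.memLp_restrict_of_isBounded hU

theorem memLp_gradient_smoothFn {U : Set Plane} (hU : Bornology.IsBounded U) (φ : smoothFn) :
    MemLp (gradient φ.1) 2 (volume.restrict U) :=
  (continuous_gradient (contDiff_smoothFn φ)).memLp_restrict_of_isBounded hU

/-- The restriction of a smooth function on the plane to a bounded set `U`, as an element of
`H¹(U)`. -/
noncomputable def ofSmooth {U : Set Plane} (hU : Bornology.IsBounded U) : smoothFn →ₗ[ℝ] H1 U where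
  toFun φ := ⟨((memLp_smoothFn hU φ).toLp, (memLp_gradient_smoothFn hU φ).toLp),
    (isWeakGradient_gradient U (contDiff_smoothFn φ)).congr_ae
      (memLp_smoothFn hU φ).coeFn_toLp.symm (memLp_gradient_smoothFn hU φ).coeFn_toLp.symm⟩
  map_add' φ ψ := by
    refine Subtype.ext (Prod.ext ?_ ?_)
    · exact MemLp.toLp_add (memLp_smoothFn hU φ) (memLp_smoothFn hU ψ)
    · exact (MemLp.toLp_congr (memLp_gradient_smoothFn hU (φ + ψ)) ((memLp_gradient_smoothFn hU φ).add (memLp_gradient_smoothFn hU ψ))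
        (by rw [← gradient_add (contDiff_smoothFn φ) (contDiff_smoothFn ψ)]; rfl)).trans
        (MemLp.toLp_add (memLp_gradient_smoothFn hU φ) (memLp_gradient_smoothFn hU ψ))
  map_smul' c φ := by
    refine Subtype.ext (Prod.ext ?_ ?_)
    · exact MemLp.toLp_const_smul c (memLp_smoothFn hU φ)
    · exact (MemLp.toLp_congr (memLp_gradient_smoothFn hU (c • φ))
        ((memLp_gradient_smoothFn hU φ).const_smul c)
        (by rw [← gradient_smul (contDiff_smoothFn φ) c]; rfl)).trans 
        (MemLp.toLp_const_smul c (memLp_gradient_smoothFn hU φ))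

variable {U : Set Plane} (hU : Bornology.IsBounded U)

theorem fn_ofSmooth (φ : smoothFn) : fn (ofSmooth hU φ) =ᵐ[volume.restrict U] φ.1 :=
  (memLp_smoothFn hU φ).coeFn_toLp

theorem grad_ofSmooth (φ : smoothFn) :
    grad (ofSmooth hU φ) =ᵐ[volume.restrict U] gradient φ.1 :=
  (memLp_gradient_smoothFn hU φ).coeFn_toLp

/-- The weak gradient is unique. -/
theorem ext_fn (hUo : IsOpen U) {u v : H1 U} (h : fn u =ᵐ[volume.restrict U] fn v) : u = v := by
  have key : ∀ w : H1 U, fn w =ᵐ[volume.restrict U] 0 → w = 0 := by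
    intro w hw
    refine Subtype.ext (Prod.ext (Lp.eq_zero_iff_ae_eq_zero.2 hw) (Lp.eq_zero_iff_ae_eq_zero.2 ?_))
    have hL : MemLp w.1.2 2 (volume.restrict U) := Lp.memLp _
    have : ∀ᵐ x, x ∈ U → w.1.2 x = 0 := by
      have : ∀ d : Plane, ∀ᵐ x, x ∈ U → ⟪w.1.2 x, d⟫ = 0 := by
        intro d
        refine hUo.ae_eq_zero_of_integral_contDiff_smul_eq_zero ?_ ?_
        · have : LocallyIntegrable (fun x => ⟪w.1.2 x, d⟫) (volume.restrict U) :=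
            (hL.inner_const d).locallyIntegrable (by simp)
          exact locallyIntegrableOn_of_locallyIntegrable_restrict this
        · intro ψ hψ hc hs
          have z1 : ∀ x, x ∉ U → ψ x = 0 :=
            fun x hx => image_eq_zero_of_notMem_tsupport fun h => hx (hs h)
          have := w.2 ψ hψ hc hs d
          rw [integral_eq_zero_of_ae (by filter_upwards [hw] with x hx; simp [show w.1.1 x = 0 from hx])] at this
          rw [← setIntegral_eq_integral_of_forall_compl_eq_zero (s := U)
            (fun x hx => by rw [z1 x hx, zero_smul])]
          simp only [smul_eq_mul]
          simp only [mul_comm (ψ _)]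
          linarith
      have h0 := this (EuclideanSpace.single 0 1)
      have h1 := this (EuclideanSpace.single 1 1)
      filter_upwards [h0, h1] with x h0 h1 hx
      ext i
      fin_cases i
      · have := h0 hx
        rw [PiLp.inner_apply] at this
        simpa using this
      · have := h1 hx
        rw [PiLp.inner_apply] at this
        simpa using this
    exact (ae_restrict_iff' hUo.measurableSet).2 this
  rw [← sub_eq_zero]
  refine key _ ?_
  filter_upwards [h, Lp.coeFn_sub u.1.1 v.1.1] with x hx h2
  have : fn (u - v) x = fn u x - fn v x := h2
  rw [this, hx, sub_self]; rfl

end H1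

/-! ### Density of smooth functions on star-shaped domains. -/

/-- The zero extension of `u` need not have a weak gradient across the boundary of `U`. Where the
support of the shifted kernel `y ↦ ρ(x - y)` stays inside `U`, however, this kernel is an admissible
test function, and the derivative passes from it to `g`. -/
theorem gradient_convolution {U : Set Plane} {u : Plane → ℝ} {g : Plane → Plane}
    (hUo : IsOpen U)
    (hu : LocallyIntegrable (U.indicator u) volume)
    (hg : LocallyIntegrable (U.indicator g) volume) (h : IsWeakGradient U u g)
    (φ : ContDiffBump (0 : Plane)) {x : Plane} (hx : Metric.closedBall x φ.rOut ⊆ U) :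
    gradient (φ.normed volume ⋆[ContinuousLinearMap.lsmul ℝ ℝ, volume] U.indicator u) x
      = (φ.normed volume ⋆[ContinuousLinearMap.lsmul ℝ ℝ, volume] U.indicator g) x := by
  set ρ := φ.normed volume
  have hρ : ContDiff ℝ ∞ ρ := φ.contDiff_normed
  have hρs : HasCompactSupport ρ := φ.hasCompactSupport_normed
  have hρt : tsupport ρ = Metric.closedBall 0 φ.rOut := φ.tsupport_normed_eq
  have hder := (hρs.hasFDerivAt_convolution_left (ContinuousLinearMap.lsmul ℝ ℝ)
    (hρ.of_le (by simp)) hu x).fderiv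
  refine ext_inner_right ℝ fun d => ?_
  rw [inner_gradient_left, hder]
  have hex := HasCompactSupport.convolutionExists_left
    ((ContinuousLinearMap.lsmul ℝ ℝ : ℝ →L[ℝ] ℝ →L[ℝ] ℝ).precompL Plane)
    (hρs.fderiv (𝕜 := ℝ)) (hρ.continuous_fderiv (by simp)) hu x
  have hex2 := HasCompactSupport.convolutionExists_left (ContinuousLinearMap.lsmul ℝ ℝ)
    hρs hρ.continuous hg x
  set ψ : Plane → ℝ := fun y => ρ (x - y)
  have hψ : ContDiff ℝ ∞ ψ := hρ.comp (contDiff_const.sub contDiff_id)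
  have hts : tsupport ψ ⊆ Metric.closedBall x φ.rOut := by
    refine closure_minimal (fun y hy => ?_) Metric.isClosed_closedBall
    have : x - y ∈ tsupport ρ := subset_tsupport _ hy
    rw [hρt] at this
    simpa [dist_eq_norm, norm_sub_rev] using this
  have hψs : HasCompactSupport ψ :=
    (isCompact_closedBall x φ.rOut).of_isClosed_subset (isClosed_tsupport _) hts
  have hψd : ∀ y, fderiv ℝ ψ y d = - fderiv ℝ ρ (x - y) d := by
    intro y
    have h1 : HasFDerivAt ψ ((fderiv ℝ ρ (x - y)).comp (-ContinuousLinearMap.id ℝ Plane)) y := by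
      refine HasFDerivAt.comp y (hρ.differentiable (by simp) (x - y)).hasFDerivAt ?_
      simpa using (hasFDerivAt_id y).const_sub x
    rw [h1.fderiv]; simp
  have key := h ψ hψ hψs (hts.trans hx) d
  calc _ = ∫ t, fderiv ℝ ρ t d * U.indicator u (x - t) := by
        exact ContinuousLinearMap.integral_apply hex d
    _ = ∫ y, fderiv ℝ ρ (x - y) d * U.indicator u y := by
        rw [← integral_sub_left_eq_self _ volume x]; simp
    _ = - ∫ y in U, u y * fderiv ℝ ψ y d := by
        rw [← integral_indicator hUo.measurableSet, ← integral_neg]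
        refine integral_congr_ae (Eventually.of_forall fun y => ?_)
        by_cases hy : y ∈ U
        · simp only [indicator_of_mem hy, hψd]; ring
        · simp [indicator_of_notMem hy]
    _ = ∫ y in U, ⟪g y, d⟫ * ψ y := by rw [key, neg_neg]
    _ = ∫ y, ⟪ρ (x - y) • U.indicator g y, d⟫ := by
        rw [← integral_indicator hUo.measurableSet]
        refine integral_congr_ae (Eventually.of_forall fun y => ?_)
        by_cases hy : y ∈ U
        · simp only [indicator_of_mem hy, real_inner_smul_left, ψ]; ring
        · simp [indicator_of_notMem hy]
    _ = ∫ t, ⟪ρ t • U.indicator g (x - t), d⟫ := by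
        rw [← integral_sub_left_eq_self _ volume x]; simp
    _ = _ := by
        rw [convolution]
        simp only [real_inner_comm d]
        exact integral_inner hex2 d

theorem gradient_comp_smul_add {ψ : Plane → ℝ} (hψ : Differentiable ℝ ψ) (θ : ℝ) (a x : Plane) :
    gradient (fun y => ψ (θ • y + a)) x = θ • gradient ψ (θ • x + a) := by
  refine ext_inner_right ℝ fun d => ?_
  rw [inner_gradient_left, real_inner_smul_left, inner_gradient_left]
  have h2 : HasFDerivAt (fun y : Plane => θ • y + a) (θ • ContinuousLinearMap.id ℝ Plane) x :=
    ((hasFDerivAt_id x).const_smul θ).add_const a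
  have h1 := HasFDerivAt.comp x (hψ (θ • x + a)).hasFDerivAt h2
  have h3 : fderiv ℝ (fun y => ψ (θ • y + a)) x = _ := h1.fderiv
  rw [h3]; simp

/-- Here `F` is a mollification of `f`. The three errors are mollification (doubled by the
dilation), dilation, and the factor `c`. The factor is `1` for functions and `θ` for gradients, by
the chain rule. -/
theorem eLpNorm_smul_comp_sub_le {E : Type*} [NormedAddCommGroup E] [NormedSpace ℝ E]
    {f F : Plane → E} (hf : MemLp f 2 volume) (hF : AEStronglyMeasurable F volume)
    {θ : ℝ} (hθ : 1 / 2 ≤ θ) (a : Plane) {η : ENNReal}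
    (h1 : eLpNorm (fun x => F x - f x) 2 volume ≤ η)
    (h2 : eLpNorm (fun x => f (θ • x + a) - f x) 2 volume ≤ η) (c : ℝ) (hc : |c| ≤ 1)
    (h3 : ENNReal.ofReal |c - 1| * eLpNorm f 2 volume ≤ η) :
    eLpNorm (fun x => c • F (θ • x + a) - f x) 2 volume ≤ 4 * η := by
  have hcomp : ∀ {u : Plane → E}, AEStronglyMeasurable u volume →
      AEStronglyMeasurable (fun x => u (θ • x + a)) volume := fun {u} hu => by
    refine AEStronglyMeasurable.comp_measurable (f := fun x : Plane => θ • x + a) (g := u) ?_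
      (by fun_prop)
    rw [map_smul_add_volume (by linarith : θ ≠ 0)]
    exact hu.smul_measure _
  have e : (fun x => c • F (θ • x + a) - f x) = (c • fun x => (F - f) (θ • x + a))
      + ((c • fun x => f (θ • x + a) - f x) + (c - 1) • f) := by
    ext x; simp only [Pi.sub_apply, Pi.add_apply, Pi.smul_apply]; module
  have m1 : AEStronglyMeasurable (c • fun x => (F - f) (θ • x + a)) volume :=
    (hcomp (hF.sub hf.1)).const_smul c
  have m2 : AEStronglyMeasurable (c • fun x => f (θ • x + a) - f x) volume :=
    ((hcomp hf.1).sub hf.1).const_smul c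
  have hc' : ‖c‖ₑ ≤ 1 := by
    rw [Real.enorm_eq_ofReal_abs]; simpa using hc
  have n1 : eLpNorm (c • fun x => (F - f) (θ • x + a)) 2 volume ≤ 2 * η := by
    rw [eLpNorm_const_smul, eLpNorm_comp_smul_add (by linarith)]
    calc _ ≤ 1 * (2 * η) := by
          gcongr
          · rw [show (2 : ENNReal) = ENNReal.ofReal 2 by simp]
            refine ENNReal.ofReal_le_ofReal ?_
            rw [inv_le_comm₀ (by linarith) (by norm_num)]; linarith
          · exact h1
      _ = _ := one_mul _
  have n2 : eLpNorm (c • fun x => f (θ • x + a) - f x) 2 volume ≤ η := by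
    rw [eLpNorm_const_smul]
    calc _ ≤ 1 * η := by gcongr
      _ = _ := one_mul _
  have n3 : eLpNorm ((c - 1) • f) 2 volume ≤ η := by
    rw [eLpNorm_const_smul, Real.enorm_eq_ofReal_abs]; exact h3
  rw [e]
  refine (eLpNorm_add_le m1 (m2.add (hf.1.const_smul _)) (by simp)).trans ?_
  refine (add_le_add n1 ((eLpNorm_add_le m2 (hf.1.const_smul _) (by simp)).trans
    (add_le_add n2 n3))).trans (le_of_eq (by ring))

theorem exists_dilation_parameter (x₀ : Plane) {δ₁ δ₂ : ℝ} (hδ₁ : 0 < δ₁) (hδ₂ : 0 < δ₂)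
    {N η : ENNReal} (hN : N ≠ ⊤) (hη : η ≠ 0) : ∃ θ : ℝ, 1 / 2 ≤ θ ∧ θ < 1 ∧
      |θ - 1| < δ₁ ∧ |θ - 1| < δ₂ ∧ ‖(1 - θ) • x₀‖ < δ₁ ∧ ‖(1 - θ) • x₀‖ < δ₂ ∧
      ENNReal.ofReal |θ - 1| * N ≤ η := by
  obtain ⟨κ, hκ0, hκ⟩ : ∃ κ : ℝ, 0 < κ ∧ ENNReal.ofReal κ * N ≤ η := by
    obtain ⟨κ, h0, h1⟩ := ENNReal.exists_nnreal_pos_mul_lt hN hη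
    refine ⟨κ, by exact_mod_cast h0, ?_⟩
    rw [ENNReal.ofReal_coe_nnreal]; exact h1.le
  set δ := min (min δ₁ δ₂) (min κ 1)
  have hδ : 0 < δ := by positivity
  have hδ1 : δ ≤ 1 := (min_le_right _ _).trans (min_le_right _ _)
  have hδκ : δ ≤ κ := (min_le_right _ _).trans (min_le_left _ _)
  have hδδ₁ : δ ≤ δ₁ := (min_le_left _ _).trans (min_le_left _ _)
  have hδδ₂ : δ ≤ δ₂ := (min_le_left _ _).trans (min_le_right _ _)
  -- The number `q` is `1 - θ`. The denominator makes both `q` and `q ‖x₀‖` smaller than `δ`.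
  set q : ℝ := δ / (2 * (1 + ‖x₀‖))
  have hq : 0 < q := by positivity
  have hq1 : q ≤ δ / 2 := by
    simp only [q]; rw [div_le_div_iff₀ (by positivity) (by norm_num)]
    nlinarith [norm_nonneg x₀]
  have hq2 : q * ‖x₀‖ < δ := by
    have : q * (2 * (1 + ‖x₀‖)) = δ := by simp only [q]; field_simp
    nlinarith [norm_nonneg x₀]
  have e1 : |1 - q - 1| = q := by rw [show (1 : ℝ) - q - 1 = -q by ring, abs_neg, abs_of_pos hq]
  have e2 : ‖(1 - (1 - q)) • x₀‖ = q * ‖x₀‖ := by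
    rw [norm_smul, sub_sub_cancel, Real.norm_of_nonneg hq.le]
  refine ⟨1 - q, by linarith, by linarith, ?_, ?_, ?_, ?_, ?_⟩
  · rw [e1]; linarith
  · rw [e1]; linarith
  · rw [e2]; linarith
  · rw [e2]; linarith
  · rw [e1]
    refine le_trans ?_ hκ
    gcongr; linarith

/-- Each `z` in the ball equals `θ x + (1 - θ) y` with `y ∈ B(x₀, r)`, hence lies on a segment from
`y` to `x`. Contraction towards `x₀` thus leaves a margin of width `(1 - θ) r` to the boundary,
which is room for mollification. -/
theorem ball_smul_add_subset {U : Set Plane} {x₀ : Plane} {r : ℝ}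
    (hs : ∀ y ∈ Metric.ball x₀ r, StarConvex ℝ y U) {x : Plane} (hx : x ∈ U) {θ : ℝ} (hθ0 : 0 ≤ θ)
    (hθ2 : θ < 1) : Metric.ball (θ • x + (1 - θ) • x₀) ((1 - θ) * r) ⊆ U := by
  intro z hz
  have hz' : ‖z - (θ • x + (1 - θ) • x₀)‖ < (1 - θ) * r := by
    rwa [Metric.mem_ball, dist_eq_norm] at hz
  have h1θ : 0 < 1 - θ := by linarith
  have hy : (1 - θ)⁻¹ • (z - θ • x) ∈ Metric.ball x₀ r := by
    rw [Metric.mem_ball, dist_eq_norm]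
    have : (1 - θ)⁻¹ • (z - θ • x) - x₀ = (1 - θ)⁻¹ • (z - (θ • x + (1 - θ) • x₀)) := by
      simp only [smul_sub, smul_add]
      rw [smul_smul (1 - θ)⁻¹ (1 - θ), inv_mul_cancel₀ h1θ.ne', one_smul]; abel
    rw [this, norm_smul, Real.norm_of_nonneg (by positivity), inv_mul_lt_iff₀ h1θ]
    exact hz'
  have := hs _ hy hx h1θ.le hθ0 (by ring)
  rwa [smul_smul, mul_inv_cancel₀ h1θ.ne', one_smul, sub_add_cancel] at this

namespace H1

set_option maxHeartbeats 1000000 in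
/-- Smooth functions are dense in `H¹(U)` if `U` is star-shaped with respect to a ball. -/
theorem denseRange_ofSmooth {U : Set Plane} (hU : Bornology.IsBounded U) (hUo : IsOpen U)
    {x₀ : Plane} {r : ℝ} (hr : 0 < r) (hs : ∀ y ∈ Metric.ball x₀ r, StarConvex ℝ y U) :
    DenseRange (ofSmooth hU) := by
  rw [Metric.denseRange_iff]
  intro u ε hε
  have hum : MeasurableSet U := hUo.measurableSet
  set f : Plane → ℝ := U.indicator u.1.1
  set g : Plane → Plane := U.indicator u.1.2
  have hfm : StronglyMeasurable f := (Lp.stronglyMeasurable u.1.1).indicator hum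
  have hgm : StronglyMeasurable g := (Lp.stronglyMeasurable u.1.2).indicator hum
  have hf : MemLp f 2 volume := (memLp_indicator_iff_restrict hum).2 (Lp.memLp u.1.1)
  have hg : MemLp g 2 volume := (memLp_indicator_iff_restrict hum).2 (Lp.memLp u.1.2)
  -- The final error is `4 η = ε / 2`.
  set η : ENNReal := ENNReal.ofReal (ε / 8)
  have hη : η ≠ 0 := by simp [η, hε]
  obtain ⟨δ₁, hδ₁, h₁⟩ := exists_eLpNorm_comp_smul_add_sub_le hf hη
  obtain ⟨δ₂, hδ₂, h₂⟩ := exists_eLpNorm_comp_smul_add_sub_le hg hη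
  obtain ⟨θ, hθ1, hθ2, hθδ₁, hθδ₂, ha₁, ha₂, hθg⟩ : ∃ θ : ℝ, 1 / 2 ≤ θ ∧ θ < 1 ∧
      |θ - 1| < δ₁ ∧ |θ - 1| < δ₂ ∧ ‖(1 - θ) • x₀‖ < δ₁ ∧ ‖(1 - θ) • x₀‖ < δ₂ ∧
      ENNReal.ofReal |θ - 1| * eLpNorm g 2 volume ≤ η :=
    exists_dilation_parameter x₀ hδ₁ hδ₂ hg.2.ne hη
  set a := (1 - θ) • x₀
  obtain ⟨φ, hφ⟩ : ∃ φ : ContDiffBump (0 : Plane), φ.rOut = min (min δ₁ δ₂) ((1 - θ) * r) / 2 := by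
    have : 0 < (1 - θ) * r := mul_pos (by linarith) hr
    have : 0 < min (min δ₁ δ₂) ((1 - θ) * r) := by positivity
    exact ⟨⟨min (min δ₁ δ₂) ((1 - θ) * r) / 4, min (min δ₁ δ₂) ((1 - θ) * r) / 2, by positivity,
      by linarith⟩, rfl⟩
  have hφ0 : 0 < φ.rOut := φ.rOut_pos
  have hφ1 : φ.rOut < δ₁ := by
    have : min (min δ₁ δ₂) ((1 - θ) * r) ≤ δ₁ := (min_le_left _ _).trans (min_le_left _ _)
    linarith
  have hφ2 : φ.rOut < δ₂ := by
    have : min (min δ₁ δ₂) ((1 - θ) * r) ≤ δ₂ := (min_le_left _ _).trans (min_le_right _ _)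
    linarith
  have hφ3 : φ.rOut < (1 - θ) * r := by
    have : min (min δ₁ δ₂) ((1 - θ) * r) ≤ (1 - θ) * r := min_le_right _ _
    linarith
  have hball : ∀ x ∈ U, Metric.closedBall (θ • x + a) φ.rOut ⊆ U :=
    fun x hx => (Metric.closedBall_subset_ball hφ3).trans (ball_smul_add_subset hs hx (by linarith) hθ2)
  have hfl : LocallyIntegrable f volume := hf.locallyIntegrable (by simp)
  have hgl : LocallyIntegrable g volume := hg.locallyIntegrable (by simp)
  set F := φ.normed volume ⋆[ContinuousLinearMap.lsmul ℝ ℝ, volume] f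
  set G := φ.normed volume ⋆[ContinuousLinearMap.lsmul ℝ ℝ, volume] g
  have hFs : ContDiff ℝ ∞ F := φ.hasCompactSupport_normed.contDiff_convolution_left _
    φ.contDiff_normed hfl
  have hGs : Continuous G := φ.hasCompactSupport_normed.continuous_convolution_left _
    φ.continuous_normed hgl
  have htr : ∀ {E : Type} [NormedAddCommGroup E] (k : Plane → E) (t : Plane),
      (fun x => k ((1 : ℝ) • x + -t) - k x) = fun x => k (x - t) - k x := by
    intro E _ k t; ext x; rw [one_smul, ← sub_eq_add_neg x t]
  have hF1 : eLpNorm (fun x => F x - f x) 2 volume ≤ η := by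
    refine eLpNorm_convolution_sub_le φ hfm hf fun t ht => ?_
    rw [← htr]; exact h₁ 1 (-t) (by simpa using hδ₁) (by rw [norm_neg]; linarith)
  have hG1 : eLpNorm (fun x => G x - g x) 2 volume ≤ η := by
    refine eLpNorm_convolution_sub_le φ hgm hg fun t ht => ?_
    rw [← htr]; exact h₂ 1 (-t) (by simpa using hδ₂) (by rw [norm_neg]; linarith)
  have hF2 := eLpNorm_smul_comp_sub_le hf hFs.continuous.aestronglyMeasurable hθ1 a hF1
    (h₁ θ a hθδ₁ ha₁) 1 (by simp) (by simp)
  have hG2 := eLpNorm_smul_comp_sub_le hg hGs.aestronglyMeasurable hθ1 a hG1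
    (h₂ θ a hθδ₂ ha₂) θ (by rw [abs_of_pos (by linarith)]; exact hθ2.le) hθg
  have h4η : (4 * η).toReal < ε := by
    simp only [η]
    rw [ENNReal.toReal_mul, ENNReal.toReal_ofReal (by positivity)]
    norm_num; linarith
  have h4η' : 4 * η ≠ ⊤ := ENNReal.mul_ne_top (by simp) ENNReal.ofReal_ne_top
  -- The approximant is the mollified zero extension, evaluated after contraction towards `x₀`. For
  -- `x ∈ U` the contracted point is farther than the mollification radius from the complement of
  -- `U`, so `gradient_convolution` applies there.
  set ψ : smoothFn := ⟨fun x => F (θ • x + a),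
    show ContDiff ℝ ∞ fun x => F (θ • x + a) from
      hFs.comp ((contDiff_id.const_smul θ).add contDiff_const)⟩
  refine ⟨ψ, ?_⟩
  rw [Subtype.dist_eq, Prod.dist_eq, max_lt_iff, Lp.dist_def, Lp.dist_def]
  constructor
  · refine lt_of_le_of_lt (ENNReal.toReal_mono h4η' ?_) h4η
    refine le_trans (le_of_eq (eLpNorm_congr_norm_ae ?_))
      ((eLpNorm_restrict_le _ _ _ U).trans hF2)
    filter_upwards [fn_ofSmooth hU ψ, ae_restrict_mem hum] with x hx hxU
    have e1 : (ofSmooth hU ψ).1.1 x = F (θ • x + a) := hx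
    simp only [Pi.sub_apply, e1, one_smul, f, indicator_of_mem hxU]
    exact norm_sub_rev _ _
  · refine lt_of_le_of_lt (ENNReal.toReal_mono h4η' ?_) h4η
    refine le_trans (le_of_eq (eLpNorm_congr_norm_ae ?_))
      ((eLpNorm_restrict_le _ _ _ U).trans hG2)
    filter_upwards [grad_ofSmooth hU ψ, ae_restrict_mem hum] with x hx hxU
    have e1 : (ofSmooth hU ψ).1.2 x = θ • G (θ • x + a) := by
      refine hx.trans ?_
      rw [show gradient ψ.1 x = _ from
        gradient_comp_smul_add (hFs.differentiable (by simp)) θ a x]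
      rw [gradient_convolution hUo hfl hgl u.2 φ (hball x hxU)]
    simp only [Pi.sub_apply, e1, g, indicator_of_mem hxU]
    exact norm_sub_rev _ _

end H1

/-! ### The Poincaré inequality for smooth functions. -/

/-- The mean is the best constant in `L²`, since `f` minus its mean is orthogonal to constants. In
the Poincaré inequality this lets the mean be replaced by `φ y`, followed by averaging over `y` in
the ball. -/
theorem integral_sq_sub_average_le {α : Type*} [MeasurableSpace α] {μ : Measure α}
    [IsFiniteMeasure μ] {f : α → ℝ} (hf : MemLp f 2 μ) (c : ℝ) :
    ∫ x, (f x - ⨍ y, f y ∂μ) ^ 2 ∂μ ≤ ∫ x, (f x - c) ^ 2 ∂μ := by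
  set m := ⨍ y, f y ∂μ
  have hfi : Integrable f μ := hf.integrable (by simp)
  have h1 : Integrable (fun x => (f x - m) ^ 2) μ := (hf.sub (memLp_const m)).integrable_sq
  have h2 : Integrable (fun x => f x - m) μ := hfi.sub (integrable_const m)
  have h0 : ∫ x, (f x - m) ∂μ = 0 := integral_sub_average μ f
  have e : ∫ x, (f x - c) ^ 2 ∂μ
      = ∫ x, (f x - m) ^ 2 ∂μ + ∫ x, (2 * (m - c) * (f x - m) + (m - c) ^ 2) ∂μ := by
    have h3 : Integrable (fun x => 2 * (m - c) * (f x - m) + (m - c) ^ 2) μ :=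
      (h2.const_mul _).add (integrable_const _)
    rw [← integral_add h1 h3]
    congr 1; ext x; ring
  rw [e, integral_add (h2.const_mul _) (integrable_const _), integral_const_mul, h0]
  have : 0 ≤ ∫ _, (m - c) ^ 2 ∂μ := integral_nonneg fun _ => sq_nonneg _
  linarith

theorem lintegral_enorm_sq_sub_average_le {α : Type*} [MeasurableSpace α] {μ : Measure α}
    [IsFiniteMeasure μ] {f : α → ℝ} (hf : MemLp f 2 μ) (c : ℝ) :
    ∫⁻ x, ‖f x - ⨍ y, f y ∂μ‖ₑ ^ 2 ∂μ ≤ ∫⁻ x, ‖f x - c‖ₑ ^ 2 ∂μ := by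
  have key : ∀ d : ℝ, ∫⁻ x, ‖f x - d‖ₑ ^ 2 ∂μ = ENNReal.ofReal (∫ x, (f x - d) ^ 2 ∂μ) := by
    intro d
    have hi : Integrable (fun x => (f x - d) ^ 2) μ := (hf.sub (memLp_const d)).integrable_sq
    rw [ofReal_integral_eq_lintegral_ofReal hi
      (Eventually.of_forall fun _ => sq_nonneg _)]
    refine lintegral_congr fun x => ?_
    rw [Real.enorm_eq_ofReal_abs, ← ENNReal.ofReal_pow (abs_nonneg _), sq_abs]
  rw [key, key]
  exact ENNReal.ofReal_le_ofReal (integral_sq_sub_average_le hf c)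

theorem enorm_gradient {φ : Plane → ℝ} (x : Plane) : ‖gradient φ x‖ₑ = ‖fderiv ℝ φ x‖ₑ := by
  simp only [gradient, enorm_eq_nnnorm, LinearIsometryEquiv.nnnorm_map]

theorem enorm_sub_sq_le_lintegral_gradient {φ : Plane → ℝ} (hφ : ContDiff ℝ ∞ φ) (x y : Plane) :
    ‖φ x - φ y‖ₑ ^ 2 ≤
      ‖x - y‖ₑ ^ 2 * ∫⁻ s in Ioc (0 : ℝ) 1, ‖gradient φ (y + s • (x - y))‖ₑ ^ 2 := by
  have hprob : IsProbabilityMeasure (volume.restrict (Ioc (0 : ℝ) 1)) := ⟨by simp⟩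
  have hcont : Continuous fun s : ℝ => gradient φ (y + s • (x - y)) :=
    (continuous_gradient hφ).comp (by fun_prop)
  have hd : ∀ s : ℝ, HasDerivAt (fun s : ℝ => φ (y + s • (x - y)))
      (fderiv ℝ φ (y + s • (x - y)) (x - y)) s := by
    intro s
    have h1 : HasDerivAt (fun s : ℝ => y + s • (x - y)) (x - y) s := by
      simpa using ((hasDerivAt_id s).smul_const (x - y)).const_add y
    exact (hφ.differentiable (by simp) _).hasFDerivAt.comp_hasDerivAt s h1
  have hc2 : Continuous fun s : ℝ => fderiv ℝ φ (y + s • (x - y)) (x - y) :=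
    (continuous_fderiv_test hφ (x - y)).comp (by fun_prop : Continuous fun s : ℝ => y + s • (x - y))
  have e := intervalIntegral.integral_eq_sub_of_hasDerivAt (a := 0) (b := 1) (fun s _ => hd s)
    (hc2.intervalIntegrable _ _)
  simp only [one_smul, zero_smul, add_zero, add_sub_cancel] at e
  rw [← e, intervalIntegral.integral_of_le zero_le_one]
  have hm : Measurable fun s : ℝ => ‖gradient φ (y + s • (x - y))‖ₑ := hcont.enorm.measurable
  calc _ ≤ (∫⁻ s in Ioc (0 : ℝ) 1, ‖x - y‖ₑ * ‖gradient φ (y + s • (x - y))‖ₑ) ^ 2 := by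
        gcongr
        refine (enorm_integral_le_lintegral_enorm _).trans (lintegral_mono fun s => ?_)
        rw [enorm_gradient, mul_comm]
        exact ContinuousLinearMap.le_opENorm _ _
    _ = ‖x - y‖ₑ ^ 2 * (∫⁻ s in Ioc (0 : ℝ) 1, ‖gradient φ (y + s • (x - y))‖ₑ) ^ 2 := by
        rw [lintegral_const_mul _ hm, mul_pow]
    _ ≤ _ := by gcongr; exact sq_lintegral_le hm.aemeasurable

/-- For fixed `s`, either `x` or `y` is substituted by the point between them. -/
theorem lintegral_lintegral_comp_segment_le {U B : Set Plane} (hBU : B ⊆ U) {G : Plane → ENNReal}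
    (hG : Measurable G) (s : ℝ) :
    ∫⁻ x in U, ∫⁻ y in B, G (y + s • (x - y)) ≤ 4 * volume U * ∫⁻ z, G z := by
  have hfour : ∀ {θ : ℝ}, 1 / 2 ≤ θ → ENNReal.ofReal (θ ^ 2)⁻¹ ≤ 4 := by
    intro θ hθ
    rw [show (4 : ENNReal) = ENNReal.ofReal 4 by simp]
    refine ENNReal.ofReal_le_ofReal ?_
    rw [inv_le_comm₀ (by positivity) (by norm_num)]; nlinarith
  -- Substituting for `y` costs the Jacobian factor `(1 - s)⁻²`, substituting for `x` costs `s⁻²`.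
  -- One of the two is at most `4`.
  by_cases h : s ≤ 1 / 2
  · calc _ ≤ ∫⁻ x in U, 4 * ∫⁻ z, G z := by
          refine lintegral_mono fun x => (setLIntegral_le_lintegral _ _).trans ?_
          have e : ∀ y : Plane, y + s • (x - y) = (1 - s) • y + s • x := fun y => by module
          simp only [e]
          rw [lintegral_comp_smul_add (by linarith)]
          gcongr
          exact hfour (by linarith)
      _ = _ := by rw [lintegral_const, Measure.restrict_apply_univ]; ring
  · push Not at h
    rw [lintegral_lintegral_swap (by fun_prop)]
    calc _ ≤ ∫⁻ y in B, 4 * ∫⁻ z, G z := by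
          refine lintegral_mono fun y => (setLIntegral_le_lintegral _ _).trans ?_
          have e : ∀ x : Plane, y + s • (x - y) = s • x + (1 - s) • y := fun x => by module
          simp only [e]
          rw [lintegral_comp_smul_add (by linarith)]
          gcongr
          exact hfour (by linarith)
      _ = 4 * volume B * ∫⁻ z, G z := by rw [lintegral_const, Measure.restrict_apply_univ]; ring
      _ ≤ _ := by gcongr

/-- The Poincaré inequality for smooth functions on a set that is star-shaped with respect to `B`. -/
theorem poincare_smooth {U B : Set Plane} (hUm : MeasurableSet U) (hBm : MeasurableSet B)
    (hU : Bornology.IsBounded U)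
    (hBU : B ⊆ U) (hs : ∀ y ∈ B, StarConvex ℝ y U) {φ : Plane → ℝ} (hφ : ContDiff ℝ ∞ φ) :
    volume B * ∫⁻ x in U, ‖φ x - ⨍ z in U, φ z‖ₑ ^ 2 ≤
      ENNReal.ofReal (Metric.diam U ^ 2) * (4 * volume U * ∫⁻ x in U, ‖gradient φ x‖ₑ ^ 2) := by
  have hfin : IsFiniteMeasure (volume.restrict U) := ⟨by simpa using hU.measure_lt_top⟩
  have hL := hφ.continuous.memLp_restrict_of_isBounded hU
  set G : Plane → ENNReal := U.indicator fun x => ‖gradient φ x‖ₑ ^ 2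
  have hG : Measurable G :=
    ((continuous_gradient hφ).enorm.measurable.pow_const 2).indicator hUm
  have hcφ := hφ.continuous
  calc volume B * ∫⁻ x in U, ‖φ x - ⨍ z in U, φ z‖ₑ ^ 2
      = ∫⁻ y in B, ∫⁻ x in U, ‖φ x - ⨍ z in U, φ z‖ₑ ^ 2 := by
        rw [lintegral_const, Measure.restrict_apply_univ, mul_comm]
    _ ≤ ∫⁻ y in B, ∫⁻ x in U, ‖φ x - φ y‖ₑ ^ 2 :=
        lintegral_mono fun y => lintegral_enorm_sq_sub_average_le hL _
    _ ≤ ∫⁻ y in B, ∫⁻ x in U, ENNReal.ofReal (Metric.diam U ^ 2) *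
          ∫⁻ s in Ioc (0 : ℝ) 1, G (y + s • (x - y)) := by
        refine setLIntegral_mono' hBm fun y hy => setLIntegral_mono' hUm fun x hx => ?_
        refine (enorm_sub_sq_le_lintegral_gradient hφ x y).trans ?_
        gcongr 1
        · rw [ENNReal.ofReal_pow Metric.diam_nonneg]
          gcongr
          rw [← ofReal_norm, ← dist_eq_norm]
          exact ENNReal.ofReal_le_ofReal (Metric.dist_le_diam_of_mem hU hx (hBU hy))
        · refine setLIntegral_mono' measurableSet_Ioc fun s hs' => ?_
          have : y + s • (x - y) ∈ U := (hs y hy).add_smul_sub_mem hx hs'.1.le hs'.2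
          simp only [G, indicator_of_mem this]; exact le_rfl
    _ = ENNReal.ofReal (Metric.diam U ^ 2) * ∫⁻ s in Ioc (0 : ℝ) 1, ∫⁻ x in U, ∫⁻ y in B,
          G (y + s • (x - y)) := by
        have hm : Measurable fun p : (Plane × Plane) × ℝ => G (p.1.1 + p.2 • (p.1.2 - p.1.1)) :=
          hG.comp (by fun_prop)
        have hm1 : Measurable fun p : Plane × Plane =>
            ∫⁻ s in Ioc (0 : ℝ) 1, G (p.1 + s • (p.2 - p.1)) := hm.lintegral_prod_right'
        have hm2 : Measurable fun p : Plane × ℝ => ∫⁻ x in U, G (p.1 + p.2 • (x - p.1)) :=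
          (hG.comp (by fun_prop : Measurable fun q : (Plane × ℝ) × Plane =>
            q.1.1 + q.1.2 • (q.2 - q.1.1))).lintegral_prod_right'
        have e1 : ∀ y : Plane, ∫⁻ x in U, ENNReal.ofReal (Metric.diam U ^ 2) *
            ∫⁻ s in Ioc (0 : ℝ) 1, G (y + s • (x - y)) = ENNReal.ofReal (Metric.diam U ^ 2) *
            ∫⁻ s in Ioc (0 : ℝ) 1, ∫⁻ x in U, G (y + s • (x - y)) := by
          intro y
          have hm3 : Measurable fun x : Plane => ∫⁻ s in Ioc (0 : ℝ) 1, G (y + s • (x - y)) :=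
            hm1.comp (by fun_prop : Measurable fun x : Plane => (y, x))
          rw [lintegral_const_mul _ hm3]
          rw [lintegral_lintegral_swap]
          exact (hG.comp (by fun_prop : Measurable fun q : Plane × ℝ =>
            y + q.2 • (q.1 - y))).aemeasurable
        simp only [e1]
        rw [lintegral_const_mul _ hm2.lintegral_prod_right', lintegral_lintegral_swap hm2.aemeasurable]
        congr 1
        refine lintegral_congr fun s => ?_
        rw [lintegral_lintegral_swap]
        exact (hG.comp (by fun_prop : Measurable fun q : Plane × Plane =>
            q.1 + s • (q.2 - q.1))).aemeasurable
    _ ≤ ENNReal.ofReal (Metric.diam U ^ 2) * ∫⁻ s in Ioc (0 : ℝ) 1, 4 * volume U * ∫⁻ z, G z := by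
        gcongr 1
        exact lintegral_mono fun s =>
          lintegral_lintegral_comp_segment_le hBU hG s
    _ = _ := by
        rw [lintegral_const, Measure.restrict_apply_univ, Real.volume_Ioc,
          lintegral_indicator hUm]; simp

/-! ### Arc length on a segment -/

/-- Parametrization by arc length is an isometry from the line, and on the line one-dimensional
Hausdorff measure is Lebesgue measure. Rescaling to `[0, 1]` produces the length factor. -/
theorem restrict_segment_eq_map {a b : Plane} (hab : a ≠ b) :
    Measure.restrict μH[1] (segment ℝ a b) = ENNReal.ofReal ‖b - a‖ •
      Measure.map (fun τ : ℝ => a + τ • (b - a)) (volume.restrict (Icc (0 : ℝ) 1)) := by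
  set L := ‖b - a‖
  have hL : 0 < L := norm_pos_iff.2 (sub_ne_zero.2 hab.symm)
  set u : Plane := L⁻¹ • (b - a)
  have hu : ‖u‖ = 1 := by
    simp only [u]; rw [norm_smul, norm_inv, Real.norm_of_nonneg hL.le, inv_mul_cancel₀ hL.ne']
  set f : ℝ → Plane := fun t => a + t • u
  have hf : Isometry f := by
    refine Isometry.of_dist_eq fun s t => ?_
    simp only [f]
    rw [dist_add_left, dist_eq_norm, ← sub_smul, norm_smul, hu, mul_one, dist_eq_norm]
  have hfe : MeasurableEmbedding f := hf.isClosedEmbedding.measurableEmbedding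
  have hLu : ∀ τ : ℝ, f (L * τ) = a + τ • (b - a) := by
    intro τ
    simp only [f, u, smul_smul]
    rw [mul_comm L, mul_assoc, mul_inv_cancel₀ hL.ne', mul_one]
  have hpre : f ⁻¹' segment ℝ a b = Icc 0 L := by
    ext t
    rw [segment_eq_image', mem_preimage, mem_image]
    constructor
    · rintro ⟨τ, hτ, h⟩
      have : L * τ = t := hf.injective (by rw [hLu, ← h])
      rw [← this]
      exact ⟨mul_nonneg hL.le hτ.1, mul_le_of_le_one_right hL.le hτ.2⟩
    · intro ht
      refine ⟨L⁻¹ * t, ⟨mul_nonneg (by positivity) ht.1, ?_⟩, ?_⟩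
      · rw [inv_mul_le_iff₀ hL, mul_one]; exact ht.2
      · show a + (L⁻¹ * t) • (b - a) = f t
        rw [← hLu, mul_inv_cancel_left₀ hL.ne']
  have hsub : segment ℝ a b ⊆ range f := by
    rw [segment_eq_image']
    rintro _ ⟨τ, -, rfl⟩
    exact ⟨L * τ, hLu τ⟩
  have h1 : Measure.restrict μH[1] (segment ℝ a b) = Measure.map f (volume.restrict (Icc 0 L)) := by
    rw [← hpre, ← hfe.restrict_map, ← hausdorffMeasure_real, hf.map_hausdorffMeasure (by simp),
      Measure.restrict_restrict_of_subset hsub]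
  have hme : MeasurableEmbedding (fun x : ℝ => L * x) :=
    (Homeomorph.mulLeft₀ L hL.ne').measurableEmbedding
  have h2 : (volume.restrict (Icc 0 L) : Measure ℝ)
      = ENNReal.ofReal L • Measure.map (fun x => L * x) (volume.restrict (Icc (0 : ℝ) 1)) := by
    have e : (fun x : ℝ => L * x) ⁻¹' Icc 0 L = Icc 0 1 := by
      rw [Set.preimage_const_mul_Icc₀ _ _ hL, zero_div, div_self hL.ne']
    rw [← e, ← hme.restrict_map, ← Measure.restrict_smul]
    congr 1
    have := Real.smul_map_volume_mul_left hL.ne'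
    rw [abs_of_pos hL] at this
    exact this.symm
  rw [h1, h2, Measure.map_smul, Measure.map_map hf.continuous.measurable (by fun_prop)]
  congr 2
  ext1 τ
  exact hLu τ

theorem lintegral_segment {a b : Plane} (hab : a ≠ b) {F : Plane → ENNReal} (hF : Measurable F) :
    ∫⁻ x in segment ℝ a b, F x ∂μH[1] =
      ENNReal.ofReal ‖b - a‖ * ∫⁻ τ in Icc (0 : ℝ) 1, F (a + τ • (b - a)) := by
  rw [restrict_segment_eq_map hab, lintegral_smul_measure, smul_eq_mul,
    lintegral_map hF (by fun_prop)]

/-! ### The trace inequality -/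

/-- The determinant of two vectors in the plane. -/
def cross (c d : Plane) : ℝ := c 0 * d 1 - c 1 * d 0

theorem lintegral_add_smul_add_smul {c d : Plane} (hcd : cross c d ≠ 0) (x₀ : Plane)
    {H : Plane → ENNReal} (hH : Measurable H) :
    ENNReal.ofReal |cross c d| * ∫⁻ s : ℝ, ∫⁻ q : ℝ, H (x₀ + s • c + q • d) = ∫⁻ x, H x := by
  set A : Plane →ₗ[ℝ] Plane := Matrix.toLpLin 2 2 !![c 0, d 0; c 1, d 1]
  have hA : ∀ p : Plane, A p = p 0 • c + p 1 • d := by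
    intro p
    ext i
    fin_cases i <;> simp [A, Matrix.toLpLin_apply, dotProduct, Fin.sum_univ_two, mul_comm]
  have hdet : LinearMap.det A = cross c d := by
    simp only [A, LinearMap.det_toLpLin, Matrix.det_fin_two_of, cross]; ring
  have hAm : Measurable A := A.continuous_of_finiteDimensional.measurable
  have h1 : ∫⁻ p : Plane, H (x₀ + A p) = ENNReal.ofReal |(cross c d)⁻¹| * ∫⁻ x, H x := by
    have := Measure.map_linearMap_addHaar_eq_smul_addHaar (volume : Measure Plane) (f := A)
      (by rwa [hdet])
    rw [← lintegral_map (f := fun y => H (x₀ + y)) (by fun_prop) hAm, this, hdet,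
      lintegral_smul_measure, smul_eq_mul, lintegral_add_left_eq_self]
  have h2 : ∫⁻ p : Plane, H (x₀ + A p) = ∫⁻ s : ℝ, ∫⁻ q : ℝ, H (x₀ + s • c + q • d) := by
    have m1 := (EuclideanSpace.volume_preserving_symm_measurableEquiv_toLp (Fin 2))
    have m2 := (volume_preserving_finTwoArrow ℝ).comp m1
    have hm : Measurable fun z : ℝ × ℝ => H (x₀ + z.1 • c + z.2 • d) := hH.comp (by fun_prop)
    have e := m2.lintegral_comp hm
    rw [Measure.volume_eq_prod, lintegral_prod _ hm.aemeasurable] at e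
    rw [← e]
    refine lintegral_congr fun p => ?_
    rw [hA, add_assoc]
    rfl
  rw [← h2, h1, ← mul_assoc, ← ENNReal.ofReal_mul (abs_nonneg _), ← abs_mul,
    mul_inv_cancel₀ hcd, abs_one, ENNReal.ofReal_one, one_mul]

/-- Coordinates `(s, τ) ↦ x₀ + s (c + τ d)` on the triangle with apex `x₀` have Jacobian `s |cross c
d|`. They arise from the affine coordinates by the substitution `q = s τ`. -/
theorem lintegral_triangle_le {U : Set Plane} (hUm : MeasurableSet U) {x₀ c d : Plane}
    (hcd : cross c d ≠ 0)
    (hU : ∀ s ∈ Ioo (0 : ℝ) 1, ∀ τ ∈ Icc (0 : ℝ) 1, x₀ + s • (c + τ • d) ∈ U) {H : Plane → ENNReal}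
    (hH : Measurable H) :
    ENNReal.ofReal |cross c d| * ∫⁻ s in Ioo (0 : ℝ) 1, ∫⁻ τ in Icc (0 : ℝ) 1,
      ENNReal.ofReal s * H (x₀ + s • (c + τ • d)) ≤ ∫⁻ x in U, H x := by
  rw [← lintegral_indicator hUm, ← lintegral_add_smul_add_smul hcd x₀ (hH.indicator hUm)]
  refine mul_le_mul' le_rfl ?_
  refine le_trans ?_ (setLIntegral_le_lintegral (Ioo (0 : ℝ) 1) _)
  refine setLIntegral_mono' measurableSet_Ioo fun s hs => ?_
  have hm : Measurable fun q : ℝ => U.indicator H (x₀ + s • c + q • d) :=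
    (hH.indicator hUm).comp (by fun_prop)
  have e : ∫⁻ q : ℝ, U.indicator H (x₀ + s • c + q • d)
      = ENNReal.ofReal s * ∫⁻ τ : ℝ, U.indicator H (x₀ + s • (c + τ • d)) := by
    conv_lhs => rw [← Real.smul_map_volume_mul_left hs.1.ne']
    rw [lintegral_smul_measure, lintegral_map hm (by fun_prop), abs_of_pos hs.1, smul_eq_mul]
    congr 1
    refine lintegral_congr fun τ => ?_
    rw [smul_add, smul_smul, add_assoc]
  have hm2 : Measurable fun τ : ℝ => U.indicator H (x₀ + s • (c + τ • d)) :=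
    (hH.indicator hUm).comp (by fun_prop)
  rw [e, ← lintegral_const_mul _ hm2]
  refine le_trans ?_ (setLIntegral_le_lintegral (Icc (0 : ℝ) 1) _)
  refine setLIntegral_mono' measurableSet_Icc fun τ hτ => ?_
  rw [indicator_of_mem (hU s hs τ hτ)]

/-- The fundamental theorem of calculus is applied to `s² φ(x₀ + s v)²`. The weight `s²` removes the
value at the apex, and Young's inequality with `s ≤ 1` leaves the factor `s`, which is the Jacobian
of `lintegral_triangle_le`. -/
theorem sq_le_integral_ray {φ : Plane → ℝ} (hφ : ContDiff ℝ ∞ φ) (x₀ v : Plane) :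
    φ (x₀ + v) ^ 2 ≤ ∫ s in (0 : ℝ)..1,
      s * (3 * φ (x₀ + s • v) ^ 2 + ‖v‖ ^ 2 * ‖gradient φ (x₀ + s • v)‖ ^ 2) := by
  have hd : ∀ s : ℝ, HasDerivAt (fun s : ℝ => φ (x₀ + s • v))
      (fderiv ℝ φ (x₀ + s • v) v) s := by
    intro s
    have h1 : HasDerivAt (fun s : ℝ => x₀ + s • v) v s := by
      simpa using ((hasDerivAt_id s).smul_const v).const_add x₀
    exact (hφ.differentiable (by simp) _).hasFDerivAt.comp_hasDerivAt s h1
  have hline : Continuous fun s : ℝ => x₀ + s • v := by fun_prop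
  have hc0 : Continuous fun s : ℝ => φ (x₀ + s • v) := hφ.continuous.comp hline
  have hc1 : Continuous fun s : ℝ => fderiv ℝ φ (x₀ + s • v) v :=
    (continuous_fderiv_test hφ v).comp hline
  have hc2 : Continuous fun s : ℝ => gradient φ (x₀ + s • v) := (continuous_gradient hφ).comp hline
  have e := intervalIntegral.integral_eq_sub_of_hasDerivAt (a := 0) (b := 1)
    (fun s _ => ((hasDerivAt_id s).pow 2).mul ((hd s).pow 2))
    (Continuous.intervalIntegrable (by simp only [id, Pi.pow_apply]; fun_prop) _ _)
  have e2 : φ (x₀ + v) ^ 2 = ∫ s in (0 : ℝ)..1, (2 * s * φ (x₀ + s • v) ^ 2 +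
      s ^ 2 * (2 * φ (x₀ + s • v) * fderiv ℝ φ (x₀ + s • v) v)) := by
    simp only [Pi.mul_apply, Pi.pow_apply, id] at e
    norm_num at e
    rw [← e]
  rw [e2]
  refine intervalIntegral.integral_mono_on zero_le_one
    (Continuous.intervalIntegrable (by fun_prop) _ _)
    (Continuous.intervalIntegrable (by fun_prop) _ _) fun s hs => ?_
  set p := φ (x₀ + s • v)
  set D := fderiv ℝ φ (x₀ + s • v) v
  have hD : D ^ 2 ≤ ‖v‖ ^ 2 * ‖gradient φ (x₀ + s • v)‖ ^ 2 := by
    have : |D| ≤ ‖gradient φ (x₀ + s • v)‖ * ‖v‖ := by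
      simp only [D]; rw [← inner_gradient_left]; exact abs_real_inner_le_norm _ _
    rw [← sq_abs, ← mul_pow, mul_comm ‖v‖]
    gcongr
  have h1 : s ^ 2 * (2 * p * D) ≤ s * (p ^ 2 + D ^ 2) := by
    have h3 : 0 ≤ s * (p - s * D) ^ 2 := mul_nonneg hs.1 (sq_nonneg _)
    have h4 : s * (s * D) ^ 2 ≤ s * D ^ 2 := by
      have : (s * D) ^ 2 ≤ D ^ 2 := by
        rw [mul_pow]; exact mul_le_of_le_one_left (sq_nonneg _) (pow_le_one₀ hs.1 hs.2)
      exact mul_le_mul_of_nonneg_left this hs.1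
    nlinarith
  have h2 : s * D ^ 2 ≤ s * (‖v‖ ^ 2 * ‖gradient φ (x₀ + s • v)‖ ^ 2) :=
    mul_le_mul_of_nonneg_left hD hs.1
  nlinarith

/-- The trace inequality for smooth functions, on the side `d` of the triangle with vertex `x₀` and
adjacent side `c`. -/
theorem trace_inequality_smooth {U : Set Plane} (hUm : MeasurableSet U) {x₀ c d : Plane} {h : ℝ}
    (hcd : cross c d ≠ 0)
    (hU : ∀ s ∈ Ioo (0 : ℝ) 1, ∀ τ ∈ Icc (0 : ℝ) 1, x₀ + s • (c + τ • d) ∈ U)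
    (hh : ∀ τ ∈ Icc (0 : ℝ) 1, ‖c + τ • d‖ ≤ h) {φ : Plane → ℝ} (hφ : ContDiff ℝ ∞ φ) :
    ENNReal.ofReal |cross c d| * ∫⁻ τ in Icc (0 : ℝ) 1, ‖φ (x₀ + (c + τ • d))‖ₑ ^ 2 ≤
      3 * (∫⁻ x in U, ‖φ x‖ₑ ^ 2) + ENNReal.ofReal (h ^ 2) * ∫⁻ x in U, ‖gradient φ x‖ₑ ^ 2 := by
  have hcφ := hφ.continuous
  have hcg := continuous_gradient hφ
  set H : Plane → ENNReal := fun x => 3 * ‖φ x‖ₑ ^ 2 + ENNReal.ofReal (h ^ 2) * ‖gradient φ x‖ₑ ^ 2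
  have hm1 : Measurable fun x => 3 * ‖φ x‖ₑ ^ 2 := (hcφ.enorm.measurable.pow_const 2).const_mul _
  have hm2 : Measurable fun x => ‖gradient φ x‖ₑ ^ 2 := hcg.enorm.measurable.pow_const 2
  have hH : Measurable H := hm1.add (hm2.const_mul _)
  have e : ∫⁻ x in U, H x = 3 * (∫⁻ x in U, ‖φ x‖ₑ ^ 2) +
      ENNReal.ofReal (h ^ 2) * ∫⁻ x in U, ‖gradient φ x‖ₑ ^ 2 := by
    simp only [H]
    rw [lintegral_add_left hm1, lintegral_const_mul _ (hcφ.enorm.measurable.pow_const 2),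
      lintegral_const_mul _ hm2]
  rw [← e]
  refine le_trans ?_ (lintegral_triangle_le hUm hcd hU hH)
  refine mul_le_mul' le_rfl ?_
  rw [lintegral_lintegral_swap]
  swap
  · exact ((ENNReal.measurable_ofReal.comp measurable_fst).mul (hH.comp (by fun_prop))).aemeasurable
  refine setLIntegral_mono' measurableSet_Icc fun τ hτ => ?_
  set v := c + τ • d
  have key := sq_le_integral_ray hφ x₀ v
  have hcont : Continuous fun s : ℝ =>
      s * (3 * φ (x₀ + s • v) ^ 2 + ‖v‖ ^ 2 * ‖gradient φ (x₀ + s • v)‖ ^ 2) := by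
    have hline : Continuous fun s : ℝ => x₀ + s • v := by fun_prop
    have := hcφ.comp hline
    have := hcg.comp hline
    fun_prop
  have hen : ∀ y : ℝ, ‖y‖ₑ ^ 2 = ENNReal.ofReal (y ^ 2) := fun y => by
    rw [Real.enorm_eq_ofReal_abs, ← ENNReal.ofReal_pow (abs_nonneg _), sq_abs]
  rw [hen]
  refine (ENNReal.ofReal_le_ofReal key).trans ?_
  rw [intervalIntegral.integral_of_le zero_le_one, integral_Ioc_eq_integral_Ioo,
    ofReal_integral_eq_lintegral_ofReal]
  · refine setLIntegral_mono' measurableSet_Ioo fun s hs => ?_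
    rw [ENNReal.ofReal_mul hs.1.le]
    gcongr
    rw [ENNReal.ofReal_add (by positivity) (by positivity), ENNReal.ofReal_mul (by positivity)]
    simp only [H]
    rw [hen, ENNReal.ofReal_mul (by positivity)]
    gcongr
    · simp
    · exact hh τ hτ
    · rw [← ofReal_norm, ENNReal.ofReal_pow (norm_nonneg _)]
  · exact (hcont.integrableOn_Icc (a := 0) (b := 1)).mono_set Ioo_subset_Icc_self
  · refine (ae_restrict_iff' measurableSet_Ioo).2 (Eventually.of_forall fun s hs => ?_)
    have := hs.1.le
    simp only [Pi.zero_apply]; positivity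

/-! ### Domains that are star-shaped with respect to a ball. -/

/-- `U` is a bounded open set that is star-shaped with respect to the ball `B(x₀, r) ⊆ U`. -/
structure IsStarDomain (U : Set Plane) (x₀ : Plane) (r : ℝ) : Prop where
  isOpen : IsOpen U
  isBounded : Bornology.IsBounded U
  pos : 0 < r
  star : ∀ y ∈ Metric.ball x₀ r, StarConvex ℝ y U
  ball_subset : Metric.ball x₀ r ⊆ U

namespace IsStarDomain

variable {U : Set Plane} {x₀ : Plane} {r : ℝ}

theorem center_mem (hU : IsStarDomain U x₀ r) : x₀ ∈ U := hU.ball_subset (Metric.mem_ball_self hU.pos)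

/-- If `x` is replaced by a nearby `x' ∈ U`, the same point `y + s (x - y)` lies on the segment from
`y + (s / (1 - s)) (x - x')` to `x'`. The corrected starting point is still in the open ball, so
star-shapedness applies to boundary points as well. -/
theorem add_smul_sub_mem (hU : IsStarDomain U x₀ r) {x y : Plane} (hx : x ∈ closure U) (hy : y ∈ Metric.ball x₀ r) {s : ℝ}
    (hs0 : 0 ≤ s) (hs1 : s < 1) : y + s • (x - y) ∈ U := by
  have h1 : 0 < 1 - s := by linarith
  have hcont : Tendsto (fun x' => y + (s / (1 - s)) • (x - x')) (𝓝 x) (𝓝 y) := by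
    have : Continuous fun x' => y + (s / (1 - s)) • (x - x') := by fun_prop
    simpa using this.tendsto x
  have hev : ∀ᶠ x' in 𝓝 x, y + (s / (1 - s)) • (x - x') ∈ Metric.ball x₀ r :=
    hcont (Metric.isOpen_ball.mem_nhds hy)
  obtain ⟨x', hx'1, hx'2⟩ := (mem_closure_iff_frequently.1 hx).and_eventually hev |>.exists
  have := hU.star _ hx'2 hx'1 h1.le hs0 (by ring)
  convert this using 1
  rw [smul_add, smul_smul, mul_div_cancel₀ _ h1.ne']
  module

theorem volume_ne_zero (hU : IsStarDomain U x₀ r) : volume U ≠ 0 := (hU.isOpen.measure_pos volume ⟨x₀, hU.center_mem⟩).ne'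

theorem volume_ne_top (hU : IsStarDomain U x₀ r) : volume U ≠ ⊤ := hU.isBounded.measure_lt_top.ne

theorem diam_pos (hU : IsStarDomain U x₀ r) : 0 < Metric.diam U := by
  have hr := hU.pos
  refine Metric.diam_pos ⟨x₀, hU.center_mem, x₀ + (r / 2) • EuclideanSpace.single 0 1,
    hU.ball_subset ?_, ?_⟩ hU.isBounded
  · rw [Metric.mem_ball, dist_eq_norm, add_sub_cancel_left, norm_smul]
    simp [abs_of_pos hr]; linarith
  · rw [Ne, left_eq_add, smul_eq_zero, not_or]
    exact ⟨by positivity, by simp⟩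

/-- `U` lies in a disc of radius `diam U` and the ball has radius `r`, so the area of the unit disc
cancels and volumes turn into powers of lengths. -/
theorem le_of_volume_mul_le (hU : IsStarDomain U x₀ r) {N S : ℝ} (hS : 0 ≤ S)
    (key : volume (Metric.ball x₀ r) * ENNReal.ofReal (N ^ 2) ≤
      ENNReal.ofReal (Metric.diam U ^ 2) * (4 * volume U * ENNReal.ofReal (S ^ 2))) :
    N ≤ 2 * Metric.diam U ^ 2 / r * S := by
  have hr := hU.pos
  have hb := hU.isBounded
  set h := Metric.diam U
  set w := volume (Metric.ball (0 : Plane) 1)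
  have hw0 : w ≠ 0 := (Metric.measure_ball_pos volume _ one_pos).ne'
  have hw1 : w ≠ ⊤ := measure_ball_lt_top.ne
  have hB : volume (Metric.ball x₀ r) = ENNReal.ofReal (r ^ 2) * w := by
    rw [Measure.addHaar_ball volume x₀ hr.le, finrank_euclideanSpace_fin]
  have hV : volume U ≤ ENNReal.ofReal (h ^ 2) * w := by
    have : U ⊆ Metric.closedBall x₀ h := fun x hx =>
      Metric.dist_le_diam_of_mem hb hx hU.center_mem
    refine (measure_mono this).trans (le_of_eq ?_)
    rw [Measure.addHaar_closedBall volume x₀ Metric.diam_nonneg, finrank_euclideanSpace_fin]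
  have key2 : w * ENNReal.ofReal (r ^ 2 * N ^ 2) ≤ w * ENNReal.ofReal (h ^ 2 * (4 * h ^ 2 * S ^ 2)) := by
    calc w * ENNReal.ofReal (r ^ 2 * N ^ 2)
        = volume (Metric.ball x₀ r) * ENNReal.ofReal (N ^ 2) := by
          rw [hB, ENNReal.ofReal_mul (by positivity)]; ring
      _ ≤ ENNReal.ofReal (h ^ 2) * (4 * volume U * ENNReal.ofReal (S ^ 2)) := key
      _ ≤ ENNReal.ofReal (h ^ 2) * (4 * (ENNReal.ofReal (h ^ 2) * w) * ENNReal.ofReal (S ^ 2)) := by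
          gcongr
      _ = _ := by
          rw [ENNReal.ofReal_mul (by positivity), ENNReal.ofReal_mul (by positivity),
            ENNReal.ofReal_mul (by positivity)]
          simp only [ENNReal.ofReal_ofNat]; ring
  have key3 := (ENNReal.ofReal_le_ofReal_iff (by positivity)).1
    ((ENNReal.mul_le_mul_iff_right hw0 hw1).1 key2)
  refine abs_le_of_sq_le_sq' ?_ (by positivity) |>.2
  rw [div_mul_eq_mul_div, div_pow, le_div_iff₀ (by positivity)]
  nlinarith

end IsStarDomain

/-! ### Mean values and the Poincaré inequality in `H¹(U)`. -/

namespace H1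

variable {U : Set Plane}

/-- The constant function `1`. -/
noncomputable def one (hU : Bornology.IsBounded U) : H1 U :=
  ofSmooth hU ⟨fun _ => 1, show ContDiff ℝ ∞ fun _ => (1 : ℝ) from contDiff_const⟩

theorem fn_one (hU : Bornology.IsBounded U) : fn (one hU) =ᵐ[volume.restrict U] fun _ => 1 :=
  fn_ofSmooth hU _

theorem grad_one (hU : Bornology.IsBounded U) : grad (one hU) = 0 := by
  refine Lp.eq_zero_iff_ae_eq_zero.2 ((grad_ofSmooth hU _).trans ?_)
  refine Eventually.of_forall fun x => ?_
  exact gradient_fun_const x (1 : ℝ)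

/-- The mean value as a continuous linear functional. -/
noncomputable def meanL (hU : Bornology.IsBounded U) : H1 U →L[ℝ] ℝ :=
  (volume.real U)⁻¹ • (innerSL ℝ (one hU).1.1).comp
    ((ContinuousLinearMap.fst ℝ _ _).comp (H1 U).subtypeL)

theorem meanL_apply (hU : Bornology.IsBounded U) (u : H1 U) : meanL hU u = mean u := by
  have h1 : meanL hU u = (volume.real U)⁻¹ * ⟪(one hU).1.1, u.1.1⟫ := rfl
  rw [h1, L2.inner_def, mean, setAverage_eq, smul_eq_mul]
  congr 1
  refine integral_congr_ae ?_
  filter_upwards [fn_one hU] with x hx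
  have : (one hU).1.1 x = 1 := hx
  rw [this]
  simp [fn]

theorem mean_sub (hU : Bornology.IsBounded U) (u v : H1 U) : mean (u - v) = mean u - mean v := by
  simp only [← meanL_apply hU, map_sub]

theorem mean_smul (hU : Bornology.IsBounded U) (c : ℝ) (u : H1 U) : mean (c • u) = c * mean u := by
  simp only [← meanL_apply hU, map_smul, smul_eq_mul]

theorem mean_one (hU : Bornology.IsBounded U) (h0 : volume U ≠ 0) (h1 : volume U ≠ ⊤) :
    mean (one hU) = 1 := by
  rw [mean, average_congr (fn_one hU), setAverage_const h0 h1]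

theorem norm_sq_eq_lintegral {α E : Type*} [MeasurableSpace α] [NormedAddCommGroup E]
    {μ : Measure α} (f : Lp E 2 μ) : ENNReal.ofReal (‖f‖ ^ 2) = ∫⁻ x, ‖f x‖ₑ ^ 2 ∂μ := by
  rw [← eLpNorm_two_sq, ENNReal.ofReal_pow (norm_nonneg _), Lp.norm_def,
    ENNReal.ofReal_toReal (Lp.eLpNorm_ne_top f)]

/-- The deviation of `u` from its mean value, in `L²(U)`. -/
noncomputable def deviation (hU : Bornology.IsBounded U) : H1 U →L[ℝ] Lp ℝ 2 (volume.restrict U) :=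
  (ContinuousLinearMap.fst ℝ _ _).comp (H1 U).subtypeL -
    (meanL hU).smulRight (one hU).1.1

theorem deviation_apply (hU : Bornology.IsBounded U) (u : H1 U) :
    deviation hU u = u.1.1 - mean u • (one hU).1.1 := by
  rw [← meanL_apply hU]; rfl

theorem seminorm_ofSmooth_sq (hU : Bornology.IsBounded U) (φ : smoothFn) :
    ENNReal.ofReal (seminorm (ofSmooth hU φ) ^ 2) = ∫⁻ x in U, ‖gradient φ.1 x‖ₑ ^ 2 := by
  rw [seminorm, norm_sq_eq_lintegral]
  exact lintegral_congr_ae (by filter_upwards [grad_ofSmooth hU φ] with x hx; rw [hx])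

theorem norm_deviation_ofSmooth_sq (hU : Bornology.IsBounded U) (φ : smoothFn) :
    ENNReal.ofReal (‖deviation hU (ofSmooth hU φ)‖ ^ 2)
      = ∫⁻ x in U, ‖φ.1 x - ⨍ y in U, φ.1 y‖ₑ ^ 2 := by
  rw [norm_sq_eq_lintegral, deviation_apply]
  refine lintegral_congr_ae ?_
  have hm : mean (ofSmooth hU φ) = ⨍ y in U, φ.1 y := average_congr (fn_ofSmooth hU φ)
  filter_upwards [fn_ofSmooth hU φ, fn_one hU, Lp.coeFn_sub (ofSmooth hU φ).1.1
    (mean (ofSmooth hU φ) • (one hU).1.1), Lp.coeFn_smul (mean (ofSmooth hU φ)) (one hU).1.1]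
    with x h1 h2 h3 h4
  have h1' : (ofSmooth hU φ).1.1 x = φ.1 x := h1
  have h2' : (one hU).1.1 x = 1 := h2
  rw [h3, Pi.sub_apply, h4, Pi.smul_apply, h1', h2', hm, smul_eq_mul, mul_one]

/-- The Poincaré inequality on a domain that is star-shaped with respect to a ball. -/
theorem poincare {x₀ : Plane} {r : ℝ} (hU : IsStarDomain U x₀ r) (u : H1 U) :
    ‖deviation hU.isBounded u‖ ≤ 2 * Metric.diam U ^ 2 / r * seminorm u := by
  have hr := hU.pos
  have hb := hU.isBounded
  refine (denseRange_ofSmooth hb hU.isOpen hr hU.star).induction_on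
    (p := fun u => ‖deviation hb u‖ ≤ 2 * Metric.diam U ^ 2 / r * seminorm u) u ?_ ?_
  · exact isClosed_le (by fun_prop) (by unfold seminorm; fun_prop)
  intro φ
  have key := poincare_smooth hU.isOpen.measurableSet Metric.isOpen_ball.measurableSet hb
    hU.ball_subset hU.star (contDiff_smoothFn φ)
  rw [← norm_deviation_ofSmooth_sq hb, ← seminorm_ofSmooth_sq hb] at key
  exact hU.le_of_volume_mul_le (norm_nonneg _) key

theorem fst_eq (hU : Bornology.IsBounded U) (u : H1 U) :
    u.1.1 = deviation hU u + mean u • (one hU).1.1 := by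
  rw [deviation_apply, sub_add_cancel]

/-- A function with mean value and gradient zero vanishes. -/
theorem eq_zero_of_mean_of_seminorm {x₀ : Plane} {r : ℝ} (hU : IsStarDomain U x₀ r) {u : H1 U}
    (hm : mean u = 0) (hs : seminorm u = 0) : u = 0 := by
  have h1 := poincare hU u
  rw [hs, mul_zero] at h1
  have h2 : u.1.1 = 0 := by
    rw [fst_eq hU.isBounded u, hm, zero_smul, add_zero]
    exact norm_le_zero_iff.1 h1
  exact Subtype.ext (Prod.ext h2 (norm_eq_zero.1 hs))

/-- The norm of `L²(U) × L²(U)²` is bounded by the norm `‖·‖_{1,U}`. -/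
theorem exists_norm_le_meanNorm {x₀ : Plane} {r : ℝ} (hU : IsStarDomain U x₀ r) :
    ∃ C, 0 ≤ C ∧ ∀ u : H1 U, ‖u‖ ≤ C * meanNorm u := by
  have hr := hU.pos
  set A := 2 * Metric.diam U ^ 2 / r
  have hA : 0 ≤ A := by positivity
  refine ⟨A + ‖(one hU.isBounded).1.1‖ + 1, by positivity, fun u => ?_⟩
  have hs : seminorm u ≤ meanNorm u := Real.le_sqrt_of_sq_le (by nlinarith [sq_nonneg (mean u)])
  have hm : |mean u| ≤ meanNorm u :=
    Real.le_sqrt_of_sq_le (by rw [sq_abs]; nlinarith [sq_nonneg (seminorm u)])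
  have h0 : 0 ≤ meanNorm u := Real.sqrt_nonneg _
  have h1 : ‖u.1.1‖ ≤ A * meanNorm u + meanNorm u * ‖(one hU.isBounded).1.1‖ := by
    rw [fst_eq hU.isBounded u]
    refine (norm_add_le _ _).trans (add_le_add ((poincare hU u).trans (by gcongr)) ?_)
    rw [norm_smul, Real.norm_eq_abs]; gcongr
  have h2 : ‖u.1.2‖ ≤ meanNorm u := hs
  have h3 : ‖u‖ = max ‖u.1.1‖ ‖u.1.2‖ := rfl
  rw [h3]
  refine max_le ?_ ?_
  · nlinarith [norm_nonneg (one hU.isBounded).1.1]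
  · nlinarith [mul_nonneg hA h0, mul_nonneg (norm_nonneg (one hU.isBounded).1.1) h0]

end H1

/-! ### Geometry of a polygon. -/

theorem inner_plane (x y : Plane) : ⟪x, y⟫ = x 0 * y 0 + x 1 * y 1 := by
  rw [PiLp.inner_apply, Fin.sum_univ_two]; simp [mul_comm]

theorem norm_sq_plane (x : Plane) : ‖x‖ ^ 2 = x 0 ^ 2 + x 1 ^ 2 := by
  rw [EuclideanSpace.norm_sq_eq, Fin.sum_univ_two]; simp

namespace IsStarDomain

/-- The distance of the centre to the line through a segment of the boundary is at least `r`. -/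
theorem mul_norm_le_abs_cross {U : Set Plane} {x₀ : Plane} {r : ℝ} (hU : IsStarDomain U x₀ r)
    {a b : Plane} (hab : segment ℝ a b ⊆ frontier U) (hne : a ≠ b) :
    r * ‖b - a‖ ≤ |cross (a - x₀) (b - a)| := by
  by_contra! hlt
  have hnot : ∀ z ∈ segment ℝ a b, z ∉ U := fun z hz hzU => by
    have := hab hz
    rw [hU.isOpen.frontier_eq] at this; exact this.2 hzU
  have hcl : ∀ z ∈ segment ℝ a b, z ∈ closure U := fun z hz => frontier_subset_closure (hab hz)
  have ha := left_mem_segment ℝ a b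
  have hb := right_mem_segment ℝ a b
  set c := a - x₀
  set d := b - a
  have hd : d ≠ 0 := sub_ne_zero.2 hne.symm
  have hd0 : 0 < ‖d‖ := norm_pos_iff.2 hd
  have hdd : ‖d‖ ^ 2 ≠ 0 := by positivity
  set R : Plane := !₂[-d 1, d 0]
  have hR : ‖R‖ = ‖d‖ := by
    have : ‖R‖ ^ 2 = ‖d‖ ^ 2 := by rw [norm_sq_plane, norm_sq_plane]; simp [R]; ring
    exact (sq_eq_sq₀ (norm_nonneg _) (norm_nonneg _)).1 this
  -- The point `y = a + l d` is the foot of the perpendicular from `x₀`, at distance `|cross c d| /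
  -- ‖d‖`, which is less than `r` under the negated claim. If `l < 0`, then `a` lies strictly
  -- between `y` and `b`; if `l > 1`, then `b` lies strictly between `y` and `a`; otherwise `y` is
  -- on the segment. Each time a boundary point would lie in `U`.
  set l : ℝ := -(⟪c, d⟫ / ‖d‖ ^ 2)
  set y : Plane := a + l • d
  have hyx : y - x₀ = (-(cross c d) / ‖d‖ ^ 2) • R := by
    have e1 : y - x₀ = c + l • d := by simp only [y, c]; abel
    rw [e1]
    have h2 := norm_sq_plane d
    simp only [l, inner_plane, cross, R]
    ext i
    fin_cases i
    · simp; field_simp; rw [h2]; ring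
    · simp; field_simp; rw [h2]; ring
  have hy : y ∈ Metric.ball x₀ r := by
    rw [Metric.mem_ball, dist_eq_norm, hyx, norm_smul, hR, Real.norm_eq_abs, abs_div, abs_neg,
      abs_of_pos (by positivity : 0 < ‖d‖ ^ 2), div_mul_eq_mul_div, div_lt_iff₀ (by positivity)]
    nlinarith
  rcases lt_or_ge l 0 with h | h
  · refine hnot a ha ?_
    have h1 : 0 < 1 - l := by linarith
    have := hU.add_smul_sub_mem (hcl b hb) hy (s := -l / (1 - l))
      (div_nonneg (by linarith) h1.le) (by rw [div_lt_one h1]; linarith)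
    convert this using 1
    have e : b - y = (1 - l) • d := by simp only [y, d]; module
    rw [e, smul_smul, div_mul_cancel₀ _ h1.ne']
    simp only [y]; module
  rcases le_or_gt l 1 with h' | h'
  · refine hnot y ?_ (hU.ball_subset hy)
    rw [segment_eq_image']
    exact ⟨l, ⟨h, h'⟩, rfl⟩
  · refine hnot b hb ?_
    have h1 : 0 < l := by linarith
    have := hU.add_smul_sub_mem (hcl a ha) hy (s := (l - 1) / l)
      (div_nonneg (by linarith) h1.le) (by rw [div_lt_one h1]; linarith)
    convert this using 1
    have e : a - y = -(l • d) := by simp only [y]; abel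
    rw [e, smul_neg, smul_smul, div_mul_cancel₀ _ h1.ne']
    simp only [y, d]; module

end IsStarDomain

namespace MeshPolygon

variable (K : MeshPolygon)

theorem side_subset_frontier (j : K.Idx) : K.side j ⊆ frontier K.carrier := by
  rw [K.frontier_eq]; exact subset_iUnion (fun i => segment ℝ (K.vertex i) (K.vertex (i + 1))) j

theorem vertex_mem_side (j : K.Idx) : K.vertex j ∈ K.side j := left_mem_segment ℝ _ _

theorem vertex_mem_closure (j : K.Idx) : K.vertex j ∈ closure K.carrier :=
  frontier_subset_closure (K.side_subset_frontier j (K.vertex_mem_side j))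

theorem vertex_ne (j : K.Idx) : K.vertex j ≠ K.vertex (j + 1) :=
  fun h => by simpa using K.vertex_injective h

/-- The length of a side. -/
noncomputable def len (j : K.Idx) : ℝ := ‖K.vertex (j + 1) - K.vertex j‖

theorem len_pos (j : K.Idx) : 0 < K.len j := norm_pos_iff.2 (sub_ne_zero.2 (K.vertex_ne j).symm)

theorem hausdorffMeasure_side (j : K.Idx) : μH[1] (K.side j) = ENNReal.ofReal (K.len j) := by
  rw [side, hausdorffMeasure_segment, edist_dist, dist_comm, dist_eq_norm]; rfl

theorem side_injective : Function.Injective K.side := by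
  intro i j h
  by_contra hij
  have hd := K.simple i j hij
  have hm : midpoint ℝ (K.vertex i) (K.vertex (i + 1)) ∈
      openSegment ℝ (K.vertex i) (K.vertex (i + 1)) :=
    ⟨1 / 2, 1 / 2, by norm_num, by norm_num, by norm_num, by
      rw [midpoint_eq_smul_add, smul_add]; norm_num⟩
  refine Set.disjoint_left.1 hd hm ?_
  have : _ ∈ K.side i := openSegment_subset_segment ℝ _ _ hm
  rw [h] at this; exact this

theorem norm_normal (j : K.Idx) : ‖K.normal j‖ = 1 := by
  rw [normal, norm_smul, norm_inv, norm_norm]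
  have : ‖(!₂[(K.vertex (j + 1) - K.vertex j) 1, -((K.vertex (j + 1) - K.vertex j) 0)] : Plane)‖
      = ‖K.vertex (j + 1) - K.vertex j‖ := by
    refine (sq_eq_sq₀ (norm_nonneg _) (norm_nonneg _)).1 ?_
    rw [norm_sq_plane, norm_sq_plane]; simp; ring
  rw [this]; exact inv_mul_cancel₀ (K.len_pos j).ne'

theorem inner_normal_self (j : K.Idx) : ⟪K.normal j, K.normal j⟫ = 1 := by
  rw [real_inner_self_eq_norm_sq, norm_normal, one_pow]

theorem perp_eq (j : K.Idx) :
    (!₂[-((K.vertex (j + 1) - K.vertex j) 1), (K.vertex (j + 1) - K.vertex j) 0] : Plane)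
      = -(K.len j • K.normal j) := by
  rw [normal, len, smul_smul, mul_inv_cancel₀ (norm_ne_zero_iff.2 (sub_ne_zero.2 (K.vertex_ne j).symm)), one_smul]
  ext i; fin_cases i <;> simp

theorem inner_sub_normal {j : K.Idx} {x y : Plane} (hx : x ∈ K.side j) (hy : y ∈ K.side j) :
    ⟪x - y, K.normal j⟫ = 0 := by
  rw [side, segment_eq_image'] at hx hy
  obtain ⟨s, -, rfl⟩ := hx
  obtain ⟨t, -, rfl⟩ := hy
  have e : K.vertex j + s • (K.vertex (j + 1) - K.vertex j)
      - (K.vertex j + t • (K.vertex (j + 1) - K.vertex j))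
      = (s - t) • (K.vertex (j + 1) - K.vertex j) := by module
  dsimp only
  rw [e, normal, real_inner_smul_left, real_inner_smul_right, inner_plane]
  simp
  right; right; ring

theorem exists_ball_disjoint_side {j : K.Idx} {p : Plane}
    (hp : p ∈ openSegment ℝ (K.vertex j) (K.vertex (j + 1))) :
    ∃ δ > 0, ∀ i, i ≠ j → Disjoint (Metric.ball p δ) (K.side i) := by
  have hclosed : IsClosed (⋃ i ∈ ({i | i ≠ j} : Set K.Idx), K.side i) := by
    refine (Set.toFinite _).isClosed_biUnion fun i _ => ?_
    rw [side, ← convexHull_pair]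
    exact ((Set.toFinite _).isCompact_convexHull ℝ).isClosed
  have hpn : p ∉ ⋃ i ∈ ({i | i ≠ j} : Set K.Idx), K.side i := by
    simp only [mem_iUnion, not_exists]
    intro i hi h
    exact Set.disjoint_left.1 (K.simple j i (Ne.symm hi)) hp h
  obtain ⟨δ, hδ, hb⟩ := Metric.isOpen_iff.1 hclosed.isOpen_compl p hpn
  refine ⟨δ, hδ, fun i hi => Set.disjoint_left.2 fun x hx hxi => hb hx ?_⟩
  exact mem_biUnion hi hxi

/-- Near an interior point of a side, the polygon contains a half-disc. -/
theorem exists_half_ball_subset {j : K.Idx} {p : Plane}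
    (hp : p ∈ openSegment ℝ (K.vertex j) (K.vertex (j + 1))) :
    ∃ δ > 0, ∀ x ∈ Metric.ball p δ, ⟪x - p, K.normal j⟫ < 0 → x ∈ K.carrier := by
  obtain ⟨δ, hδ, hdis⟩ := K.exists_ball_disjoint_side hp
  refine ⟨δ, hδ, ?_⟩
  have hps : p ∈ K.side j := openSegment_subset_segment ℝ _ _ hp
  -- The half-disc is convex, hence connected, and misses the boundary because it avoids the line of
  -- side `j` and all other sides. By `left` it meets the polygon, so it is contained in it.
  set H : Set Plane := Metric.ball p δ ∩ {x | ⟪x - p, K.normal j⟫ < 0}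
  have hconv : Convex ℝ H := by
    refine (convex_ball p δ).inter ?_
    have : {x : Plane | ⟪x - p, K.normal j⟫ < 0} = {x : Plane | innerSL ℝ (K.normal j) x < ⟪p, K.normal j⟫} := by
      ext x; simp only [mem_ofPred_eq, inner_sub_left, sub_neg, innerSL_apply_apply]
      rw [real_inner_comm]
    rw [this]
    exact convex_halfSpace_lt (innerSL ℝ (K.normal j)).isLinear _
  have hfr : ¬ (H ∩ frontier K.carrier).Nonempty := by
    rintro ⟨x, ⟨hx1, hx2⟩, hx3⟩
    rw [K.frontier_eq, mem_iUnion] at hx3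
    obtain ⟨i, hi⟩ := hx3
    by_cases hij : i = j
    · subst hij
      have : ⟪x - p, K.normal i⟫ = 0 := K.inner_sub_normal hi hps
      simp only [mem_ofPred_eq] at hx2; linarith
    · exact Set.disjoint_left.1 (hdis i hij) hx1 hi
  have hne : (H ∩ K.carrier).Nonempty := by
    have hl := K.left j p hp
    rw [K.perp_eq j] at hl
    have h2 : ∀ᶠ ε in 𝓝[>] (0 : ℝ), p + ε • -(K.len j • K.normal j) ∈ Metric.ball p δ := by
      have : Tendsto (fun ε : ℝ => p + ε • -(K.len j • K.normal j)) (𝓝 0) (𝓝 p) := by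
        have : Continuous fun ε : ℝ => p + ε • -(K.len j • K.normal j) := by fun_prop
        simpa using this.tendsto 0
      exact (this.mono_left nhdsWithin_le_nhds).eventually (Metric.ball_mem_nhds p hδ)
    obtain ⟨ε, ⟨hε1, -⟩, hε2, hε3⟩ := (hl.and (h2.and self_mem_nhdsWithin)).exists
    refine ⟨_, ⟨hε2, ?_⟩, hε1⟩
    simp only [mem_ofPred_eq, add_sub_cancel_left]
    rw [real_inner_smul_left, inner_neg_left, real_inner_smul_left, K.inner_normal_self]
    have := K.len_pos j
    have : 0 < ε := hε3
    nlinarith [mul_pos this (K.len_pos j)]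
  have hcov : H ⊆ K.carrier ∪ (closure K.carrier)ᶜ := by
    intro x hx
    by_cases hxK : x ∈ K.carrier
    · exact Or.inl hxK
    · refine Or.inr fun hxc => hfr ⟨x, hx, ?_⟩
      rw [K.isOpen.frontier_eq]; exact ⟨hxc, hxK⟩
  exact fun x hx1 hx2 => hconv.isPreconnected.subset_left_of_subset_union K.isOpen
    isClosed_closure.isOpen_compl (disjoint_compl_right_iff_subset.2 subset_closure) hcov hne
    ⟨hx1, hx2⟩

/-- Localizes functionals on the boundary: a smooth function multiplied by `χ` has zero trace on all
sides except `j`. -/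
theorem exists_smooth_bump {j : K.Idx} {p : Plane}
    (hp : p ∈ openSegment ℝ (K.vertex j) (K.vertex (j + 1))) :
    ∃ χ : Plane → ℝ, ContDiff ℝ ∞ χ ∧ (∀ x, 0 ≤ χ x) ∧ 0 < χ p ∧
      ∀ i, i ≠ j → ∀ x ∈ K.side i, χ x = 0 := by
  obtain ⟨δ, hδ, hdis⟩ := K.exists_ball_disjoint_side hp
  let f : ContDiffBump p := ⟨δ / 2, δ, by linarith, by linarith⟩
  refine ⟨f, f.contDiff, fun x => f.nonneg, ?_, fun i hi x hx => ?_⟩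
  · exact f.pos_of_mem_ball (Metric.mem_ball_self f.rOut_pos)
  · by_contra hne
    have : x ∈ Function.support f := hne
    rw [f.support_eq] at this
    exact Set.disjoint_left.1 (hdis i hi) this hx

variable {K} {γ₀ γ₁ : ℝ}

/-- The ball is shrunk to radius exactly `γ₀ h_K`, so that the later constants contain only `γ₀` and
the diameter. The ball is inside the polygon because a nonempty star-convex set contains its centre.
-/
theorem ShapeRegular.isStarDomain (hγ₀ : 0 < γ₀) (hK : K.ShapeRegular γ₀ γ₁) :
    ∃ x₀, IsStarDomain K.carrier x₀ (γ₀ * Metric.diam K.carrier) := by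
  obtain ⟨x₀, r, hr, hs⟩ := hK.star
  have hs' : ∀ y ∈ Metric.ball x₀ (γ₀ * Metric.diam K.carrier), StarConvex ℝ y K.carrier :=
    fun y hy => hs y (Metric.ball_subset_ball hr hy)
  have hd : 0 < Metric.diam K.carrier := by
    have h1 : 0 < dist (K.vertex 0) (K.vertex (0 + 1)) := dist_pos.2 (K.vertex_ne 0)
    have h2 := Metric.dist_le_diam_of_mem K.isBounded.closure (K.vertex_mem_closure 0)
      (K.vertex_mem_closure (0 + 1))
    rw [Metric.diam_closure] at h2
    linarith
  exact ⟨x₀, K.isOpen, K.isBounded, by positivity, hs', fun y hy =>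
    (hs' y hy).mem K.isConnected.nonempty⟩

theorem ShapeRegular.mul_diam_le_len (hK : K.ShapeRegular γ₀ γ₁) (j : K.Idx) :
    γ₁ * Metric.diam K.carrier ≤ K.len j := by
  have := hK.dist_vertex (j + 1) j (by simp)
  rwa [dist_eq_norm] at this

/-- The number of vertices is bounded in terms of `γ₁`. -/
theorem ShapeRegular.card_le (hγ₀ : 0 < γ₀) (hγ₁ : 0 < γ₁) (hK : K.ShapeRegular γ₀ γ₁) :
    (Fintype.card K.Idx : ℝ) ≤ (1 + 2 / γ₁) ^ 2 := by
  obtain ⟨x₀, hU⟩ := hK.isStarDomain hγ₀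
  set h := Metric.diam K.carrier
  have hh : 0 < h := hU.diam_pos
  set w := volume (Metric.ball (0 : Plane) 1)
  have hw0 : w ≠ 0 := (Metric.measure_ball_pos volume _ one_pos).ne'
  have hw1 : w ≠ ⊤ := measure_ball_lt_top.ne
  have hvol : ∀ (x : Plane) {ρ : ℝ}, 0 ≤ ρ →
      volume (Metric.ball x ρ) = ENNReal.ofReal (ρ ^ 2) * w := fun x ρ hρ => by
    rw [Measure.addHaar_ball volume x hρ, finrank_euclideanSpace_fin]
  -- Packing: discs of radius `γ₁ h / 2` about the vertices are disjoint and lie in one disc of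
  -- radius `h + γ₁ h / 2`. The ratio of the areas is `(1 + 2 / γ₁)²`.
  have hdis : Pairwise (Function.onFun Disjoint fun i : K.Idx =>
      Metric.ball (K.vertex i) (γ₁ * h / 2)) := by
    intro i j hij
    refine Metric.ball_disjoint_ball ?_
    have := hK.dist_vertex i j hij
    simp only [h]; linarith
  have hsub : ⋃ i : K.Idx, Metric.ball (K.vertex i) (γ₁ * h / 2) ⊆
      Metric.ball (K.vertex 0) (h + γ₁ * h / 2) := by
    refine iUnion_subset fun i x hx => ?_
    have h2 := Metric.dist_le_diam_of_mem K.isBounded.closure (K.vertex_mem_closure i)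
      (K.vertex_mem_closure 0)
    rw [Metric.diam_closure] at h2
    rw [Metric.mem_ball] at hx ⊢
    have := dist_triangle x (K.vertex i) (K.vertex 0)
    simp only [h] at *; linarith
  have key := measure_mono (μ := volume) hsub
  rw [measure_iUnion hdis fun i => Metric.isOpen_ball.measurableSet, tsum_fintype,
    hvol _ (by positivity)] at key
  simp only [hvol _ (show 0 ≤ γ₁ * h / 2 by positivity)] at key
  rw [Finset.sum_const, Finset.card_univ, nsmul_eq_mul, ← mul_assoc,
    ENNReal.mul_le_mul_iff_left hw0 hw1, ← ENNReal.ofReal_natCast,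
    ← ENNReal.ofReal_mul (by positivity), ENNReal.ofReal_le_ofReal_iff (by positivity)] at key
  have e : (h + γ₁ * h / 2) ^ 2 = (1 + 2 / γ₁) ^ 2 * (γ₁ * h / 2) ^ 2 := by field_simp; ring
  rw [e] at key
  exact le_of_mul_le_mul_right key (by positivity)

end MeshPolygon

/-! ### The trace operator of a polygon and its bound. -/

namespace MeshPolygon

variable (K : MeshPolygon)

theorem isFiniteMeasure_side (j : K.Idx) : IsFiniteMeasure (Measure.restrict μH[1] (K.side j)) :=
  ⟨by rw [Measure.restrict_apply_univ, hausdorffMeasure_side]; exact ENNReal.ofReal_lt_top⟩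

theorem isCompact_side (j : K.Idx) : IsCompact (K.side j) := by
  rw [side, ← convexHull_pair]
  exact (Set.toFinite _).isCompact_convexHull ℝ

theorem memLp_side (j : K.Idx) (φ : smoothFn) :
    MemLp φ.1 2 (Measure.restrict μH[1] (K.side j)) := by
  have := K.isFiniteMeasure_side j
  have hc := (contDiff_smoothFn φ).continuous
  obtain ⟨C, hC⟩ := (K.isCompact_side j).exists_bound_of_continuousOn hc.continuousOn
  exact MemLp.of_bound hc.aestronglyMeasurable C
    ((ae_restrict_iff' (K.isCompact_side j).isClosed.measurableSet).2 (Eventually.of_forall hC))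

/-- The restriction of smooth functions to a side. -/
noncomputable def restrictSide (j : K.Idx) : smoothFn →ₗ[ℝ] L2Seg (K.side j) where
  toFun φ := (K.memLp_side j φ).toLp
  map_add' φ ψ := MemLp.toLp_add (K.memLp_side j φ) (K.memLp_side j ψ)
  map_smul' c φ := MemLp.toLp_const_smul c (K.memLp_side j φ)

theorem coeFn_restrictSide (j : K.Idx) (φ : smoothFn) :
    K.restrictSide j φ =ᵐ[Measure.restrict μH[1] (K.side j)] φ.1 :=
  (K.memLp_side j φ).coeFn_toLp

variable {K} {x₀ : Plane} {r : ℝ}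

/-- The trace inequality is applied on the triangle spanned by the centre and the side. Its double
area `|cross c d|` is at least `r` times the length of the side, so the length cancels against the
one from the arc length measure. -/
theorem norm_restrictSide_sq_le (hU : IsStarDomain K.carrier x₀ r) (j : K.Idx) (φ : smoothFn) :
    r * ‖K.restrictSide j φ‖ ^ 2 ≤ 3 * ‖(_root_.H1.ofSmooth hU.isBounded φ).1.1‖ ^ 2 +
      Metric.diam K.carrier ^ 2 * _root_.H1.seminorm (_root_.H1.ofSmooth hU.isBounded φ) ^ 2 := by
  have hr := hU.pos
  have hb := hU.isBounded
  have hlen := K.len_pos j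
  have hcr := hU.mul_norm_le_abs_cross (K.side_subset_frontier j) (K.vertex_ne j)
  change r * K.len j ≤ _ at hcr
  set c := K.vertex j - x₀
  set d := K.vertex (j + 1) - K.vertex j
  have hcr0 : 0 < |cross c d| := lt_of_lt_of_le (by positivity) hcr
  have hmem : ∀ τ ∈ Icc (0 : ℝ) 1, x₀ + (c + τ • d) ∈ closure K.carrier := by
    intro τ hτ
    refine frontier_subset_closure (K.side_subset_frontier j ?_)
    rw [side, segment_eq_image']
    exact ⟨τ, hτ, by simp only [c, d]; abel⟩
  have key := trace_inequality_smooth hU.isOpen.measurableSet (abs_pos.1 hcr0)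
    (x₀ := x₀) (h := Metric.diam K.carrier)
    (fun s hs τ hτ => by
      have := hU.add_smul_sub_mem (hmem τ hτ) (Metric.mem_ball_self hr) hs.1.le hs.2
      rwa [add_sub_cancel_left] at this)
    (fun τ hτ => by
      have := Metric.dist_le_diam_of_mem hb.closure (hmem τ hτ) (subset_closure hU.center_mem)
      rwa [Metric.diam_closure, dist_eq_norm, add_sub_cancel_left] at this)
    (contDiff_smoothFn φ)
  have e1 : ENNReal.ofReal (‖K.restrictSide j φ‖ ^ 2) = ENNReal.ofReal (K.len j) *
      ∫⁻ τ in Icc (0 : ℝ) 1, ‖φ.1 (x₀ + (c + τ • d))‖ₑ ^ 2 := by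
    rw [_root_.H1.norm_sq_eq_lintegral, lintegral_congr_ae
      (g := fun x => ‖φ.1 x‖ₑ ^ 2)
      (by filter_upwards [K.coeFn_restrictSide j φ] with x hx; rw [hx])]
    rw [side, lintegral_segment (K.vertex_ne j)
      ((contDiff_smoothFn φ).continuous.enorm.measurable.pow_const 2)]
    have : ∀ τ : ℝ, x₀ + (c + τ • d) = K.vertex j + τ • d := fun τ => by simp only [c]; abel
    simp only [this]; rfl
  have e2 : ENNReal.ofReal (‖(_root_.H1.ofSmooth hb φ).1.1‖ ^ 2)
      = ∫⁻ x in K.carrier, ‖φ.1 x‖ₑ ^ 2 := by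
    rw [_root_.H1.norm_sq_eq_lintegral]
    refine lintegral_congr_ae ?_
    filter_upwards [_root_.H1.fn_ofSmooth hb φ] with x hx
    have hx' : (_root_.H1.ofSmooth hb φ).1.1 x = φ.1 x := hx
    rw [hx']
  rw [← e2, ← _root_.H1.seminorm_ofSmooth_sq hb] at key
  generalize ‖(_root_.H1.ofSmooth hb φ).1.1‖ = N at *
  generalize _root_.H1.seminorm (_root_.H1.ofSmooth hb φ) = S at *
  generalize ‖K.restrictSide j φ‖ = T at *
  set h := Metric.diam K.carrier
  have key2 : ENNReal.ofReal (|cross c d| * T ^ 2) ≤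
      ENNReal.ofReal (K.len j * (3 * N ^ 2 + h ^ 2 * S ^ 2)) := by
    rw [ENNReal.ofReal_mul hcr0.le, e1, ENNReal.ofReal_mul hlen.le, mul_left_comm]
    gcongr
    refine key.trans (le_of_eq ?_)
    rw [ENNReal.ofReal_add (by positivity) (by positivity), ENNReal.ofReal_mul (by positivity),
      ENNReal.ofReal_mul (by positivity)]
    simp
  have key3 := (ENNReal.ofReal_le_ofReal_iff (by positivity)).1 key2
  have h3 : r * K.len j * T ^ 2 ≤ |cross c d| * T ^ 2 := by gcongr
  refine le_of_mul_le_mul_left ?_ hlen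
  nlinarith

/-- Restriction to the side is bounded on the dense subspace of smooth functions and extends by
continuity. This excludes the default value `0` in the definition of `trace`. -/
theorem exists_isTrace (hU : IsStarDomain K.carrier x₀ r) (j : K.Idx) : ∃ T, K.IsTrace j T := by
  have hr := hU.pos
  have hb := hU.isBounded
  have hd := _root_.H1.denseRange_ofSmooth hb hU.isOpen hr hU.star
  have hbound : ∃ C, ∀ φ : smoothFn, ‖K.restrictSide j φ‖ ≤ C * ‖_root_.H1.ofSmooth hb φ‖ := by
    refine ⟨Real.sqrt ((3 + Metric.diam K.carrier ^ 2) / r), fun φ => ?_⟩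
    have key := norm_restrictSide_sq_le hU j φ
    have h1 : ‖(_root_.H1.ofSmooth hb φ).1.1‖ ≤ ‖_root_.H1.ofSmooth hb φ‖ := le_max_left _ _
    have h2 : _root_.H1.seminorm (_root_.H1.ofSmooth hb φ) ≤ ‖_root_.H1.ofSmooth hb φ‖ :=
      le_max_right _ _
    have h0 : 0 ≤ _root_.H1.seminorm (_root_.H1.ofSmooth hb φ) := norm_nonneg _
    have h3 : r * ‖K.restrictSide j φ‖ ^ 2 ≤
        (3 + Metric.diam K.carrier ^ 2) * ‖_root_.H1.ofSmooth hb φ‖ ^ 2 := by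
      rw [add_mul]
      refine key.trans (add_le_add ?_ ?_) <;> gcongr
    rw [← Real.sqrt_sq (norm_nonneg (_root_.H1.ofSmooth hb φ)), ← Real.sqrt_mul (by positivity)]
    refine Real.le_sqrt_of_sq_le ?_
    rw [div_mul_eq_mul_div, le_div_iff₀ hr, mul_comm]
    exact h3
  refine ⟨(K.restrictSide j).extendOfNorm (_root_.H1.ofSmooth hb), fun u φ hφ hu => ?_⟩
  have hu' : u = _root_.H1.ofSmooth hb ⟨φ, hφ⟩ :=
    _root_.H1.ext_fn hU.isOpen (hu.trans (_root_.H1.fn_ofSmooth hb ⟨φ, hφ⟩).symm)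
  rw [hu', LinearMap.extendOfNorm_eq hd hbound]
  exact K.coeFn_restrictSide j _

theorem isTrace_trace (hU : IsStarDomain K.carrier x₀ r) (j : K.Idx) : K.IsTrace j (K.trace j) := by
  have h := exists_isTrace hU j
  rw [trace, dif_pos h]
  exact h.choose_spec

theorem trace_ofSmooth (hU : IsStarDomain K.carrier x₀ r) (j : K.Idx) (φ : smoothFn) :
    K.trace j (_root_.H1.ofSmooth hU.isBounded φ) = K.restrictSide j φ :=
  Lp.ext ((isTrace_trace hU j _ φ.1 φ.2 (_root_.H1.fn_ofSmooth _ φ)).trans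
    (K.coeFn_restrictSide j φ).symm)

theorem norm_trace_sq_le (hU : IsStarDomain K.carrier x₀ r) (j : K.Idx) (u : K.H1) :
    r * ‖K.trace j u‖ ^ 2 ≤ 3 * ‖u.1.1‖ ^ 2 +
      Metric.diam K.carrier ^ 2 * _root_.H1.seminorm u ^ 2 := by
  refine (_root_.H1.denseRange_ofSmooth hU.isBounded hU.isOpen hU.pos hU.star).induction_on
    (p := fun u : K.H1 => r * ‖K.trace j u‖ ^ 2 ≤ 3 * ‖u.1.1‖ ^ 2 +
      Metric.diam K.carrier ^ 2 * _root_.H1.seminorm u ^ 2) u ?_ fun φ => ?_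
  · exact isClosed_le (by fun_prop) (by unfold _root_.H1.seminorm; fun_prop)
  · rw [trace_ofSmooth hU]
    exact norm_restrictSide_sq_le hU j φ

/-- The constant in the trace inequality for functions with mean value zero. -/
noncomputable def traceConst (γ₀ γ₁ : ℝ) : ℝ := Real.sqrt ((12 / γ₀ ^ 3 + 1 / γ₀) / γ₁)

/-- For mean value zero, the Poincaré inequality replaces the `L²` norm by the seminorm. The factor
`√h_K` is turned into the root of the side length by `γ₁`, so that pairing with an edgewise constant
produces exactly the side length. -/
theorem norm_trace_le {γ₀ γ₁ : ℝ} (hγ₀ : 0 < γ₀) (hγ₁ : 0 < γ₁) (hK : K.ShapeRegular γ₀ γ₁)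
    (j : K.Idx) {u : K.H1} (hu : _root_.H1.mean u = 0) :
    ‖K.trace j u‖ ≤ Real.sqrt (K.len j) * (traceConst γ₀ γ₁ * _root_.H1.seminorm u) := by
  obtain ⟨x₀, hU⟩ := hK.isStarDomain hγ₀
  have hlen := hK.mul_diam_le_len j
  have hh := hU.diam_pos
  have h1 := norm_trace_sq_le hU j u
  have h2 := _root_.H1.poincare hU u
  rw [_root_.H1.deviation_apply, hu, zero_smul, sub_zero] at h2
  set S := _root_.H1.seminorm u
  have hS : 0 ≤ S := norm_nonneg _
  have hN0 : 0 ≤ ‖u.1.1‖ := norm_nonneg _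
  generalize ‖u.1.1‖ = N at *
  generalize ‖K.trace j u‖ = T at *
  set h := Metric.diam K.carrier
  set L := K.len j
  have hL : 0 < L := K.len_pos j
  have e : 2 * h ^ 2 / (γ₀ * h) * S = 2 * h / γ₀ * S := by field_simp
  rw [e] at h2
  have hN : N ^ 2 ≤ (2 * h / γ₀ * S) ^ 2 := by gcongr
  -- The Poincaré constant with `r = γ₀ h` is `2 h / γ₀`. Inserted in the trace inequality and
  -- divided by `γ₀ h`, it gives `3 · 4 / γ₀³`, and the gradient term gives `1 / γ₀`.
  have h3 : T ^ 2 ≤ h * ((12 / γ₀ ^ 3 + 1 / γ₀) * S ^ 2) := by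
    refine le_of_mul_le_mul_left (a := γ₀ * h) ?_ (by positivity)
    refine h1.trans ?_
    have : γ₀ * h * (h * ((12 / γ₀ ^ 3 + 1 / γ₀) * S ^ 2))
        = 3 * (2 * h / γ₀ * S) ^ 2 + h ^ 2 * S ^ 2 := by field_simp; ring
    rw [this]; linarith
  have h4 : h ≤ L / γ₁ := by rw [le_div_iff₀ hγ₁]; linarith
  have hA : 0 ≤ (12 / γ₀ ^ 3 + 1 / γ₀) / γ₁ := by positivity
  have h5 : T ^ 2 ≤ (Real.sqrt L * (traceConst γ₀ γ₁ * S)) ^ 2 := by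
    rw [mul_pow, mul_pow, traceConst, Real.sq_sqrt hL.le, Real.sq_sqrt hA]
    calc T ^ 2 ≤ h * ((12 / γ₀ ^ 3 + 1 / γ₀) * S ^ 2) := h3
      _ ≤ L / γ₁ * ((12 / γ₀ ^ 3 + 1 / γ₀) * S ^ 2) := by gcongr
      _ = _ := by ring
  exact (abs_le_of_sq_le_sq' h5 (by unfold traceConst; positivity)).2

end MeshPolygon

/-! ### The dual norm and the dual seminorm. -/

namespace H1

variable {U : Set Plane} {x₀ : Plane} {r : ℝ}

theorem seminorm_nonneg (u : H1 U) : 0 ≤ seminorm u := norm_nonneg _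

theorem meanNorm_nonneg (u : H1 U) : 0 ≤ meanNorm u := Real.sqrt_nonneg _

theorem meanNorm_sq (u : H1 U) : meanNorm u ^ 2 = mean u ^ 2 + seminorm u ^ 2 :=
  Real.sq_sqrt (by positivity)

theorem seminorm_neg (u : H1 U) : seminorm (-u) = seminorm u := by
  rw [seminorm, map_neg, norm_neg]; rfl

theorem seminorm_sub_smul_one (hU : Bornology.IsBounded U) (u : H1 U) (c : ℝ) :
    seminorm (u - c • one hU) = seminorm u := by
  rw [seminorm, map_sub, map_smul, grad_one, smul_zero, sub_zero]; rfl

theorem mean_neg (u : H1 U) : mean (-u) = -mean u := by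
  have : fn (-u) =ᵐ[volume.restrict U] fun x => -fn u x := Lp.coeFn_neg u.1.1
  rw [mean, average_congr this, average_neg]; rfl

theorem mean_sub_mean_smul_one (hU : IsStarDomain U x₀ r) (u : H1 U) :
    mean (u - mean u • one hU.isBounded) = 0 := by
  rw [mean_sub hU.isBounded, mean_smul hU.isBounded,
    mean_one hU.isBounded hU.volume_ne_zero hU.volume_ne_top, mul_one, sub_self]

theorem meanNorm_one (hU : IsStarDomain U x₀ r) : meanNorm (one hU.isBounded) = 1 := by
  rw [meanNorm, mean_one hU.isBounded hU.volume_ne_zero hU.volume_ne_top, seminorm, grad_one]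
  simp

/-- Shows that the quotients defining the dual norms are bounded above; the supremum of an unbounded
set of reals would be `0` and carry no information. -/
theorem exists_apply_le (hU : IsStarDomain U x₀ r) (F : Dual U) :
    ∃ C, 0 ≤ C ∧ ∀ g, F g ≤ C * meanNorm g := by
  obtain ⟨C, hC, h⟩ := exists_norm_le_meanNorm hU
  refine ⟨‖F‖ * C, by positivity, fun g => ?_⟩
  calc F g ≤ ‖F‖ * ‖g‖ := (le_abs_self _).trans (F.le_opNorm g)
    _ ≤ ‖F‖ * (C * meanNorm g) := by gcongr; exact h g
    _ = _ := by ring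

theorem eq_zero_of_meanNorm (hU : IsStarDomain U x₀ r) {g : H1 U} (h : meanNorm g = 0) : g = 0 := by
  have := meanNorm_sq g
  rw [h] at this
  exact eq_zero_of_mean_of_seminorm hU (by nlinarith [sq_nonneg (seminorm g), sq_nonneg (mean g)])
    (by nlinarith [sq_nonneg (seminorm g), sq_nonneg (mean g)])

theorem apply_le_dualNorm (hU : IsStarDomain U x₀ r) (F : Dual U) (g : H1 U) :
    F g ≤ dualNorm F * meanNorm g := by
  rcases (meanNorm_nonneg g).eq_or_lt with h0 | h0
  · rw [eq_zero_of_meanNorm hU h0.symm, map_zero]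
    exact mul_nonneg (Real.iSup_nonneg' ⟨0, by simp⟩) (meanNorm_nonneg _)
  rw [← div_le_iff₀ h0]
  obtain ⟨C, hC, h⟩ := exists_apply_le hU F
  refine le_ciSup (f := fun g : H1 U => F g / meanNorm g) ⟨C, ?_⟩ g
  rintro _ ⟨v, rfl⟩
  exact div_le_of_le_mul₀ (meanNorm_nonneg v) hC (h v)

theorem meanNorm_eq_seminorm {g : H1 U} (hg : mean g = 0) : meanNorm g = seminorm g := by
  rw [meanNorm, hg]; simp [Real.sqrt_sq (seminorm_nonneg g)]

theorem dualSeminorm_nonneg (F : Dual U) : 0 ≤ dualSeminorm F :=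
  Real.iSup_nonneg' ⟨⟨0, by
    have : mean (-(0 : H1 U)) = -mean 0 := mean_neg 0
    rw [neg_zero] at this; linarith⟩, by simp⟩

theorem dualNorm_nonneg (F : Dual U) : 0 ≤ dualNorm F := Real.iSup_nonneg' ⟨0, by simp⟩

theorem apply_le_dualSeminorm (hU : IsStarDomain U x₀ r) (F : Dual U) {g : H1 U}
    (hg : mean g = 0) : F g ≤ dualSeminorm F * seminorm g := by
  rcases (seminorm_nonneg g).eq_or_lt with h0 | h0
  · rw [eq_zero_of_mean_of_seminorm hU hg h0.symm, map_zero]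
    exact mul_nonneg (dualSeminorm_nonneg F) (seminorm_nonneg _)
  rw [← div_le_iff₀ h0]
  obtain ⟨C, hC, h⟩ := exists_apply_le hU F
  refine le_ciSup (f := fun g : {g : H1 U // mean g = 0} => F g.1 / seminorm g.1) ⟨C, ?_⟩ ⟨g, hg⟩
  rintro _ ⟨v, rfl⟩
  refine div_le_of_le_mul₀ (seminorm_nonneg _) hC ?_
  rw [← meanNorm_eq_seminorm v.2]; exact h v.1

theorem abs_apply_le_dualSeminorm (hU : IsStarDomain U x₀ r) (F : Dual U) {g : H1 U}
    (hg : mean g = 0) : |F g| ≤ dualSeminorm F * seminorm g := by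
  refine abs_le'.2 ⟨apply_le_dualSeminorm hU F hg, ?_⟩
  have := apply_le_dualSeminorm hU F (g := -g) (by rw [mean_neg, hg, neg_zero])
  rwa [map_neg, seminorm_neg] at this

theorem dualSeminorm_le {F : Dual U} {B : ℝ} (hB : 0 ≤ B)
    (h : ∀ g, mean g = 0 → F g ≤ B * seminorm g) : dualSeminorm F ≤ B :=
  Real.iSup_le (fun g => div_le_of_le_mul₀ (seminorm_nonneg _) hB (h g.1 g.2)) hB

theorem dualNorm_le {F : Dual U} {B : ℝ} (hB : 0 ≤ B) (h : ∀ g, F g ≤ B * meanNorm g) :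
    dualNorm F ≤ B :=
  Real.iSup_le (fun g => div_le_of_le_mul₀ (meanNorm_nonneg _) hB (h g)) hB

theorem abs_apply_one_le (hU : IsStarDomain U x₀ r) (F : Dual U) :
    |F (one hU.isBounded)| ≤ dualNorm F := by
  have h1 := apply_le_dualNorm hU F (one hU.isBounded)
  have h2 := apply_le_dualNorm hU F (-one hU.isBounded)
  have e : meanNorm (-one hU.isBounded) = meanNorm (one hU.isBounded) := by
    rw [meanNorm, meanNorm, mean_neg, seminorm_neg, neg_sq]
  rw [e, map_neg] at h2
  rw [meanNorm_one hU, mul_one] at h1 h2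
  exact abs_le'.2 ⟨h1, h2⟩

theorem mul_add_mul_le_sqrt_mul_sqrt (a b c d : ℝ) :
    a * b + c * d ≤ Real.sqrt (b ^ 2 + c ^ 2) * Real.sqrt (a ^ 2 + d ^ 2) := by
  rw [← Real.sqrt_mul (by positivity)]
  refine Real.le_sqrt_of_sq_le ?_
  nlinarith [sq_nonneg (a * c - b * d)]

/-- Split `g` into its mean and a part with mean zero, then apply Cauchy–Schwarz. The stabilization
controls only the dual seminorm, so the value on constants has to come from the choice of test
function. -/
theorem dualNorm_sq_le (hU : IsStarDomain U x₀ r) (F : Dual U) :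
    dualNorm F ^ 2 ≤ F (one hU.isBounded) ^ 2 + dualSeminorm F ^ 2 := by
  have h : dualNorm F ≤ Real.sqrt (F (one hU.isBounded) ^ 2 + dualSeminorm F ^ 2) := by
    refine dualNorm_le (Real.sqrt_nonneg _) fun g => ?_
    have e : F g = mean g * F (one hU.isBounded) + F (g - mean g • one hU.isBounded) := by
      rw [map_sub, map_smul, smul_eq_mul]; ring
    have h1 := apply_le_dualSeminorm hU F (mean_sub_mean_smul_one hU g)
    rw [seminorm_sub_smul_one] at h1
    rw [e, meanNorm]
    exact (add_le_add le_rfl h1).trans (mul_add_mul_le_sqrt_mul_sqrt _ _ _ _)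
  calc dualNorm F ^ 2 ≤ Real.sqrt (F (one hU.isBounded) ^ 2 + dualSeminorm F ^ 2) ^ 2 := by
        have := dualNorm_nonneg F
        gcongr
    _ = _ := Real.sq_sqrt (by positivity)

theorem dualNorm_add_smul_le (hU : IsStarDomain U x₀ r) (F G : Dual U) {c : ℝ} (hc : 0 ≤ c) :
    dualNorm (F + c • G) ≤ dualNorm F + c * dualNorm G := by
  have hF := dualNorm_nonneg F
  have hG := dualNorm_nonneg G
  refine dualNorm_le (by positivity) fun g => ?_
  have h1 := apply_le_dualNorm hU F g
  have h2 := mul_le_mul_of_nonneg_left (apply_le_dualNorm hU G g) hc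
  rw [add_apply, smul_apply, smul_eq_mul]
  linarith

theorem eq_zero_of_dualNorm (hU : IsStarDomain U x₀ r) {F : Dual U} (h : dualNorm F = 0) :
    F = 0 := by
  ext g
  have h1 := apply_le_dualNorm hU F g
  have h2 := apply_le_dualNorm hU F (-g)
  rw [h, zero_mul] at h1 h2
  rw [map_neg] at h2
  change F g = 0
  linarith

theorem dualSeminorm_neg (F : Dual U) : dualSeminorm (-F) = dualSeminorm F := by
  have e : Function.Surjective fun g : {g : H1 U // mean g = 0} =>
      (⟨-g.1, by rw [mean_neg, g.2, neg_zero]⟩ : {g : H1 U // mean g = 0}) := fun g =>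
    ⟨⟨-g.1, by rw [mean_neg, g.2, neg_zero]⟩, by simp⟩
  rw [dualSeminorm, dualSeminorm, ← e.iSup_comp]
  congr 1; ext g
  simp [seminorm_neg]

theorem dualSeminorm_D_le (u : H1 U) : dualSeminorm (D u) ≤ seminorm u :=
  dualSeminorm_le (seminorm_nonneg u) fun g _ => by
    have : D u g = ⟪grad u, grad g⟫ := rfl
    rw [this]; exact real_inner_le_norm (grad u) (grad g)

/-- A bilinear form with `s(F, G) ≤ M |F| |G|` satisfies `|s(F, G)| ≤ M |F| |G|`. -/
theorem abs_form_le {s : Dual U →ₗ[ℝ] Dual U →ₗ[ℝ] ℝ} {M : ℝ}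
    (hs : ∀ F G, s F G ≤ M * dualSeminorm F * dualSeminorm G) (F G : Dual U) :
    |s F G| ≤ M * dualSeminorm F * dualSeminorm G := by
  refine abs_le'.2 ⟨hs F G, ?_⟩
  have := hs F (-G)
  rwa [(s F).map_neg G, dualSeminorm_neg] at this

end H1

/-! ### Edges, normals and jumps. -/

section Mesh

variable {ι : Type*} [Fintype ι] {K : ι → MeshPolygon} {Ω : Set Plane} {n : Set Plane → Plane}

open Classical in
/-- The pairs of an element and one of its sides for which this side is `e`. -/
noncomputable def sidesAt (K : ι → MeshPolygon) (e : Set Plane) : Finset (Σ i, (K i).Idx) :=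
  Finset.univ.filter fun p => (K p.1).side p.2 = e

theorem mem_sidesAt {e : Set Plane} {p : Σ i, (K i).Idx} :
    p ∈ sidesAt K e ↔ (K p.1).side p.2 = e := by simp [sidesAt]

theorem jump_eq_sum (w : ∀ i, (K i).Idx → ℝ) (e : Set Plane) :
    jump K w e = ∑ p ∈ sidesAt K e, w p.1 p.2 • (K p.1).normal p.2 := by
  classical
  rw [jump, sidesAt, Finset.sum_filter, Fintype.sum_sigma]

theorem sum_edges_sum_sidesAt (f : (Σ i, (K i).Idx) → ℝ) :
    ∑ e ∈ edges K, ∑ p ∈ sidesAt K e, f p = ∑ i, ∑ j, f ⟨i, j⟩ := by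
  classical
  rw [← Fintype.sum_sigma (f := f)]
  unfold sidesAt
  exact Finset.sum_fiberwise_of_maps_to (fun p _ => side_mem_edges K p.1 p.2) f

theorem exists_side_eq {e : Set Plane} (he : e ∈ edges K) :
    ∃ i, ∃ j : (K i).Idx, (K i).side j = e := by
  classical
  obtain ⟨p, -, hp⟩ := Finset.mem_image.1 he
  exact ⟨p.1, p.2, hp⟩

namespace IsSkeletonNormal

theorem norm_eq_one (hn : IsSkeletonNormal Ω K n) {e : Set Plane} (he : e ∈ edges K) :
    ‖n e‖ = 1 := by
  obtain ⟨i, j, rfl⟩ := exists_side_eq he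
  rcases hn.normal i j with h | h <;> simp [h, MeshPolygon.norm_normal]

theorem inner_eq {ι : Type*} {K : ι → MeshPolygon} (hn : IsSkeletonNormal Ω K n) (i : ι) (j : (K i).Idx) :
    ⟪(K i).normal j, n ((K i).side j)⟫ = 1 ∨ ⟪(K i).normal j, n ((K i).side j)⟫ = -1 := by
  rcases hn.normal i j with h | h <;> rw [h]
  · left; exact (K i).inner_normal_self j
  · right; rw [inner_neg_right, (K i).inner_normal_self j]

theorem abs_inner_eq {ι : Type*} {K : ι → MeshPolygon} (hn : IsSkeletonNormal Ω K n) (i : ι) (j : (K i).Idx) :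
    |⟪(K i).normal j, n ((K i).side j)⟫| = 1 := by
  rcases hn.inner_eq i j with h | h <;> simp [h]

/-- All element normals on an edge are `± n`, so the jump has no tangential component and is
determined by its normal component. -/
theorem jump_eq_inner_smul (hn : IsSkeletonNormal Ω K n) (w : ∀ i, (K i).Idx → ℝ) (e : Set Plane) :
    jump K w e = ⟪jump K w e, n e⟫ • n e := by
  rw [jump_eq_sum, sum_inner, Finset.sum_smul]
  refine Finset.sum_congr rfl fun p hp => ?_
  rw [real_inner_smul_left, mul_smul]
  congr 1
  rw [mem_sidesAt] at hp
  subst hp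
  rcases hn.normal p.1 p.2 with h | h <;>
    simp [h, (K p.1).norm_normal]

theorem inner_jump_sq (hn : IsSkeletonNormal Ω K n) (w : ∀ i, (K i).Idx → ℝ) {e : Set Plane}
    (he : e ∈ edges K) : |⟪jump K w e, n e⟫| = ‖jump K w e‖ := by
  conv_rhs => rw [hn.jump_eq_inner_smul w e, norm_smul, hn.norm_eq_one he, mul_one, Real.norm_eq_abs]

theorem sum_mul_inner_jump (w : ∀ i, (K i).Idx → ℝ) (b : Set Plane → ℝ) :
    ∑ e ∈ edges K, b e * ⟪jump K w e, n e⟫ =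
      ∑ i, ∑ j, w i j * (⟪(K i).normal j, n ((K i).side j)⟫ * b ((K i).side j)) := by
  rw [← sum_edges_sum_sidesAt (fun p : Σ i, (K i).Idx =>
    w p.1 p.2 * (⟪(K p.1).normal p.2, n ((K p.1).side p.2)⟫ * b ((K p.1).side p.2)))]
  refine Finset.sum_congr rfl fun e _ => ?_
  rw [jump_eq_sum, sum_inner, Finset.mul_sum]
  refine Finset.sum_congr rfl fun p hp => ?_
  rw [mem_sidesAt] at hp
  subst hp
  rw [real_inner_smul_left]; ring

end IsSkeletonNormal

theorem MeshPolygon.midpoint_mem_openSegment (P : MeshPolygon) (j : P.Idx) :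
    midpoint ℝ (P.vertex j) (P.vertex (j + 1)) ∈
      openSegment ℝ (P.vertex j) (P.vertex (j + 1)) :=
  ⟨1 / 2, 1 / 2, by norm_num, by norm_num, by norm_num, by
    rw [midpoint_eq_smul_add, smul_add]; norm_num⟩

/-- Equal sides are only equal as sets; their end points may be listed in either order. The open
segment is recovered from the closed one as the set of midpoints of two distinct points of it. -/
theorem side_eq_image_openSegment {P Q : MeshPolygon} {i : P.Idx} {j : Q.Idx}
    (h : P.side i = Q.side j) {p : Plane}
    (hp : p ∈ openSegment ℝ (P.vertex i) (P.vertex (i + 1))) :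
    p ∈ openSegment ℝ (Q.vertex j) (Q.vertex (j + 1)) := by
  have hs : segment ℝ (P.vertex i) (P.vertex (i + 1)) = segment ℝ (Q.vertex j) (Q.vertex (j + 1)) := h
  have e : ∀ {a b : Plane}, a ≠ b → ∀ x, x ∈ openSegment ℝ a b ↔
      x ∈ segment ℝ a b ∧ ∃ y ∈ segment ℝ a b, ∃ z ∈ segment ℝ a b, y ≠ z ∧ x = midpoint ℝ y z := by
    intro a b hab x
    constructor
    · intro hx
      refine ⟨openSegment_subset_segment ℝ _ _ hx, ?_⟩
      rw [openSegment_eq_image'] at hx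
      obtain ⟨t, ⟨h0, h1⟩, rfl⟩ := hx
      set ε := min t (1 - t)
      have hε : 0 < ε := lt_min h0 (by linarith)
      have hεt : ε ≤ t := min_le_left _ _
      have hεt' : ε ≤ 1 - t := min_le_right _ _
      refine ⟨a + (t - ε) • (b - a), ?_, a + (t + ε) • (b - a), ?_, ?_, ?_⟩
      · rw [segment_eq_image']; exact ⟨t - ε, ⟨by linarith, by linarith⟩, rfl⟩
      · rw [segment_eq_image']; exact ⟨t + ε, ⟨by linarith, by linarith⟩, rfl⟩
      · intro h
        have h2 : (2 * ε) • (b - a) = 0 := by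
          have := sub_eq_zero.2 h.symm
          rw [← this]; module
        rcases smul_eq_zero.1 h2 with h3 | h3
        · linarith
        · exact hab (sub_eq_zero.1 h3).symm
      · rw [midpoint_eq_smul_add]
        simp only [invOf_eq_inv]; module
    · rintro ⟨-, y, hy, z, hz, hyz, rfl⟩
      rw [segment_eq_image'] at hy hz
      obtain ⟨s, hs, rfl⟩ := hy
      obtain ⟨t, ht, rfl⟩ := hz
      rw [openSegment_eq_image']
      have hst : s ≠ t := fun h => hyz (by rw [h])
      refine ⟨(s + t) / 2, ⟨?_, ?_⟩, ?_⟩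
      · rcases lt_or_gt_of_ne hst with h | h <;> linarith [hs.1, ht.1]
      · rcases lt_or_gt_of_ne hst with h | h <;> linarith [hs.2, ht.2]
      · rw [midpoint_eq_smul_add]
        simp only [invOf_eq_inv]; module
  rw [e (P.vertex_ne i), hs, ← e (Q.vertex_ne j)] at hp
  exact hp

/-- Two elements with a common side lie on different sides of it. -/
theorem IsMesh.normal_eq_neg {ι : Type*} {K : ι → MeshPolygon} (hM : IsMesh Ω K) (hn : IsSkeletonNormal Ω K n)
    {p q : Σ i, (K i).Idx} (hpq : p ≠ q) (h : (K p.1).side p.2 = (K q.1).side q.2) :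
    (K q.1).normal q.2 = -(K p.1).normal p.2 := by
  have hor : (K q.1).normal q.2 = (K p.1).normal p.2 ∨ (K q.1).normal q.2 = -(K p.1).normal p.2 := by
    have h1 := hn.normal p.1 p.2
    have h2 := hn.normal q.1 q.2
    rw [← h] at h2
    rcases h1 with h1 | h1 <;> rcases h2 with h2 | h2
    · left; rw [← h1, h2]
    · right; rw [← h1, h2, neg_neg]
    · right; rw [← h2, h1]
    · left; exact neg_injective (by rw [← h1, h2])
  -- With equal normals, both elements would contain a half-disc on the same side of the edge,
  -- although they are disjoint.
  refine hor.resolve_left fun hnorm => ?_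
  have h1 : p.1 ≠ q.1 := by
    intro h1
    obtain ⟨i, j⟩ := p
    obtain ⟨i', j'⟩ := q
    obtain rfl : i = i' := h1
    exact hpq (congrArg _ ((K i).side_injective h))
  have hm := (K p.1).midpoint_mem_openSegment p.2
  set m := midpoint ℝ ((K p.1).vertex p.2) ((K p.1).vertex (p.2 + 1))
  obtain ⟨δ, hδ, hb⟩ := (K p.1).exists_half_ball_subset hm
  obtain ⟨δ', hδ', hb'⟩ := (K q.1).exists_half_ball_subset (side_eq_image_openSegment h hm)
  rw [hnorm] at hb'
  set ν := (K p.1).normal p.2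
  set ε := min δ δ' / 2
  have hε : 0 < ε := by positivity
  have hεδ : ε < δ := by have := min_le_left δ δ'; simp only [ε]; linarith
  have hεδ' : ε < δ' := by have := min_le_right δ δ'; simp only [ε]; linarith
  have hd : dist (m - ε • ν) m = ε := by
    rw [dist_eq_norm, sub_sub_cancel_left, norm_neg, norm_smul, (K p.1).norm_normal, mul_one,
      Real.norm_of_nonneg hε.le]
  have hi : ⟪m - ε • ν - m, ν⟫ < 0 := by
    rw [sub_sub_cancel_left, inner_neg_left, real_inner_smul_left, (K p.1).inner_normal_self]
    linarith
  exact Set.disjoint_left.1 (hM.disjoint p.1 q.1 h1)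
    (hb (m - ε • ν) (by rw [Metric.mem_ball, hd]; exact hεδ) hi)
    (hb' (m - ε • ν) (by rw [Metric.mem_ball, hd]; exact hεδ') hi)

/-- Three elements at one edge would have pairwise opposite normals. -/
theorem IsMesh.card_sidesAt_le (hM : IsMesh Ω K) (hn : IsSkeletonNormal Ω K n) (e : Set Plane) :
    (sidesAt K e).card ≤ 2 := by
  by_contra! h
  obtain ⟨p, hp, q, hq, s, hs, hpq, hps, hqs⟩ := Finset.two_lt_card.1 h
  rw [mem_sidesAt] at hp hq hs
  have h1 := hM.normal_eq_neg hn hpq (hp.trans hq.symm)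
  have h2 := hM.normal_eq_neg hn hps (hp.trans hs.symm)
  have h3 := hM.normal_eq_neg hn hqs (hq.trans hs.symm)
  rw [h1, h2, neg_neg, neg_eq_iff_add_eq_zero, ← two_smul ℝ, smul_eq_zero] at h3
  have := (K p.1).norm_normal p.2
  rcases h3 with h3 | h3
  · norm_num at h3
  · rw [h3] at this; simp at this

theorem IsMesh.norm_jump_sq_le (hM : IsMesh Ω K) (hn : IsSkeletonNormal Ω K n)
    (w : ∀ i, (K i).Idx → ℝ) (e : Set Plane) :
    ‖jump K w e‖ ^ 2 ≤ 2 * ∑ p ∈ sidesAt K e, w p.1 p.2 ^ 2 := by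
  have h1 : ‖jump K w e‖ ≤ ∑ p ∈ sidesAt K e, |w p.1 p.2| := by
    rw [jump_eq_sum]
    refine (norm_sum_le _ _).trans (Finset.sum_le_sum fun p _ => ?_)
    rw [norm_smul, (K p.1).norm_normal, mul_one, Real.norm_eq_abs]
  calc ‖jump K w e‖ ^ 2 ≤ (∑ p ∈ sidesAt K e, |w p.1 p.2|) ^ 2 := by gcongr
    _ ≤ (sidesAt K e).card * ∑ p ∈ sidesAt K e, |w p.1 p.2| ^ 2 := sq_sum_le_card_mul_sum_sq
    _ ≤ 2 * ∑ p ∈ sidesAt K e, w p.1 p.2 ^ 2 := by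
      simp only [sq_abs]
      gcongr
      exact_mod_cast hM.card_sidesAt_le hn e

theorem IsMesh.sum_norm_jump_sq_le (hM : IsMesh Ω K) (hn : IsSkeletonNormal Ω K n)
    (w : ∀ i, (K i).Idx → ℝ) :
    ∑ e ∈ edges K, ‖jump K w e‖ ^ 2 ≤ 2 * ∑ i, ∑ j, w i j ^ 2 := by
  rw [← sum_edges_sum_sidesAt (fun p : Σ i, (K i).Idx => w p.1 p.2 ^ 2), Finset.mul_sum]
  exact Finset.sum_le_sum fun e _ => hM.norm_jump_sq_le hn w e

theorem IsMesh.sum_sides_le (hM : IsMesh Ω K) (hn : IsSkeletonNormal Ω K n) {b : Set Plane → ℝ}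
    (hb : ∀ e, 0 ≤ b e) : ∑ i, ∑ j, b ((K i).side j) ≤ 2 * ∑ e ∈ edges K, b e := by
  rw [← sum_edges_sum_sidesAt (fun p : Σ i, (K i).Idx => b ((K p.1).side p.2)), Finset.mul_sum]
  refine Finset.sum_le_sum fun e _ => ?_
  calc ∑ p ∈ sidesAt K e, b ((K p.1).side p.2) = ∑ p ∈ sidesAt K e, b e :=
        Finset.sum_congr rfl fun p hp => by rw [mem_sidesAt.1 hp]
    _ = (sidesAt K e).card * b e := by rw [Finset.sum_const, nsmul_eq_mul]
    _ ≤ 2 * b e := by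
      gcongr
      · exact hb e
      · exact_mod_cast hM.card_sidesAt_le hn e

/-! ### The pairing of multipliers and jumps -/

theorem setIntegral_mul_trace (l : SkeletonL2 K) (v : BrokenH1 K) (e : {e // e ∈ edges K})
    {p : Σ i, (K i).Idx} (hp : (K p.1).side p.2 = e.1) :
    Integrable (fun x => l e x * (K p.1).trace p.2 (v p.1) x) (Measure.restrict μH[1] e.1) ∧
    ∫ x in e.1, l e x * (K p.1).trace p.2 (v p.1) x ∂μH[1] =
      ⟪l ⟨(K p.1).side p.2, side_mem_edges K p.1 p.2⟩, (K p.1).trace p.2 (v p.1)⟫ := by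
  obtain ⟨e, he⟩ := e
  obtain rfl : (K p.1).side p.2 = e := hp
  have h : (fun x => l ⟨(K p.1).side p.2, he⟩ x * (K p.1).trace p.2 (v p.1) x) =
      fun x => ⟪l ⟨(K p.1).side p.2, he⟩ x, (K p.1).trace p.2 (v p.1) x⟫ := by
    ext x; simp [mul_comm]
  constructor
  · rw [h]; exact L2.integrable_inner _ _
  · rw [h, L2.inner_def]

/-- Regrouping the edge integrals by elements turns both coupling terms of the form into sums of
`γ_K^*` functionals, which makes them comparable with the stabilization. -/
theorem jumpPairing_eq_sum (n : Set Plane → Plane) (l : SkeletonL2 K) (v : BrokenH1 K) :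
    jumpPairing K n l v = ∑ i, adjTrace K n l i (v i) := by
  have h1 : ∀ e : {e // e ∈ edges K},
      ∫ x in e.1, l e x * ⟪jump K (fun i j => (K i).trace j (v i) x) e.1, n e.1⟫ ∂μH[1] =
      ∑ p ∈ sidesAt K e.1, ⟪(K p.1).normal p.2, n ((K p.1).side p.2)⟫ *
        ⟪l ⟨(K p.1).side p.2, side_mem_edges K p.1 p.2⟩, (K p.1).trace p.2 (v p.1)⟫ := by
    intro e
    have h2 : ∀ x, l e x * ⟪jump K (fun i j => (K i).trace j (v i) x) e.1, n e.1⟫ =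
        ∑ p ∈ sidesAt K e.1, ⟪(K p.1).normal p.2, n e.1⟫ *
          (l e x * (K p.1).trace p.2 (v p.1) x) := by
      intro x
      rw [jump_eq_sum, sum_inner, Finset.mul_sum]
      refine Finset.sum_congr rfl fun p _ => ?_
      rw [real_inner_smul_left]; ring
    simp only [h2]
    rw [integral_finsetSum _ fun p hp =>
      (setIntegral_mul_trace l v e (mem_sidesAt.1 hp)).1.const_mul _]
    refine Finset.sum_congr rfl fun p hp => ?_
    rw [integral_const_mul, (setIntegral_mul_trace l v e (mem_sidesAt.1 hp)).2,
      ← show n ((K p.1).side p.2) = n e.1 from congrArg n (mem_sidesAt.1 hp)]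
  rw [jumpPairing, Finset.sum_congr rfl fun e _ => h1 e,
    Finset.sum_coe_sort (edges K) (fun e => ∑ p ∈ sidesAt K e,
      ⟪(K p.1).normal p.2, n ((K p.1).side p.2)⟫ *
        ⟪l ⟨(K p.1).side p.2, side_mem_edges K p.1 p.2⟩, (K p.1).trace p.2 (v p.1)⟫),
    sum_edges_sum_sidesAt]
  refine Finset.sum_congr rfl fun i _ => ?_
  rw [adjTrace, sum_apply]
  rfl

end Mesh

/-! ### Piecewise constants with vanishing jumps. -/

section Mesh

variable {ι : Type*} [Fintype ι] {K : ι → MeshPolygon} {Ω : Set Plane} {n : Set Plane → Plane}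

/-- With only one element at the edge, the jump would be `c i` times a unit vector and nonzero.
Hence a second element exists; its normal is opposite, so zero jump means equal values. -/
theorem IsMesh.exists_neighbour (hM : IsMesh Ω K) (hn : IsSkeletonNormal Ω K n) {c : ι → ℝ}
    (hc : ∀ e ∈ edges K, jump K (fun i _ => c i) e = 0) {i : ι} (hi : c i ≠ 0) (j : (K i).Idx) :
    ∃ i', ∃ j' : (K i').Idx, c i' = c i ∧ (K i').side j' = (K i).side j ∧
      (K i').normal j' = -(K i).normal j := by
  classical
  have h := hc _ (side_mem_edges K i j)
  rw [jump_eq_sum] at h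
  have hp : (⟨i, j⟩ : Σ i, (K i).Idx) ∈ sidesAt K ((K i).side j) := mem_sidesAt.2 rfl
  have hν : (K i).normal j ≠ 0 := fun h0 => by
    have := (K i).norm_normal j
    rw [h0] at this; simp at this
  by_cases hex : ∃ q ∈ sidesAt K ((K i).side j), q ≠ ⟨i, j⟩
  · obtain ⟨q, hq, hqp⟩ := hex
    have hnq := hM.normal_eq_neg hn hqp.symm (mem_sidesAt.1 hq).symm
    have hS : sidesAt K ((K i).side j) = {⟨i, j⟩, q} := by
      refine (Finset.eq_of_subset_of_card_le ?_ ?_).symm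
      · intro x hx
        rcases Finset.mem_insert.1 hx with rfl | hx
        · exact hp
        · rwa [Finset.mem_singleton.1 hx]
      · rw [Finset.card_pair hqp.symm]; exact hM.card_sidesAt_le hn _
    rw [hS, Finset.sum_pair hqp.symm, hnq, smul_neg, ← sub_eq_add_neg, ← sub_smul,
      smul_eq_zero] at h
    exact ⟨q.1, q.2, (sub_eq_zero.1 (h.resolve_right hν)).symm, mem_sidesAt.1 hq, hnq⟩
  · push Not at hex
    rw [Finset.sum_eq_single_of_mem _ hp fun q hq hqp => absurd (hex q hq) hqp, smul_eq_zero] at h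
    exact absurd h (not_or.2 ⟨hi, hν⟩)

/-- On a horizontal line that avoids all vertices, the rightmost point of the union of the elements
with a given value lies on a side that is shared by two of them. -/
theorem IsMesh.eq_zero_of_jump_eq_zero (hM : IsMesh Ω K) (hn : IsSkeletonNormal Ω K n) {c : ι → ℝ}
    (hc : ∀ e ∈ edges K, jump K (fun i _ => c i) e = 0) (i₀ : ι) : c i₀ = 0 := by
  by_contra hne
  set e₁ : Plane := EuclideanSpace.single 0 1
  set e₂ : Plane := EuclideanSpace.single 1 1
  have he₁0 : ∀ (p : Plane) (ε : ℝ), (p + ε • e₁) 0 = p 0 + ε := fun p ε => by simp [e₁]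
  have he₁1 : ∀ (p : Plane) (ε : ℝ), (p + ε • e₁) 1 = p 1 := fun p ε => by simp [e₁]
  -- These are the ordinates of all vertices, a countable set. A line at any other height meets
  -- sides only in their interior points.
  set V : Set ℝ := range fun p : Σ i, (K i).Idx => (K p.1).vertex p.2 1
  have hV : V.Countable := countable_range _
  obtain ⟨x₀, hx₀⟩ := (K i₀).isConnected.nonempty
  obtain ⟨t, htV, htK⟩ : ∃ t ∈ Vᶜ, x₀ + (t - x₀ 1) • e₂ ∈ (K i₀).carrier := by
    have hopen : IsOpen {t : ℝ | x₀ + (t - x₀ 1) • e₂ ∈ (K i₀).carrier} :=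
      (K i₀).isOpen.preimage (by fun_prop : Continuous fun t : ℝ => x₀ + (t - x₀ 1) • e₂)
    obtain ⟨t, h1, h2⟩ := (hV.dense_compl ℝ).exists_mem_open hopen ⟨x₀ 1, by simpa using hx₀⟩
    exact ⟨t, h1, h2⟩
  set W : Set Plane := ⋃ i ∈ {i | c i = c i₀}, closure (K i).carrier
  have hWc : IsCompact W := (Set.toFinite _).isCompact_biUnion fun i _ =>
    (K i).isBounded.isCompact_closure
  have hline : IsClosed {x : Plane | x 1 = t} :=
    isClosed_eq (by fun_prop) continuous_const
  obtain ⟨p, ⟨hpW, hpt⟩, hmax⟩ := (hWc.inter_right hline).exists_isMaxOn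
    ⟨x₀ + (t - x₀ 1) • e₂, mem_biUnion (rfl : c i₀ = c i₀) (subset_closure htK), by
      simp [e₂]⟩ (f := fun x : Plane => x 0) (by fun_prop)
  have hpt' : p 1 = t := hpt
  have hright : ∀ i, c i = c i₀ → ∀ ε : ℝ, 0 < ε → p + ε • e₁ ∉ (K i).carrier := by
    intro i hi ε hε hmem
    have h1 : p + ε • e₁ ∈ W ∩ {x : Plane | x 1 = t} :=
      ⟨mem_biUnion (show i ∈ {i | c i = c i₀} from hi) (subset_closure hmem),
        show (p + ε • e₁) 1 = t by rw [he₁1, hpt']⟩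
    have h2 : (p + ε • e₁) 0 ≤ p 0 := hmax h1
    rw [he₁0] at h2; linarith
  have htend : Tendsto (fun ε : ℝ => p + ε • e₁) (𝓝[>] 0) (𝓝 p) := by
    have : Continuous fun ε : ℝ => p + ε • e₁ := by fun_prop
    have h := this.tendsto 0
    simp only [zero_smul, add_zero] at h
    exact h.mono_left nhdsWithin_le_nhds
  obtain ⟨i, hi, hpi⟩ := mem_iUnion₂.1 hpW
  have hi' : c i = c i₀ := hi
  have hpK : p ∉ (K i).carrier := fun hmem => by
    obtain ⟨ε, h1, h2⟩ := ((htend.eventually ((K i).isOpen.mem_nhds hmem)).and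
      self_mem_nhdsWithin).exists
    exact hright i hi' ε h2 h1
  have hpf : p ∈ frontier (K i).carrier := by rw [(K i).isOpen.frontier_eq]; exact ⟨hpi, hpK⟩
  rw [(K i).frontier_eq, mem_iUnion] at hpf
  obtain ⟨j, hj⟩ := hpf
  have hvert : ∀ j', (K i).vertex j' 1 ≠ t := fun j' h => htV ⟨⟨i, j'⟩, h⟩
  have hpo : p ∈ openSegment ℝ ((K i).vertex j) ((K i).vertex (j + 1)) :=
    mem_openSegment_of_ne_left_right (fun h => hvert j (by rw [h, hpt']))
      (fun h => hvert (j + 1) (by rw [h, hpt'])) hj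
  obtain ⟨i', j', hi'', hside, hnorm⟩ := hM.exists_neighbour hn hc (hi'.symm ▸ hne : c i ≠ 0) j
  obtain ⟨δ, hδ, hb⟩ := (K i).exists_half_ball_subset hpo
  obtain ⟨δ', hδ', hb'⟩ := (K i').exists_half_ball_subset (side_eq_image_openSegment hside.symm hpo)
  rw [hnorm] at hb'
  -- If the side were horizontal, its vertices would have the excluded height `t`.
  have hν : (K i).normal j 0 ≠ 0 := by
    intro h
    rw [MeshPolygon.normal, PiLp.smul_apply, smul_eq_mul, mul_eq_zero] at h
    have h1 : ((K i).vertex (j + 1) - (K i).vertex j) 1 = 0 :=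
      h.resolve_left (inv_ne_zero ((K i).len_pos j).ne')
    rw [segment_eq_image'] at hj
    obtain ⟨s, -, hs⟩ := hj
    refine hvert j ?_
    rw [← hpt', ← hs, PiLp.add_apply, PiLp.smul_apply, h1, smul_zero, add_zero]
  obtain ⟨ε, ⟨hε1, hε2⟩, hε⟩ := (((htend.eventually (Metric.ball_mem_nhds p hδ)).and
      (htend.eventually (Metric.ball_mem_nhds p hδ'))).and self_mem_nhdsWithin).exists
  have hε0 : 0 < ε := hε
  have hin : ⟪p + ε • e₁ - p, (K i).normal j⟫ = ε * (K i).normal j 0 := by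
    rw [add_sub_cancel_left, real_inner_smul_left, inner_plane]; simp [e₁]
  -- A small step to the right from `p` enters the element or its neighbour across the side,
  -- depending on the sign of the normal. Both carry the value `c i₀`, against the maximality of
  -- `p`.
  rcases lt_or_gt_of_ne hν with h | h
  · exact hright i hi' ε hε (hb _ hε1 (by rw [hin]; exact mul_neg_of_pos_of_neg hε0 h))
  · refine hright i' (hi''.trans hi') ε hε (hb' _ hε2 ?_)
    rw [inner_neg_right, hin]
    have := mul_pos hε0 h
    linarith

end Mesh

/-! ### Injectivity of `λ ↦ (γ_K^* λ)_K` on the discrete multipliers. -/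

theorem contDiff_polyFn (p : MvPolynomial (Fin 2) ℝ) : ContDiff ℝ ∞ (polyFn p) := by
  induction p using MvPolynomial.induction_on with
  | C a =>
    have : polyFn (MvPolynomial.C a) = fun _ => a := by ext x; simp [polyFn]
    rw [this]; exact contDiff_const
  | add p q hp hq =>
    have : polyFn (p + q) = fun x => polyFn p x + polyFn q x := by ext x; simp [polyFn]
    rw [this]; exact hp.add hq
  | mul_X p i hp =>
    have : polyFn (p * MvPolynomial.X i) = fun x => polyFn p x * x i := by ext x; simp [polyFn]
    rw [this]
    exact hp.mul (contDiff_euclidean.1 contDiff_id i)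

namespace MeshPolygon

variable {P : MeshPolygon} {j : P.Idx}

theorem eq_zero_on_side_of_ae {G : Plane → ℝ} (hG : Continuous G)
    (h : G =ᵐ[Measure.restrict μH[1] (P.side j)] 0) : ∀ x ∈ P.side j, G x = 0 := by
  have hlen := P.len_pos j
  rw [side, restrict_segment_eq_map (P.vertex_ne j)] at h
  have h0 : ENNReal.ofReal ‖P.vertex (j + 1) - P.vertex j‖ ≠ 0 := by
    simpa [len] using hlen
  have h1 := (Measure.ae_ennreal_smul_measure_iff h0).1 h
  have h2 := ae_of_ae_map (by fun_prop) h1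
  have h3 : EqOn (fun τ : ℝ => G (P.vertex j + τ • (P.vertex (j + 1) - P.vertex j))) (fun _ => 0)
      (Icc 0 1) :=
    Measure.eqOn_Icc_of_ae_eq volume zero_ne_one h2
      (hG.comp (by fun_prop)).continuousOn continuousOn_const
  intro x hx
  rw [side, segment_eq_image'] at hx
  obtain ⟨τ, hτ, rfl⟩ := hx
  exact h3 hτ

theorem eq_zero_on_side_of_integral {G : Plane → ℝ} (hG : Continuous G) (h0 : ∀ x, 0 ≤ G x)
    (h : ∫ x in P.side j, G x ∂μH[1] = 0) : ∀ x ∈ P.side j, G x = 0 := by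
  have := P.isFiniteMeasure_side j
  have hi : Integrable G (Measure.restrict μH[1] (P.side j)) := by
    obtain ⟨C, hC⟩ := (P.isCompact_side j).exists_bound_of_continuousOn hG.continuousOn
    exact Integrable.of_bound hG.aestronglyMeasurable C
      ((ae_restrict_iff' (P.isCompact_side j).isClosed.measurableSet).2 (Eventually.of_forall hC))
  exact eq_zero_on_side_of_ae hG ((integral_eq_zero_iff_of_nonneg h0 hi).1 h)

end MeshPolygon

section Mesh

variable {ι : Type*} [Fintype ι] {K : ι → MeshPolygon} {Ω : Set Plane} {n : Set Plane → Plane}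

theorem adjTrace_apply (l : SkeletonL2 K) (i : ι) (v : (K i).H1) :
    adjTrace K n l i v = ∑ j, ⟪(K i).normal j, n ((K i).side j)⟫ *
      ⟪l ⟨(K i).side j, side_mem_edges K i j⟩, (K i).trace j v⟫ := by
  rw [adjTrace, sum_apply]; rfl

theorem adjTrace_add_smul (l m : SkeletonL2 K) (c : ℝ) (i : ι) :
    adjTrace K n (l + c • m) i = adjTrace K n l i + c • adjTrace K n m i := by
  refine ContinuousLinearMap.ext fun v => ?_
  have h : ∀ j, ⟪(l + c • m) ⟨(K i).side j, side_mem_edges K i j⟩, (K i).trace j v⟫ =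
      ⟪l ⟨(K i).side j, side_mem_edges K i j⟩, (K i).trace j v⟫ +
        c * ⟪m ⟨(K i).side j, side_mem_edges K i j⟩, (K i).trace j v⟫ := fun j => by
    rw [← real_inner_smul_left, ← inner_add_left]; rfl
  have e : (adjTrace K n l i + c • adjTrace K n m i) v =
      adjTrace K n l i v + c * adjTrace K n m i v := rfl
  rw [e, adjTrace_apply, adjTrace_apply, adjTrace_apply, Finset.mul_sum, ← Finset.sum_add_distrib]
  refine Finset.sum_congr rfl fun j _ => ?_
  rw [h]; ring

theorem inner_trace_ofSmooth {x₀ : Plane} {r : ℝ} {i : ι} (hU : IsStarDomain (K i).carrier x₀ r)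
    (l : SkeletonL2 K) (j : (K i).Idx) (φ : smoothFn) :
    ⟪l ⟨(K i).side j, side_mem_edges K i j⟩, (K i).trace j (H1.ofSmooth hU.isBounded φ)⟫ =
      ∫ x in (K i).side j, l ⟨(K i).side j, side_mem_edges K i j⟩ x * φ.1 x ∂μH[1] := by
  rw [MeshPolygon.trace_ofSmooth hU, L2.inner_def]
  refine integral_congr_ae ?_
  filter_upwards [(K i).coeFn_restrictSide j φ] with x hx
  rw [hx]; simp [mul_comm]

/-- For a smooth function vanishing on all sides but one, only this side contributes. -/
theorem adjTrace_ofSmooth_of_eq_zero {x₀ : Plane} {r : ℝ} {i : ι}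
    (hU : IsStarDomain (K i).carrier x₀ r) (l : SkeletonL2 K) (j : (K i).Idx) (φ : smoothFn)
    (h : ∀ j', j' ≠ j → ∀ x ∈ (K i).side j', φ.1 x = 0) :
    adjTrace K n l i (H1.ofSmooth hU.isBounded φ) = ⟪(K i).normal j, n ((K i).side j)⟫ *
      ∫ x in (K i).side j, l ⟨(K i).side j, side_mem_edges K i j⟩ x * φ.1 x ∂μH[1] := by
  rw [adjTrace_apply, Finset.sum_eq_single_of_mem j (Finset.mem_univ j) ?_, inner_trace_ofSmooth hU]
  intro j' _ hj'
  rw [inner_trace_ofSmooth hU, setIntegral_eq_zero_of_forall_eq_zero, mul_zero]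
  intro x hx
  rw [h j' hj' x hx, mul_zero]

/-- On a side where `λ` is the polynomial `p`, test with `p χ`, where `χ` is a bump at an interior
point of the side that vanishes on the other sides. Then `∫ p² χ = 0`, so `p` vanishes at that
point. -/
theorem IsSkeletonNormal.eq_zero_of_adjTrace_eq_zero (hn : IsSkeletonNormal Ω K n)
    (hK : ∀ i, ∃ x₀ r, IsStarDomain (K i).carrier x₀ r) {k' : ℕ} {l : SkeletonL2 K}
    (hl : l ∈ discreteL K k') (h : ∀ i, adjTrace K n l i = 0) : l = 0 := by
  funext e
  obtain ⟨e, he⟩ := e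
  obtain ⟨i, j, rfl⟩ := exists_side_eq he
  obtain ⟨p, -, hp⟩ := hl ⟨(K i).side j, he⟩
  obtain ⟨x₀, r, hU⟩ := hK i
  have hpc := contDiff_polyFn p
  have hzero : ∀ y ∈ openSegment ℝ ((K i).vertex j) ((K i).vertex (j + 1)), polyFn p y = 0 := by
    intro y hy
    obtain ⟨χ, hχ, hχ0, hχy, hχs⟩ := (K i).exists_smooth_bump hy
    set φ : smoothFn := ⟨fun x => polyFn p x * χ x,
      show ContDiff ℝ ∞ fun x => polyFn p x * χ x from hpc.mul hχ⟩
    have h1 := adjTrace_ofSmooth_of_eq_zero (n := n) hU l j φ fun j' hj' x hx => by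
      show polyFn p x * χ x = 0
      rw [hχs j' hj' x hx, mul_zero]
    rw [h i] at h1
    have h2 : ∫ x in (K i).side j, polyFn p x ^ 2 * χ x ∂μH[1] = 0 := by
      have h3 := (mul_eq_zero.1 h1.symm).resolve_left (fun h0 => by
        have := hn.abs_inner_eq i j
        rw [h0] at this; simp at this)
      rw [← h3]
      refine integral_congr_ae ?_
      filter_upwards [hp] with x hx
      rw [hx]; show _ = polyFn p x * (polyFn p x * χ x); ring
    have h4 := MeshPolygon.eq_zero_on_side_of_integral
      ((hpc.continuous.pow 2).mul hχ.continuous)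
      (fun x => mul_nonneg (sq_nonneg _) (hχ0 x)) h2 y (openSegment_subset_segment ℝ _ _ hy)
    simpa [hχy.ne'] using h4
  have hside : ∀ x ∈ (K i).side j, polyFn p x = 0 := by
    have hcl : IsClosed {x | polyFn p x = 0} := isClosed_eq hpc.continuous continuous_const
    intro x hx
    rw [MeshPolygon.side, ← closure_openSegment] at hx
    exact closure_minimal hzero hcl hx
  refine Lp.eq_zero_iff_ae_eq_zero.2 (hp.trans ?_)
  exact (ae_restrict_iff' ((K i).isCompact_side j).isClosed.measurableSet).2
    (Eventually.of_forall hside)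

/-! ### Edgewise constant multipliers -/

theorem isFiniteMeasure_edge (e : {e // e ∈ edges K}) :
    IsFiniteMeasure (Measure.restrict μH[1] e.1) := by
  obtain ⟨e, he⟩ := e
  obtain ⟨i, j, rfl⟩ := exists_side_eq he
  exact (K i).isFiniteMeasure_side j

theorem memLp_const_edge (e : {e // e ∈ edges K}) (c : ℝ) :
    MemLp (fun _ : Plane => c) 2 (Measure.restrict μH[1] e.1) :=
  haveI := isFiniteMeasure_edge e
  memLp_const c

/-- The function on the skeleton with the constant value `b e` on each edge `e`. -/
noncomputable def edgeConst (K : ι → MeshPolygon) (b : Set Plane → ℝ) : SkeletonL2 K :=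
  fun e => (memLp_const_edge e (b e.1)).toLp

theorem coeFn_edgeConst (b : Set Plane → ℝ) (e : {e // e ∈ edges K}) :
    edgeConst K b e =ᵐ[Measure.restrict μH[1] e.1] fun _ => b e.1 :=
  (memLp_const_edge e (b e.1)).coeFn_toLp

theorem edgeConst_mem_discreteL (b : Set Plane → ℝ) (k' : ℕ) : edgeConst K b ∈ discreteL K k' := by
  intro e
  refine ⟨MvPolynomial.C (b e.1), ?_, (coeFn_edgeConst b e).trans
    (Eventually.of_forall fun x => by simp [polyFn])⟩
  rw [MvPolynomial.mem_restrictTotalDegree]; simp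

theorem norm_edgeConst (b : Set Plane → ℝ) (i : ι) (j : (K i).Idx) :
    ‖edgeConst K b ⟨(K i).side j, side_mem_edges K i j⟩‖ =
      |b ((K i).side j)| * Real.sqrt ((K i).len j) := by
  have h : ‖edgeConst K b ⟨(K i).side j, side_mem_edges K i j⟩‖ ^ 2 =
      (|b ((K i).side j)| * Real.sqrt ((K i).len j)) ^ 2 := by
    have e := H1.norm_sq_eq_lintegral (edgeConst K b ⟨(K i).side j, side_mem_edges K i j⟩)
    rw [lintegral_congr_ae (g := fun _ => ‖b ((K i).side j)‖ₑ ^ 2)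
      (by filter_upwards [coeFn_edgeConst b ⟨(K i).side j, side_mem_edges K i j⟩] with x hx
          rw [hx]), lintegral_const, Measure.restrict_apply_univ,
      MeshPolygon.hausdorffMeasure_side, Real.enorm_eq_ofReal_abs,
      ← ENNReal.ofReal_pow (abs_nonneg _), ← ENNReal.ofReal_mul (by positivity)] at e
    have := ((K i).len_pos j).le
    rw [mul_pow, Real.sq_sqrt this]
    exact (ENNReal.ofReal_eq_ofReal_iff (by positivity) (by positivity)).1 e
  exact (sq_eq_sq₀ (norm_nonneg _) (by positivity)).1 h

theorem adjTrace_edgeConst_one {x₀ : Plane} {r : ℝ} {i : ι}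
    (hU : IsStarDomain (K i).carrier x₀ r) (b : Set Plane → ℝ) :
    adjTrace K n (edgeConst K b) i (H1.one hU.isBounded) =
      ∑ j, ⟪(K i).normal j, n ((K i).side j)⟫ * (b ((K i).side j) * (K i).len j) := by
  rw [adjTrace_apply]
  refine Finset.sum_congr rfl fun j _ => ?_
  congr 1
  rw [H1.one, inner_trace_ofSmooth hU, integral_congr_ae (g := fun _ => b ((K i).side j))
    (by filter_upwards [coeFn_edgeConst b ⟨(K i).side j, side_mem_edges K i j⟩] with x hx
        rw [hx]; exact mul_one _), setIntegral_const, measureReal_def,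
    MeshPolygon.hausdorffMeasure_side, ENNReal.toReal_ofReal ((K i).len_pos j).le, smul_eq_mul,
    mul_comm]

/-- One root of the side length comes from the norm of the constant and one from the trace
inequality. Their product cancels the division by the length in `jumpMultiplier`. -/
theorem dualSeminorm_edgeConst_le (hn : IsSkeletonNormal Ω K n) {γ₀ γ₁ : ℝ} (hγ₀ : 0 < γ₀)
    (hγ₁ : 0 < γ₁) {i : ι} (hK : (K i).ShapeRegular γ₀ γ₁) (b : Set Plane → ℝ) :
    H1.dualSeminorm (adjTrace K n (edgeConst K b) i) ≤
      MeshPolygon.traceConst γ₀ γ₁ * ∑ j, |b ((K i).side j)| * (K i).len j := by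
  have hT : 0 ≤ MeshPolygon.traceConst γ₀ γ₁ := Real.sqrt_nonneg _
  refine H1.dualSeminorm_le (mul_nonneg hT (Finset.sum_nonneg fun j _ =>
    mul_nonneg (abs_nonneg _) ((K i).len_pos j).le)) fun g hg => ?_
  rw [adjTrace_apply, Finset.mul_sum, Finset.sum_mul]
  refine Finset.sum_le_sum fun j _ => ?_
  refine (le_abs_self _).trans ?_
  rw [abs_mul, hn.abs_inner_eq, one_mul]
  refine (abs_real_inner_le_norm _ _).trans ?_
  rw [norm_edgeConst]
  have h := MeshPolygon.norm_trace_le hγ₀ hγ₁ hK j hg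
  calc _ ≤ |b ((K i).side j)| * Real.sqrt ((K i).len j) *
        (Real.sqrt ((K i).len j) * (MeshPolygon.traceConst γ₀ γ₁ * H1.seminorm g)) := by gcongr
    _ = |b ((K i).side j)| * (Real.sqrt ((K i).len j) * Real.sqrt ((K i).len j)) *
        (MeshPolygon.traceConst γ₀ γ₁ * H1.seminorm g) := by ring
    _ = _ := by rw [Real.mul_self_sqrt ((K i).len_pos j).le]; ring

/-! ### Comparison of the two stabilization constants. -/

theorem eq_zero_of_mul_sq_le {M ρ d : ℝ} (hlt : M < ρ) (h : ρ * d ^ 2 ≤ M * d * d) : d = 0 := by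
  by_contra hd
  have : 0 < d ^ 2 := by positivity
  nlinarith [mul_pos (sub_pos.2 hlt) this]

/-- The constants of continuity and coercivity of the stabilization forms satisfy `ρ ≤ M`. -/
theorem StabCoercive.le (hn : IsSkeletonNormal Ω K n)
    (hK : ∀ i, ∃ x₀ r, IsStarDomain (K i).carrier x₀ r) {k' : ℕ} {s : StabForms K} {M ρ : ℝ}
    (hs : StabContinuous K s M) (hc : StabCoercive K n k' s ρ) (i : ι) : ρ ≤ M := by
  by_contra! hlt
  obtain ⟨x₀, r, hU⟩ := hK i
  -- If `M < ρ`, the two assumptions on `s_K` force the dual seminorm of `γ_K^* λ` to vanish for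
  -- each edgewise constant `λ`, so these functionals annihilate all functions of mean value zero.
  have hz : ∀ b : Set Plane → ℝ, ∀ g : (K i).H1, H1.mean g = 0 →
      adjTrace K n (edgeConst K b) i g = 0 := by
    intro b g hg
    have h1 := hc i _ (edgeConst_mem_discreteL b k')
    have h2 := hs i (adjTrace K n (edgeConst K b) i) (adjTrace K n (edgeConst K b) i)
    have h3 := H1.abs_apply_le_dualSeminorm hU (adjTrace K n (edgeConst K b) i) hg
    have h6 := eq_zero_of_mul_sq_le hlt (h1.trans h2)
    rw [h6, zero_mul] at h3
    exact abs_nonpos_iff.1 h3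
  obtain ⟨χ, hχ, hχ0, hχy, hχs⟩ := (K i).exists_smooth_bump ((K i).midpoint_mem_openSegment 0)
  set φ : smoothFn := ⟨χ, hχ⟩
  set u : (K i).H1 := H1.ofSmooth hU.isBounded φ
  have hinner : ∀ j, ⟪(K i).normal j, n ((K i).side j)⟫ ≠ 0 := fun j h0 => by
    have := hn.abs_inner_eq i j
    rw [h0] at this; simp at this
  classical
  have hu : ∀ b : Set Plane → ℝ, adjTrace K n (edgeConst K b) i u =
      ⟪(K i).normal 0, n ((K i).side 0)⟫ * (b ((K i).side 0) * ∫ x in (K i).side 0, χ x ∂μH[1]) := by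
    intro b
    rw [adjTrace_ofSmooth_of_eq_zero hU _ 0 φ hχs, ← integral_const_mul (b _)]
    congr 1
    refine integral_congr_ae ?_
    filter_upwards [coeFn_edgeConst b ⟨(K i).side 0, side_mem_edges K i 0⟩] with x hx
    rw [hx]
  -- The multiplier concentrated on side `1` does not see `u`, whose trace lives on side `0`.
  -- Applied to `u` minus its mean, it yields the mean times the length of side `1`.
  have hmean : H1.mean u = 0 := by
    have h1 := hz (fun e => if e = (K i).side 1 then 1 else 0) _ (H1.mean_sub_mean_smul_one hU u)
    have h01 : (K i).side 0 ≠ (K i).side 1 := fun h => by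
      have := (K i).side_injective h
      simp at this
    rw [map_sub, map_smul, hu, adjTrace_edgeConst_one hU, if_neg h01,
      Finset.sum_eq_single_of_mem 1 (Finset.mem_univ _)] at h1
    · rw [if_pos rfl, zero_mul, mul_zero, zero_sub, neg_eq_zero, smul_eq_mul, one_mul,
        mul_eq_zero] at h1
      exact h1.resolve_right (mul_ne_zero (hinner 1) ((K i).len_pos 1).ne')
    · intro j _ hj
      rw [if_neg fun h => hj ((K i).side_injective h)]; simp
  -- Now `u` itself is admissible, and the constant multiplier gives `∫ χ = 0` over side `0`,
  -- although `χ ≥ 0` is positive at its midpoint.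
  have h2 := hz (fun _ => 1) u hmean
  rw [hu, one_mul] at h2
  have h3 := MeshPolygon.eq_zero_on_side_of_integral hχ.continuous hχ0
    ((mul_eq_zero.1 h2).resolve_left (hinner 0))
  have hmem : midpoint ℝ ((K i).vertex 0) ((K i).vertex (0 + 1)) ∈ (K i).side 0 :=
    openSegment_subset_segment ℝ _ _ ((K i).midpoint_mem_openSegment 0)
  exact hχy.ne' (h3 _ hmem)

end Mesh

/-! ### The norm on the discrete space and the multiplier built from jumps. -/

section Mesh

variable {ι : Type*} [Fintype ι] {K : ι → MeshPolygon} {Ω : Set Plane} {n : Set Plane → Plane}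
  {γ₀ γ₁ : ℝ}

theorem normV_sq (u : BrokenH1 K) : normV K u ^ 2 = ∑ i, H1.seminorm (u i) ^ 2 +
    ∑ e ∈ edges K, ‖jump K (fun i _ => H1.mean (u i)) e‖ ^ 2 :=
  Real.sq_sqrt (by positivity)

theorem normL_sq (l : SkeletonL2 K) :
    normL K n l ^ 2 = ∑ i, H1.dualNorm (adjTrace K n l i) ^ 2 :=
  Real.sq_sqrt (by positivity)

theorem normVL_sq (x : BrokenH1 K × SkeletonL2 K) :
    normVL K n x ^ 2 = normV K x.1 ^ 2 + normL K n x.2 ^ 2 :=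
  Real.sq_sqrt (by positivity)

/-- `‖·‖_{𝕍_h}` is definite on the discrete space. -/
theorem IsMesh.normVL_pos (hM : IsMesh Ω K) (hn : IsSkeletonNormal Ω K n)
    (hK : ∀ i, ∃ x₀ r, IsStarDomain (K i).carrier x₀ r) {k k' : ℕ}
    {x : BrokenH1 K × SkeletonL2 K} (hx : x ∈ discreteVL K k k') (hx0 : x ≠ 0) :
    0 < normVL K n x := by
  refine lt_of_le_of_ne (Real.sqrt_nonneg _) fun h => hx0 ?_
  have h1 := normVL_sq (n := n) x
  rw [← h] at h1
  have hV : normV K x.1 ^ 2 = 0 := by nlinarith [sq_nonneg (normV K x.1), sq_nonneg (normL K n x.2)]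
  have hL : normL K n x.2 ^ 2 = 0 := by
    nlinarith [sq_nonneg (normV K x.1), sq_nonneg (normL K n x.2)]
  rw [normV_sq] at hV
  rw [normL_sq, Finset.sum_eq_zero_iff_of_nonneg fun i _ => sq_nonneg _] at hL
  have h2 : 0 ≤ ∑ i, H1.seminorm (x.1 i) ^ 2 := by positivity
  have h3 : 0 ≤ ∑ e ∈ edges K, ‖jump K (fun i _ => H1.mean (x.1 i)) e‖ ^ 2 := by positivity
  have hV1 : ∑ i, H1.seminorm (x.1 i) ^ 2 = 0 := by linarith
  have hV2 : ∑ e ∈ edges K, ‖jump K (fun i _ => H1.mean (x.1 i)) e‖ ^ 2 = 0 := by linarith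
  rw [Finset.sum_eq_zero_iff_of_nonneg fun i _ => sq_nonneg _] at hV1 hV2
  have hmean := hM.eq_zero_of_jump_eq_zero hn (c := fun i => H1.mean (x.1 i))
    fun e he => norm_eq_zero.1 (pow_eq_zero_iff two_ne_zero |>.1 (hV2 e he))
  refine Prod.ext (funext fun i => ?_) ?_
  · obtain ⟨x₀, r, hU⟩ := hK i
    exact H1.eq_zero_of_mean_of_seminorm hU (hmean i)
      (pow_eq_zero_iff two_ne_zero |>.1 (hV1 i (Finset.mem_univ i)))
  · refine hn.eq_zero_of_adjTrace_eq_zero hK hx.2 fun i => ?_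
    obtain ⟨x₀, r, hU⟩ := hK i
    exact H1.eq_zero_of_dualNorm hU (pow_eq_zero_iff two_ne_zero |>.1 (hL i (Finset.mem_univ i)))

/-! ### The multiplier built from the jumps of the mean values -/

/-- On each edge `e`, the normal component of `⟦ū⟧`, divided by the length of `e`. -/
noncomputable def jumpMultiplier (K : ι → MeshPolygon) (n : Set Plane → Plane) (u : BrokenH1 K)
    (e : Set Plane) : ℝ :=
  ⟪jump K (fun i _ => H1.mean (u i)) e, n e⟫ / (μH[1] e).toReal

theorem toReal_hausdorffMeasure_side (P : MeshPolygon) (j : P.Idx) :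
    (μH[1] (P.side j)).toReal = P.len j := by
  rw [P.hausdorffMeasure_side, ENNReal.toReal_ofReal (P.len_pos j).le]

theorem jumpMultiplier_mul_len (u : BrokenH1 K) (i : ι) (j : (K i).Idx) :
    jumpMultiplier K n u ((K i).side j) * (K i).len j =
      ⟪jump K (fun i _ => H1.mean (u i)) ((K i).side j), n ((K i).side j)⟫ := by
  rw [jumpMultiplier, toReal_hausdorffMeasure_side, div_mul_cancel₀ _ ((K i).len_pos j).ne']

theorem abs_jumpMultiplier_mul_len (hn : IsSkeletonNormal Ω K n) (u : BrokenH1 K) (i : ι)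
    (j : (K i).Idx) : |jumpMultiplier K n u ((K i).side j)| * (K i).len j =
      ‖jump K (fun i _ => H1.mean (u i)) ((K i).side j)‖ := by
  rw [← hn.inner_jump_sq _ (side_mem_edges K i j), ← jumpMultiplier_mul_len, abs_mul,
    abs_of_pos ((K i).len_pos j)]

/-- The constant in the bound of `γ_K^* μ` for the multiplier `μ` built from the jumps. -/
noncomputable def multiplierConst (γ₀ γ₁ : ℝ) : ℝ :=
  2 * ((1 + MeshPolygon.traceConst γ₀ γ₁ ^ 2) * (1 + 2 / γ₁) ^ 2)

theorem MeshPolygon.ShapeRegular.sq_sum_side_le {P : MeshPolygon} (hP : P.ShapeRegular γ₀ γ₁)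
    (hγ₀ : 0 < γ₀) (hγ₁ : 0 < γ₁) (f : P.Idx → ℝ) :
    (∑ j, f j) ^ 2 ≤ (1 + 2 / γ₁) ^ 2 * ∑ j, f j ^ 2 := by
  refine (sq_sum_le_card_mul_sum_sq (s := Finset.univ)).trans ?_
  rw [Finset.card_univ]
  gcongr
  exact hP.card_le hγ₀ hγ₁

/-- On each element both terms are bounded through `∑_j |⟦ū⟧|` over its sides, because the lengths
cancel. Cauchy–Schwarz with the bounded number of sides gives squares, and the factor `2` in
`multiplierConst` accounts for edges shared by two elements. -/
theorem IsMesh.sum_apply_one_sq_add_dualSeminorm_sq_le (hM : IsMesh Ω K)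
    (hn : IsSkeletonNormal Ω K n) (hγ₀ : 0 < γ₀) (hγ₁ : 0 < γ₁)
    (hK : ∀ i, (K i).ShapeRegular γ₀ γ₁) (u : BrokenH1 K) :
    ∑ i, (adjTrace K n (edgeConst K (jumpMultiplier K n u)) i (H1.one (K i).isBounded) ^ 2 +
      H1.dualSeminorm (adjTrace K n (edgeConst K (jumpMultiplier K n u)) i) ^ 2) ≤
    multiplierConst γ₀ γ₁ * ∑ e ∈ edges K, ‖jump K (fun i _ => H1.mean (u i)) e‖ ^ 2 := by
  set J : Set Plane → ℝ := fun e => ‖jump K (fun i _ => H1.mean (u i)) e‖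
  set T := MeshPolygon.traceConst γ₀ γ₁
  have hT : 0 ≤ T := Real.sqrt_nonneg _
  have hi : ∀ i, adjTrace K n (edgeConst K (jumpMultiplier K n u)) i (H1.one (K i).isBounded) ^ 2 +
      H1.dualSeminorm (adjTrace K n (edgeConst K (jumpMultiplier K n u)) i) ^ 2 ≤
      (1 + T ^ 2) * (1 + 2 / γ₁) ^ 2 * ∑ j, J ((K i).side j) ^ 2 := by
    intro i
    obtain ⟨x₀, hU⟩ := (hK i).isStarDomain hγ₀
    have h1 : |adjTrace K n (edgeConst K (jumpMultiplier K n u)) i (H1.one (K i).isBounded)| ≤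
        ∑ j, J ((K i).side j) := by
      rw [adjTrace_edgeConst_one hU]
      refine (Finset.abs_sum_le_sum_abs _ _).trans (Finset.sum_le_sum fun j _ => ?_)
      rw [abs_mul, hn.abs_inner_eq, one_mul, abs_mul, abs_of_pos ((K i).len_pos j),
        abs_jumpMultiplier_mul_len hn]
    have h2 := dualSeminorm_edgeConst_le hn hγ₀ hγ₁ (hK i) (jumpMultiplier K n u)
    simp only [abs_jumpMultiplier_mul_len hn] at h2
    have h3 := (hK i).sq_sum_side_le hγ₀ hγ₁ fun j => J ((K i).side j)
    have h4 := H1.dualSeminorm_nonneg (adjTrace K n (edgeConst K (jumpMultiplier K n u)) i)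
    calc _ ≤ (∑ j, J ((K i).side j)) ^ 2 + (T * ∑ j, J ((K i).side j)) ^ 2 := by
          rw [← sq_abs (adjTrace K n _ i _)]
          gcongr
      _ = (1 + T ^ 2) * (∑ j, J ((K i).side j)) ^ 2 := by ring
      _ ≤ (1 + T ^ 2) * ((1 + 2 / γ₁) ^ 2 * ∑ j, J ((K i).side j) ^ 2) := by gcongr
      _ = _ := by ring
  refine (Finset.sum_le_sum fun i _ => hi i).trans ?_
  rw [← Finset.mul_sum]
  have h5 := hM.sum_sides_le hn (b := fun e => J e ^ 2) fun e => sq_nonneg _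
  calc _ ≤ (1 + T ^ 2) * (1 + 2 / γ₁) ^ 2 * (2 * ∑ e ∈ edges K, J e ^ 2) := by gcongr
    _ = _ := by rw [multiplierConst]; ring

/-- The mean values of `u` contribute exactly the sum of the squared jumps, since `μ` times the edge
length is the normal jump. What remains of `u` has mean zero and is paired through the dual
seminorm. -/
theorem jumpPairing_jumpMultiplier_ge (hn : IsSkeletonNormal Ω K n)
    (hK : ∀ i, ∃ x₀ r, IsStarDomain (K i).carrier x₀ r) (u : BrokenH1 K) :
    ∑ e ∈ edges K, ‖jump K (fun i _ => H1.mean (u i)) e‖ ^ 2 -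
      ∑ i, H1.seminorm (u i) *
        H1.dualSeminorm (adjTrace K n (edgeConst K (jumpMultiplier K n u)) i) ≤
    jumpPairing K n (edgeConst K (jumpMultiplier K n u)) u := by
  have h1 : ∀ i, adjTrace K n (edgeConst K (jumpMultiplier K n u)) i (u i) ≥
      ∑ j, H1.mean (u i) * (⟪(K i).normal j, n ((K i).side j)⟫ *
        ⟪jump K (fun i _ => H1.mean (u i)) ((K i).side j), n ((K i).side j)⟫) -
      H1.seminorm (u i) *
        H1.dualSeminorm (adjTrace K n (edgeConst K (jumpMultiplier K n u)) i) := by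
    intro i
    obtain ⟨x₀, r, hU⟩ := hK i
    have h2 := H1.abs_apply_le_dualSeminorm hU
      (adjTrace K n (edgeConst K (jumpMultiplier K n u)) i) (H1.mean_sub_mean_smul_one hU (u i))
    rw [H1.seminorm_sub_smul_one, map_sub, map_smul, smul_eq_mul, adjTrace_edgeConst_one hU] at h2
    simp only [jumpMultiplier_mul_len] at h2
    rw [← Finset.mul_sum]
    have := (abs_le.1 h2).1
    linarith
  rw [jumpPairing_eq_sum]
  refine le_trans (le_of_eq ?_) (Finset.sum_le_sum fun i _ => h1 i)
  rw [Finset.sum_sub_distrib, ← IsSkeletonNormal.sum_mul_inner_jump (fun i _ => H1.mean (u i))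
    (fun e => ⟪jump K (fun i _ => H1.mean (u i)) e, n e⟫)]
  congr 1
  refine Finset.sum_congr rfl fun e he => ?_
  rw [← hn.inner_jump_sq _ he, sq_abs, sq]

/-! ### The test function -/

/-- The piecewise constant function with the values `⟨γ_K^* λ, 1⟩`. -/
noncomputable def fluxFn (n : Set Plane → Plane) (l : SkeletonL2 K) : BrokenH1 K :=
  fun i => adjTrace K n l i (H1.one (K i).isBounded) • H1.one (K i).isBounded

theorem fluxFn_mem_discreteV (l : SkeletonL2 K) (k : ℕ) : fluxFn n l ∈ discreteV K k := by
  intro i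
  set m := adjTrace K n l i (H1.one (K i).isBounded)
  refine ⟨MvPolynomial.C m, by rw [MvPolynomial.mem_restrictTotalDegree]; simp, ?_⟩
  filter_upwards [H1.fn_one (K i).isBounded,
    Lp.coeFn_smul m (H1.one (K i).isBounded).1.1] with x h1 h2
  have h3 : H1.fn (fluxFn n l i) x = m * H1.fn (H1.one (K i).isBounded) x := h2
  rw [h3, h1]; simp [polyFn]

/-! ### Lower bounds on one element. -/

/-- Here `U = |u|_{1,K}`, `L = |γ_K^* λ|_{-1,K}` and `d = |γ_K^* μ|_{-1,K}`; `v` and `w` are the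
values of `s_K` at `D u - γ_K^* λ` against `t D u - γ_K^* λ` and `γ_K^* μ`. The choice of `α`
balances the weights: coercivity receives `C r²` and continuity `C r`, where `r = ρ / M ≤ 1`, so
every cross term is of the form `(r L) · U` or `(r L) · d`. -/
theorem element_estimate {C ρ M δ U L d v w : ℝ} (hC : 0 < C) (hC' : C ≤ 1 / 6) (hρ : 0 < ρ)
    (hρM : ρ ≤ M) (hδ : 0 ≤ δ) (hU : 0 ≤ U) (hd : 0 ≤ d)
    (hv : ρ * L ^ 2 - M * U ^ 2 - 2 * (M * U * L) ≤ v) (hw : w ≤ M * (U + L) * d) :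
    U ^ 2 / 4 + C / 4 * (ρ / M) ^ 2 * L ^ 2 - 5 * δ ^ 2 * d ^ 2 ≤
      U ^ 2 - δ * (U * d) + C * (ρ / M ^ 2) * (v - δ * w) := by
  have hM : 0 < M := lt_of_lt_of_le hρ hρM
  set r := ρ / M
  have hr0 : 0 < r := by positivity
  have hr1 : r ≤ 1 := (div_le_one hM).2 hρM
  have hα : C * (ρ / M ^ 2) * M = C * r := by simp only [r]; field_simp
  have hα' : C * (ρ / M ^ 2) * ρ = C * r ^ 2 := by simp only [r]; field_simp
  have hα0 : 0 ≤ C * (ρ / M ^ 2) := by positivity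
  have h1 : C * r ^ 2 * L ^ 2 - C * r * U ^ 2 - 2 * (C * r * U * L) ≤ C * (ρ / M ^ 2) * v := by
    refine le_trans (le_of_eq ?_) (mul_le_mul_of_nonneg_left hv hα0)
    rw [← hα, ← hα']; ring
  have h2 : C * (ρ / M ^ 2) * (δ * w) ≤ δ * (C * r * (U + L) * d) := by
    refine le_trans (mul_le_mul_of_nonneg_left (mul_le_mul_of_nonneg_left hw hδ) hα0) (le_of_eq ?_)
    rw [← hα]; ring
  -- The three squares are Young's inequality for the products `U L`, `L d` and `U d`. They leave `C
  -- - C/2 - C/4 = C/4` in front of `r² L²`, at least `1 - 1/6 - 2/6 - 1/4 = 1/4` in front of `U²`,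
  -- which is where `C ≤ 1/6` enters, and at most `4 + C ≤ 5` in front of `δ² d²`.
  have h3 : 0 ≤ C / 2 * (r * L - 2 * U) ^ 2 := by positivity
  have h4 : 0 ≤ C * (r * L / 2 - δ * d) ^ 2 := by positivity
  have h5 : 0 ≤ (U / 2 - 2 * (δ * d)) ^ 2 := sq_nonneg _
  have h6 : C * r ≤ 1 / 6 := by nlinarith
  have h7 : C * r * (δ * (U * d)) ≤ 1 * (δ * (U * d)) := by gcongr; linarith
  have h8 : C * r * U ^ 2 ≤ 1 / 6 * U ^ 2 := by gcongr
  have h9 : C * U ^ 2 ≤ 1 / 6 * U ^ 2 := by gcongr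
  have h10 : C * (δ * d) ^ 2 ≤ 1 * (δ * d) ^ 2 := by gcongr; linarith
  nlinarith

theorem bilin_sub_left {E : Type*} [AddCommGroup E] [Module ℝ E] (s : E →ₗ[ℝ] E →ₗ[ℝ] ℝ)
    (x y z : E) : s (x - y) z = s x z - s y z := by
  rw [map_sub, LinearMap.sub_apply]

theorem bilin_sub_smul_sub {E : Type*} [AddCommGroup E] [Module ℝ E] (s : E →ₗ[ℝ] E →ₗ[ℝ] ℝ)
    (x y z w : E) (t : ℝ) :
    s (x - y) (t • z - w) = t * s x z - s x w - (t * s y z - s y w) := by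
  rw [bilin_sub_left, map_sub, map_sub, map_smul, map_smul, smul_eq_mul, smul_eq_mul]

/-- Apart from `s(F, F)`, every term is estimated by absolute value, so the sign `t` plays no role.
-/
theorem form_lower_bound {U : Set Plane} {s : H1.Dual U →ₗ[ℝ] H1.Dual U →ₗ[ℝ] ℝ} {M ρ t : ℝ}
    (hM : 0 < M) (ht : t = 1 ∨ t = -1)
    (hs : ∀ F G, s F G ≤ M * H1.dualSeminorm F * H1.dualSeminorm G) (u : H1 U) {F : H1.Dual U}
    (hF : ρ * H1.dualSeminorm F ^ 2 ≤ s F F) :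
    ρ * H1.dualSeminorm F ^ 2 - M * H1.seminorm u ^ 2 -
      2 * (M * H1.seminorm u * H1.dualSeminorm F) ≤ s (H1.D u - F) (t • H1.D u - F) := by
  have h0 := H1.dualSeminorm_D_le u
  have hD0 := H1.dualSeminorm_nonneg (H1.D u)
  have hF0 := H1.dualSeminorm_nonneg F
  have h1 := abs_le.1 (H1.abs_form_le hs (H1.D u) (H1.D u))
  have h2 := abs_le.1 (H1.abs_form_le hs (H1.D u) F)
  have h3 := abs_le.1 (H1.abs_form_le hs F (H1.D u))
  have e : s (H1.D u - F) (t • H1.D u - F) =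
      t * s (H1.D u) (H1.D u) - s (H1.D u) F - (t * s F (H1.D u) - s F F) := by
    exact bilin_sub_smul_sub (E := H1.Dual U) s _ _ _ _ t
  rw [e]
  have h4 : M * H1.dualSeminorm (H1.D u) * H1.dualSeminorm (H1.D u) ≤ M * H1.seminorm u ^ 2 := by
    rw [mul_assoc, ← sq]; gcongr
  have h5 : M * H1.dualSeminorm (H1.D u) * H1.dualSeminorm F ≤
      M * H1.seminorm u * H1.dualSeminorm F := by gcongr
  have h6 : M * H1.dualSeminorm F * H1.dualSeminorm (H1.D u) ≤
      M * H1.seminorm u * H1.dualSeminorm F := by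
    rw [mul_right_comm]; gcongr
  rcases ht with rfl | rfl
  · linarith
  · linarith

theorem form_sub_le {U : Set Plane} {s : H1.Dual U →ₗ[ℝ] H1.Dual U →ₗ[ℝ] ℝ} {M : ℝ} (hM : 0 < M)
    (hs : ∀ F G, s F G ≤ M * H1.dualSeminorm F * H1.dualSeminorm G) (u : H1 U) (F G : H1.Dual U) :
    s (H1.D u - F) G ≤ M * (H1.seminorm u + H1.dualSeminorm F) * H1.dualSeminorm G := by
  have h0 := H1.dualSeminorm_D_le u
  have hG0 := H1.dualSeminorm_nonneg G
  have h1 := (abs_le.1 (H1.abs_form_le hs (H1.D u) G)).2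
  have h2 := (abs_le.1 (H1.abs_form_le hs F G)).1
  have h3 : M * H1.dualSeminorm (H1.D u) * H1.dualSeminorm G ≤
      M * H1.seminorm u * H1.dualSeminorm G := by gcongr
  have e : s (H1.D u - F) G = s (H1.D u) G - s F G :=
    bilin_sub_left (E := H1.Dual U) s _ _ _
  rw [e]
  linarith

end Mesh

/-! ### The inf-sup condition. -/

section Mesh

variable {ι : Type*} [Fintype ι] {K : ι → MeshPolygon} {Ω : Set Plane} {n : Set Plane → Plane}
  {γ₀ γ₁ : ℝ}

theorem H1.grad_sub_smul_one {U : Set Plane} (hU : Bornology.IsBounded U) (u : H1 U) (c : ℝ) :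
    H1.grad (u - c • H1.one hU) = H1.grad u := by
  simp only [map_sub, map_smul, H1.grad_one, smul_zero, sub_zero]

theorem H1.D_sub_smul_one {U : Set Plane} (hU : Bornology.IsBounded U) (u : H1 U) (c : ℝ) :
    H1.D (u - c • H1.one hU) = H1.D u := by
  rw [H1.D, H1.grad_sub_smul_one, H1.D]

theorem jump_sub (w w' : ∀ i, (K i).Idx → ℝ) (e : Set Plane) :
    jump K (fun i j => w i j - w' i j) e = jump K w e - jump K w' e := by
  simp only [jump, ← Finset.sum_sub_distrib]
  refine Finset.sum_congr rfl fun i _ => Finset.sum_congr rfl fun j _ => ?_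
  split_ifs
  · rw [sub_smul]
  · rw [sub_zero]

theorem norm_sub_sq_le_two_mul {E : Type*} [SeminormedAddCommGroup E] (a b : E) :
    ‖a - b‖ ^ 2 ≤ 2 * ‖a‖ ^ 2 + 2 * ‖b‖ ^ 2 := by
  nlinarith [norm_sub_le a b, norm_nonneg (a - b), sq_nonneg (‖a‖ - ‖b‖)]

theorem form_test_eq {E : Type*} [AddCommGroup E] [Module ℝ E] (s : E →ₗ[ℝ] E →ₗ[ℝ] ℝ)
    {x a a' b b' c : E} {t δ : ℝ} (ha : a' = a) (hb : b' = b + δ • c) :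
    s x (t • a' - b') = s x (t • a - b) - δ * s x c := by
  rw [ha, hb, ← sub_sub, map_sub, map_smul, smul_eq_mul]

/-- The sums over the elements are `SU = ∑ |u|²`, `SL = ∑ |γ^*λ|²`, `Sm = ∑ ⟨γ^*λ, 1⟩²`, `Sd = ∑
|γ^*μ|²`, `Sg = ∑ ⟨γ^*μ, 1⟩²` and `D = ∑ ‖γ^*λ‖²`; further `J` is the sum of the squared jumps and
`R = (ρ/M)²`. The condition `10 δ κ ≤ 1` allows half of `δ J` to absorb the error `5 δ² Sd`. -/
theorem test_combination {SU SL Sm Sd Sg J D R C δ κ c A : ℝ} (hδ : 0 ≤ δ)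
    (hδκ : 10 * (δ * κ) ≤ 1) (hc : 0 < c) (hcC : c ≤ C / 4) (hC' : C ≤ 1 / 6) (hcδ : c ≤ δ / 2)
    (hR : 0 < R) (hR' : R ≤ 1) (hSU : 0 ≤ SU) (hSL : 0 ≤ SL) (hSm : 0 ≤ Sm) (hSg : 0 ≤ Sg)
    (hJ : 0 ≤ J) (h1 : SU / 4 + C / 4 * R * SL - 5 * δ ^ 2 * Sd + Sm + δ * J ≤ A)
    (h2 : Sg + Sd ≤ κ * J) (h3 : D ≤ Sm + SL) : c * R * (SU + J + D) ≤ A := by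
  have hd : 5 * δ ^ 2 * Sd ≤ δ / 2 * J := by
    have : Sd ≤ κ * J := by linarith
    calc 5 * δ ^ 2 * Sd ≤ 5 * δ ^ 2 * (κ * J) := by gcongr
      _ = (10 * (δ * κ)) * (δ / 2 * J) := by ring
      _ ≤ 1 * (δ / 2 * J) := by gcongr
      _ = _ := one_mul _
  have hcR : c * R ≤ c := mul_le_of_le_one_right hc.le hR'
  calc c * R * (SU + J + D) ≤ c * R * (SU + J + (Sm + SL)) := by gcongr
    _ = c * R * SU + c * R * J + c * R * Sm + c * R * SL := by ring
    _ ≤ 1 / 4 * SU + δ / 2 * J + 1 * Sm + C / 4 * R * SL := by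
        gcongr <;> linarith
    _ ≤ A := by linarith

/-- The terms `f i = ⟨γ_K^* λ, u⟩` enter the two couplings with opposite signs and cancel. Only the
squared fluxes `m i ^ 2` and the pairing of `μ` with `u` survive. -/
theorem sum_test_eq {a a' b c d f g m w : ι → ℝ} {α δ p q r : ℝ} (hp : p = ∑ i, b i)
    (hq : q = ∑ i, c i) (hr : r = ∑ i, g i) (ha : ∀ i, a i = a' i)
    (hb : ∀ i, b i = f i - m i * m i) (hc : ∀ i, c i = f i + δ * g i) (hd : ∀ i, d i = w i) :
    ∑ i, a i - p + q + α * ∑ i, d i =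
      ∑ i, (a' i + α * w i) + ∑ i, m i ^ 2 + δ * r := by
  simp only [hp, hq, hr, ha, hb, hc, hd, Finset.sum_add_distrib, Finset.sum_sub_distrib,
    Finset.mul_sum, sq]
  ring

theorem mul_le_div_of_test {c c' R X Y A : ℝ} (hc : 0 < c) (hc' : 0 < c') (hR : 0 ≤ R)
    (hX : 0 < X) (hY : 0 < Y) (hYX : Y ≤ c' * X) (hA : c * R * X ^ 2 ≤ A) :
    c / c' * R ≤ A / (X * Y) := by
  refine (le_div_iff₀ (mul_pos hX hY)).2 ?_
  calc c / c' * R * (X * Y) ≤ c / c' * R * (X * (c' * X)) := by gcongr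
    _ = c * R * X ^ 2 := by field_simp
    _ ≤ A := hA

/-- Testing with `(u - ∑_K ⟨γ_K^* λ, 1⟩ χ_K, λ + δ μ)`, where `μ` is built from the jumps of `ū`. -/
theorem bilinA_test_ge (hn : IsSkeletonNormal Ω K n)
    (hK : ∀ i, ∃ x₀ r, IsStarDomain (K i).carrier x₀ r) {k' : ℕ} {s : StabForms K}
    {C M ρ t δ : ℝ} (hC : 0 < C) (hC' : C ≤ 1 / 6) (hρ : 0 < ρ) (hρM : ρ ≤ M) (hδ : 0 ≤ δ)
    (ht : t = 1 ∨ t = -1) (hs : StabContinuous K s M) (hc : StabCoercive K n k' s ρ)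
    (u : BrokenH1 K) {l : SkeletonL2 K} (hl : l ∈ discreteL K k') :
    (∑ i, H1.seminorm (u i) ^ 2) / 4 +
      C / 4 * (ρ / M) ^ 2 * ∑ i, H1.dualSeminorm (adjTrace K n l i) ^ 2 -
      5 * δ ^ 2 *
        ∑ i, H1.dualSeminorm (adjTrace K n (edgeConst K (jumpMultiplier K n u)) i) ^ 2 +
      ∑ i, adjTrace K n l i (H1.one (K i).isBounded) ^ 2 +
      δ * ∑ e ∈ edges K, ‖jump K (fun i _ => H1.mean (u i)) e‖ ^ 2 ≤
    bilinA K n s t (C * (ρ / M ^ 2)) (u, l)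
      (u - fluxFn n l, l + δ • edgeConst K (jumpMultiplier K n u)) := by
  have hM : 0 < M := hρ.trans_le hρM
  set μ := edgeConst K (jumpMultiplier K n u)
  set α := C * (ρ / M ^ 2)
  have hJ := mul_le_mul_of_nonneg_left (jumpPairing_jumpMultiplier_ge hn hK u) hδ
  have hi : ∀ i, s i (H1.D (u i) - adjTrace K n l i)
      (t • H1.D ((u - fluxFn n l) i) - adjTrace K n (l + δ • μ) i) =
      s i (H1.D (u i) - adjTrace K n l i) (t • H1.D (u i) - adjTrace K n l i) -
        δ * s i (H1.D (u i) - adjTrace K n l i) (adjTrace K n μ i) := by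
    intro i
    exact form_test_eq (E := H1.Dual (K i).carrier) (s i) (H1.D_sub_smul_one _ (u i) _)
      (adjTrace_add_smul l μ δ i)
  have hexp : bilinA K n s t α (u, l) (u - fluxFn n l, l + δ • μ) =
      ∑ i, (H1.seminorm (u i) ^ 2 +
        α * (s i (H1.D (u i) - adjTrace K n l i) (t • H1.D (u i) - adjTrace K n l i) -
        δ * s i (H1.D (u i) - adjTrace K n l i) (adjTrace K n μ i))) +
      ∑ i, adjTrace K n l i (H1.one (K i).isBounded) ^ 2 + δ * jumpPairing K n μ u := by
    have e1 : ∀ i, ⟪H1.grad (u i), H1.grad ((u - fluxFn n l) i)⟫ = H1.seminorm (u i) ^ 2 :=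
      fun i => (congrArg (⟪H1.grad (u i), ·⟫) (H1.grad_sub_smul_one _ (u i) _)).trans
        (real_inner_self_eq_norm_sq _)
    have e2 : ∀ i, adjTrace K n l i ((u - fluxFn n l) i) = adjTrace K n l i (u i) -
        adjTrace K n l i (H1.one (K i).isBounded) * adjTrace K n l i (H1.one (K i).isBounded) :=
      fun i => ((adjTrace K n l i).map_sub _ _).trans
        (congrArg (_ - ·) ((adjTrace K n l i).map_smul _ _))
    have e3 : ∀ i, adjTrace K n (l + δ • μ) i (u i) =
        adjTrace K n l i (u i) + δ * adjTrace K n μ i (u i) :=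
      fun i => DFunLike.congr_fun (adjTrace_add_smul l μ δ i) (u i)
    exact sum_test_eq (jumpPairing_eq_sum n l (u - fluxFn n l))
      (jumpPairing_eq_sum n (l + δ • μ) u) (jumpPairing_eq_sum n μ u) e1 e2 e3 hi
  have hel := Finset.sum_le_sum fun i (_ : i ∈ Finset.univ) =>
    element_estimate (U := H1.seminorm (u i)) hC hC' hρ hρM hδ (norm_nonneg _)
      (H1.dualSeminorm_nonneg (adjTrace K n μ i))
      (form_lower_bound hM ht (hs i) (u i) (hc i l hl))
      (form_sub_le hM (hs i) (u i) (adjTrace K n l i) (adjTrace K n μ i))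
  rw [hexp]
  simp only [Finset.sum_add_distrib, Finset.sum_sub_distrib, ← Finset.mul_sum,
    ← Finset.sum_div] at hel ⊢
  rw [mul_sub] at hJ
  linarith

/-- Subtracting constants leaves the gradients unchanged, so only the jumps of the means grow. Since
`‖1‖_{1,K} = 1`, the subtracted values are bounded by `‖γ_K^* λ‖_{-1,K}`, each occurring once per
side. -/
theorem IsMesh.normV_sub_fluxFn_sq_le (hM : IsMesh Ω K) (hn : IsSkeletonNormal Ω K n) (hγ₀ : 0 < γ₀)
    (hγ₁ : 0 < γ₁) (hK : ∀ i, (K i).ShapeRegular γ₀ γ₁) (u : BrokenH1 K) (l : SkeletonL2 K) :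
    normV K (u - fluxFn n l) ^ 2 ≤
      2 * normV K u ^ 2 + 4 * (1 + 2 / γ₁) ^ 2 * normL K n l ^ 2 := by
  have hi : ∀ i, (u - fluxFn n l) i =
      u i - adjTrace K n l i (H1.one (K i).isBounded) • H1.one (K i).isBounded := fun i => rfl
  have hmean : ∀ i, H1.mean ((u - fluxFn n l) i) =
      H1.mean (u i) - adjTrace K n l i (H1.one (K i).isBounded) := by
    intro i
    obtain ⟨x₀, hU⟩ := (hK i).isStarDomain hγ₀
    rw [hi, H1.mean_sub hU.isBounded, H1.mean_smul hU.isBounded,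
      H1.mean_one hU.isBounded hU.volume_ne_zero hU.volume_ne_top, mul_one]
  have hflux : ∑ e ∈ edges K,
      ‖jump K (fun i _ => adjTrace K n l i (H1.one (K i).isBounded)) e‖ ^ 2 ≤
      2 * ((1 + 2 / γ₁) ^ 2 * normL K n l ^ 2) := by
    refine (hM.sum_norm_jump_sq_le hn _).trans ?_
    refine mul_le_mul_of_nonneg_left ?_ zero_le_two
    rw [normL_sq, Finset.mul_sum]
    refine Finset.sum_le_sum fun i _ => ?_
    obtain ⟨x₀, hU⟩ := (hK i).isStarDomain hγ₀
    rw [Finset.sum_const, Finset.card_univ, nsmul_eq_mul,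
      ← sq_abs (adjTrace K n l i (H1.one (K i).isBounded))]
    gcongr
    · exact (hK i).card_le hγ₀ hγ₁
    · exact H1.abs_apply_one_le hU _
  have hjump := Finset.sum_le_sum fun e (_ : e ∈ edges K) =>
    norm_sub_sq_le_two_mul (jump K (fun i _ => H1.mean (u i)) e)
      (jump K (fun i _ => adjTrace K n l i (H1.one (K i).isBounded)) e)
  rw [Finset.sum_add_distrib, ← Finset.mul_sum, ← Finset.mul_sum] at hjump
  have h0 : 0 ≤ ∑ i, H1.seminorm (u i) ^ 2 := by positivity
  rw [normV_sq, normV_sq]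
  simp only [hmean, jump_sub (fun i _ => H1.mean (u i))]
  simp only [hi, H1.seminorm_sub_smul_one]
  linarith

theorem IsMesh.normL_add_smul_sq_le (hM : IsMesh Ω K) (hn : IsSkeletonNormal Ω K n) (hγ₀ : 0 < γ₀)
    (hγ₁ : 0 < γ₁) (hK : ∀ i, (K i).ShapeRegular γ₀ γ₁) (u : BrokenH1 K) (l : SkeletonL2 K)
    {δ : ℝ} (hδ : 0 ≤ δ) (hδ' : δ ≤ 1) :
    normL K n (l + δ • edgeConst K (jumpMultiplier K n u)) ^ 2 ≤
      2 * normL K n l ^ 2 + 2 * multiplierConst γ₀ γ₁ * normV K u ^ 2 := by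
  set μ := edgeConst K (jumpMultiplier K n u)
  have hi : ∀ i, H1.dualNorm (adjTrace K n (l + δ • μ) i) ^ 2 ≤
      2 * H1.dualNorm (adjTrace K n l i) ^ 2 +
      2 * (adjTrace K n μ i (H1.one (K i).isBounded) ^ 2 +
        H1.dualSeminorm (adjTrace K n μ i) ^ 2) := by
    intro i
    obtain ⟨x₀, hU⟩ := (hK i).isStarDomain hγ₀
    rw [adjTrace_add_smul l μ δ i]
    have h1 := H1.dualNorm_add_smul_le hU (adjTrace K n l i) (adjTrace K n μ i) hδ
    have h2 := H1.dualNorm_sq_le hU (adjTrace K n μ i)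
    have h3 := H1.dualNorm_nonneg (adjTrace K n (l + δ • μ) i)
    have h4 := H1.dualNorm_nonneg (adjTrace K n μ i)
    rw [adjTrace_add_smul l μ δ i] at h3
    have h5 : H1.dualNorm (adjTrace K n l i + δ • adjTrace K n μ i) ≤
        H1.dualNorm (adjTrace K n l i) + H1.dualNorm (adjTrace K n μ i) := by
      nlinarith
    nlinarith [sq_nonneg (H1.dualNorm (adjTrace K n l i) - H1.dualNorm (adjTrace K n μ i))]
  have hμ := hM.sum_apply_one_sq_add_dualSeminorm_sq_le hn hγ₀ hγ₁ hK u
  have hJ : ∑ e ∈ edges K, ‖jump K (fun i _ => H1.mean (u i)) e‖ ^ 2 ≤ normV K u ^ 2 := by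
    rw [normV_sq]
    exact le_add_of_nonneg_left (by positivity)
  have hκ : 0 ≤ multiplierConst γ₀ γ₁ := by unfold multiplierConst; positivity
  have h := Finset.sum_le_sum fun i (_ : i ∈ Finset.univ) => hi i
  rw [Finset.sum_add_distrib, ← Finset.mul_sum, ← Finset.mul_sum] at h
  rw [normL_sq, normL_sq]
  nlinarith [mul_le_mul_of_nonneg_left hJ hκ]

theorem adjTrace_zero (i : ι) : adjTrace K n (0 : SkeletonL2 K) i = 0 := by
  simp [adjTrace]

theorem bilinA_zero_right (s : StabForms K) (t α : ℝ) (x : BrokenH1 K × SkeletonL2 K) :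
    bilinA K n s t α x 0 = 0 := by
  have h : ∀ i, t • H1.D (0 : (K i).H1) - adjTrace K n (0 : SkeletonL2 K) i = 0 := fun i => by
    have : H1.D (0 : (K i).H1) = 0 := by simp [H1.D]
    rw [this, adjTrace_zero, smul_zero]
    exact sub_self (0 : H1.Dual (K i).carrier)
  have hs : ∀ i, s i (H1.D (x.1 i) - adjTrace K n x.2 i)
      (t • H1.D (0 : (K i).H1) - adjTrace K n (0 : SkeletonL2 K) i) = 0 := fun i => by
    rw [h]; exact (s i _).map_zero
  simp only [bilinA, jumpPairing_eq_sum, Prod.fst_zero, Prod.snd_zero, Pi.zero_apply, hs]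
  simp [adjTrace_zero]

/-- The inf-sup condition, with explicit constants. -/
theorem IsMesh.exists_test_pair (hM : IsMesh Ω K) (hn : IsSkeletonNormal Ω K n) (hγ₀ : 0 < γ₀)
    (hγ₁ : 0 < γ₁) (hK : ∀ i, (K i).ShapeRegular γ₀ γ₁) {k k' : ℕ} {s : StabForms K}
    {C M ρ t δ c₂ c₃ : ℝ} (hC : 0 < C) (hC' : C ≤ 1 / 6) (hρ : 0 < ρ)
    (ht : t = 1 ∨ t = -1) (hs : StabContinuous K s M) (hc : StabCoercive K n k' s ρ)
    (hδ : 0 ≤ δ) (hδ' : δ ≤ 1) (hδκ : 10 * (δ * multiplierConst γ₀ γ₁) ≤ 1)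
    (hc₂ : 0 < c₂) (hc₂C : c₂ ≤ C / 4) (hc₂δ : c₂ ≤ δ / 2) (hc₃ : 0 < c₃)
    (hc₃' : 2 * multiplierConst γ₀ γ₁ + 4 * (1 + 2 / γ₁) ^ 2 + 2 ≤ c₃ ^ 2)
    {x : BrokenH1 K × SkeletonL2 K} (hx : x ∈ discreteVL K k k') (hx0 : x ≠ 0) :
    ∃ y ∈ discreteVL K k k', y ≠ 0 ∧ c₂ / c₃ * (ρ / M) ^ 2 ≤
      bilinA K n s t (C * (ρ / M ^ 2)) x y / (normVL K n x * normVL K n y) := by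
  have hstar : ∀ i, ∃ x₀ r, IsStarDomain (K i).carrier x₀ r := fun i =>
    let ⟨x₀, h⟩ := (hK i).isStarDomain hγ₀
    ⟨x₀, _, h⟩
  -- Without elements the discrete space is trivial, contrary to `x ≠ 0`. An element is needed to
  -- derive `ρ ≤ M`.
  obtain ⟨i₀⟩ : Nonempty ι := by
    by_contra h
    rw [not_nonempty_iff] at h
    refine hx0 (Prod.ext (Subsingleton.elim _ _) (funext fun e => ?_))
    have := e.2
    simp [edges] at this
  have hρM := hc.le hn hstar hs i₀
  have hM0 : 0 < M := hρ.trans_le hρM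
  obtain ⟨u, l⟩ := x
  set μ := edgeConst K (jumpMultiplier K n u)
  set κ := multiplierConst γ₀ γ₁
  set J := ∑ e ∈ edges K, ‖jump K (fun i _ => H1.mean (u i)) e‖ ^ 2 with hJ
  set A := bilinA K n s t (C * (ρ / M ^ 2)) (u, l) (u - fluxFn n l, l + δ • μ) with hA
  set X := normVL K n (u, l) with hXdef
  set Y := normVL K n (u - fluxFn n l, l + δ • μ) with hYdef
  have hX : 0 < X := hM.normVL_pos hn hstar hx hx0
  have hr1 : (ρ / M) ^ 2 ≤ 1 := pow_le_one₀ (by positivity) ((div_le_one hM0).2 hρM)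
  have hr0 : 0 < (ρ / M) ^ 2 := by positivity
  have hJ0 : 0 ≤ J := by positivity
  have hmem : (u - fluxFn n l, l + δ • μ) ∈ discreteVL K k k' :=
    ⟨Submodule.sub_mem _ hx.1 (fluxFn_mem_discreteV l k),
      Submodule.add_mem _ hx.2 (Submodule.smul_mem _ δ (edgeConst_mem_discreteL _ k'))⟩
  have hlow : c₂ * (ρ / M) ^ 2 * X ^ 2 ≤ A := by
    have h1 := bilinA_test_ge hn hstar hC hC' hρ hρM hδ ht hs hc u hx.2
    have h2 := hM.sum_apply_one_sq_add_dualSeminorm_sq_le hn hγ₀ hγ₁ hK u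
    have h3 : ∑ i, H1.dualNorm (adjTrace K n l i) ^ 2 ≤
        ∑ i, (adjTrace K n l i (H1.one (K i).isBounded) ^ 2 +
          H1.dualSeminorm (adjTrace K n l i) ^ 2) :=
      Finset.sum_le_sum fun i _ => by
        obtain ⟨x₀, r, hU⟩ := hstar i
        exact H1.dualNorm_sq_le hU _
    rw [Finset.sum_add_distrib] at h2 h3
    rw [hXdef, normVL_sq, normV_sq, normL_sq]
    exact test_combination hδ hδκ hc₂ hc₂C hC' hc₂δ hr0 hr1
      (Finset.sum_nonneg fun _ _ => sq_nonneg _) (Finset.sum_nonneg fun _ _ => sq_nonneg _)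
      (Finset.sum_nonneg fun _ _ => sq_nonneg _) (Finset.sum_nonneg fun _ _ => sq_nonneg _)
      hJ0 h1 h2 h3
  -- Positivity of the form at the test pair also shows that this pair is nonzero, hence admissible.
  have hApos : 0 < A := lt_of_lt_of_le (by positivity) hlow
  have hy0 : (u - fluxFn n l, l + δ • μ) ≠ 0 := fun h => by
    rw [hA, h, bilinA_zero_right] at hApos
    exact lt_irrefl _ hApos
  have hY : 0 < Y := hM.normVL_pos hn hstar hmem hy0
  have hYX : Y ≤ c₃ * X := by
    have h1 := hM.normV_sub_fluxFn_sq_le hn hγ₀ hγ₁ hK u l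
    have h2 := hM.normL_add_smul_sq_le hn hγ₀ hγ₁ hK u l hδ hδ'
    have hκ : 0 ≤ κ := by simp only [κ, multiplierConst]; positivity
    refine le_of_pow_le_pow_left₀ two_ne_zero (by positivity) ?_
    rw [mul_pow, hYdef, hXdef, normVL_sq, normVL_sq]
    refine le_trans ?_ (mul_le_mul_of_nonneg_right hc₃' (by positivity))
    have h3 : 0 ≤ κ * normL K n l ^ 2 := by positivity
    have h4 : 0 ≤ (1 + 2 / γ₁) ^ 2 * normV K u ^ 2 := by positivity
    simp only
    linarith
  exact ⟨_, hmem, hy0, mul_le_div_of_test hc₂ hc₃ hr0.le hX hY hYX hlow⟩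

end Mesh

/-- Values in `EReal` give the supremum its usual meaning without a proof of boundedness, and make
the infimum over an empty index set `⊤`. -/
theorem mainTheorem4 (γ₀ γ₁ : ℝ) (hγ₀ : 0 < γ₀) (hγ₁ : 0 < γ₁) :
    ∃ C₀ : ℝ, 0 < C₀ ∧ ∀ C : ℝ, 0 < C → C ≤ C₀ → ∃ c : ℝ, 0 < c ∧
      ∀ (Ω : Set Plane), IsPolygonalDomain Ω →
      ∀ (ι : Type) [Fintype ι] (K : ι → MeshPolygon), IsMesh Ω K →
        (∀ i, (K i).ShapeRegular γ₀ γ₁) →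
      ∀ (n : Set Plane → Plane), IsSkeletonNormal Ω K n →
      ∀ (k k' : ℕ), (k' = k ∨ k' + 1 = k) →
      ∀ (s : StabForms K) (M ρ : ℝ), 0 < M → 0 < ρ →
        StabContinuous K s M → StabCoercive K n k' s ρ →
      ∀ (t : ℝ), (t = 1 ∨ t = -1) →
        ((c * (ρ / M) ^ 2 : ℝ) : EReal) ≤
          ⨅ x : {x : BrokenH1 K × SkeletonL2 K // x ∈ discreteVL K k k' ∧ x ≠ 0},
          ⨆ y : {y : BrokenH1 K × SkeletonL2 K // y ∈ discreteVL K k k' ∧ y ≠ 0},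
            ((bilinA K n s t (C * (ρ / M ^ 2)) x.1 y.1 /
              (normVL K n x.1 * normVL K n y.1) : ℝ) : EReal) := by
  set κ := multiplierConst γ₀ γ₁
  set N := (1 + 2 / γ₁) ^ 2
  have hκ : 0 ≤ κ := by simp only [κ, multiplierConst]; positivity
  have hN : 0 ≤ N := by positivity
  -- This gives both `δ ≤ 1` and `10 δ κ ≤ 1`, and depends only on `γ₀` and `γ₁`.
  set δ := 1 / (10 * (κ + 1)) with hδdef
  have hδ : 0 < δ := by positivity
  have hδκ : δ * (10 * (κ + 1)) = 1 := by rw [hδdef]; field_simp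
  refine ⟨1 / 6, by norm_num, fun C hC hC' => ?_⟩
  -- The numerator is the constant of the lower bound for the form at the test pair. The root bounds
  -- the norm of the test pair relative to that of the trial pair.
  refine ⟨min (C / 4) (δ / 2) / Real.sqrt (2 * κ + 4 * N + 2), by positivity, ?_⟩
  intro Ω _ ι _ K hM hK n hn k k' _ s M ρ _ hρ hs hc t ht
  refine le_iInf fun x => ?_
  obtain ⟨y, hy, hy0, h⟩ := hM.exists_test_pair hn hγ₀ hγ₁ hK hC hC' hρ ht hs hc hδ.le
    (by nlinarith) (by nlinarith) (lt_min (by positivity) (by positivity)) (min_le_left _ _)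
    (min_le_right _ _) (Real.sqrt_pos.2 (by positivity)) (Real.sq_sqrt (by positivity)).ge
    x.2.1 x.2.2
  exact le_iSup_of_le ⟨y, hy, hy0⟩ (EReal.coe_le_coe_iff.2 h)
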